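/- Let $a<b$ be real. For each $n\ge 1$ let $q_n\in\{1,\dots,n\}$ and let $x^{(n)}=(x^{(n)}_1>\cdots>x^{(n)}_n)$ be points of $[a,b]$. Let $\mu$ be a probability measure on $\mathbb R$ with support in $[a,b]$ that is not a point mass, and let $\alpha\in(0,1)$. Assume that $\frac1n\sum_{i=1}^n\delta_{x_i^{(n)}}\to\mu$ weakly and $q_n/n\to\alpha$ as $n\to\infty$. Choose a Gelfand–Tsetlin pattern of depth $n$ (an array $(y^{(1)},\dots,y^{(n)})$ with $y^{(r)}\in\mathbb R^r$ weakly decreasing and $y^{(r+1)}_i\ge y^{(r)}_i\ge y^{(r+1)}_{i+1}$) uniformly at random among those with fixed top level $y^{(n)}=x^{(n)}$. For $1\le r\le n-1$, $1\le s\le n$ and real $u,v$ put $$K_n((r,u),(s,v))=\sum_{j=1}^n \big(1_{v\le u<x_j^{(n)}}-1_{v>u>x_j^{(n)}}\big)\frac{(x_j^{(n)}-u)^{n-r-1}}{(n-r-1)!}\,\frac{\partial^{n-s}}{\partial v^{n-s}}\prod_{i\ne j}\frac{v-x_i^{(n)}}{x_j^{(n)}-x_i^{(n)}}.$$ Then,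 whenever $q_n<n$, the function $(u,v)\mapsto K_n((q_n,u),(q_n,v))$ is a correlation kernel, with respect to Lebesgue measure, of the particles $y^{(q_n)}$ on level $q_n$: for each $m\le q_n$ and each Borel set $B\subset\mathbb R^m$, the expected number of $m$-tuples of particles with distinct labels lying in $B$ is $\int_B\det[K_n((q_n,y_i),(q_n,y_j))]_{i,j=1}^m\,dy$. Let $G_\mu(w)=\int\frac{\mu(dx)}{w-x}$ for $w\in\mathbb C\setminus\mathbb R$, and let $A_\alpha$ be the set of $c\in(a,b)$ for which some $w\in\mathbb C\setminus\mathbb R$ satisfies $wG_\mu(w+c)=1-\alpha$. Then for every $c\in A_\alpha$ there is $w_{\alpha,c}\in\mathbb C$ with $\operatorname{Im}w_{\alpha,c}>0$ and $$\{w\in\mathbb C\setminus\mathbb R: wG_\mu(w+c)=1-\alpha\}=\{w_{\alpha,c},\overline{w_{\alpha,c}}\}.$$ Moreover, with $\rho_\alpha(c)=-\frac{1-\alpha}{\pi}\operatorname{Im}(w_{\alpha,c}^{-1})$ and $C_{\alpha,c}=\exp\big(\pi\,\frac{\operatorname{Re}(w_{\alpha,c}^{-1})}{\operatorname{Im}(w_{\alpha,c}^{-1})}\big)$,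 for all compact $U,V\subset\mathbb R$, $$\lim_{n\to\infty}\sup_{u\in U,\,v\in V}\left|\frac{(C_{\alpha,c})^{v-u}}{n\rho_\alpha(c)}K_n\Big(\big(q_n,c+\tfrac{u}{n\rho_\alpha(c)}\big),\big(q_n,c+\tfrac{v}{n\rho_\alpha(c)}\big)\Big)-\frac{\sin(\pi(v-u))}{\pi(v-u)}\right|=0,$$ where $\frac{\sin(\pi(v-u))}{\pi(v-u)}$ is read as $1$ for $u=v$. -/

import Mathlib

open MeasureTheory Filter Topology

namespace GelfandTsetlin

/-! ### Gelfand–Tsetlin patterns and the uniform measure with a fixed top level -/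

/-- Triangular arrays of depth `n`. The index `r : Fin n` stands for level `r + 1`, which carries
`r + 1` real numbers. -/
abbrev TriArray (n : ℕ) : Type := (r : Fin n) → Fin (r.val + 1) → ℝ

/-- The Gelfand–Tsetlin patterns of depth `n`: every level is weakly decreasing and neighbouring
levels interlace. -/
def patterns (n : ℕ) : Set (TriArray n) :=
  {y | (∀ r : Fin n, Antitone (y r)) ∧
    ∀ (r : ℕ) (h : r + 1 < n) (i : Fin (r + 1)),
      y ⟨r, Nat.lt_of_succ_lt h⟩ i ≤ y ⟨r + 1, h⟩ i.castSucc ∧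
      y ⟨r + 1, h⟩ i.succ ≤ y ⟨r, Nat.lt_of_succ_lt h⟩ i}

/-- The reference measure on one level: the point mass at `x` on the top level, Lebesgue measure
on all lower levels. -/
noncomputable def levelMeasure {n : ℕ} (x : Fin n → ℝ) (r : Fin n) :
    Measure (Fin (r.val + 1) → ℝ) :=
  if h : r.val + 1 = n then Measure.dirac (fun i => x (Fin.cast h i)) else volume

/-- The uniform probability distribution on the Gelfand–Tsetlin patterns of depth `n` with top
level `x`: the product of the level measures, restricted to the set of patterns and normalised. -/
noncomputable def uniformPattern {n : ℕ} (x : Fin n → ℝ) : Measure (TriArray n) :=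
  ProbabilityTheory.cond (Measure.pi (levelMeasure x)) (patterns n)

/-! ### Correlation measures and correlation kernels -/

/-- The `m`-th correlation measure of the random configuration `X` of `N` real particles:
the measure of a Borel set `B` is the expected number of `m`-tuples of particles with pairwise
distinct labels which lie in `B`. -/
noncomputable def correlationMeasure {Ω : Type*} [MeasurableSpace Ω] (P : Measure Ω) {N : ℕ}
    (X : Ω → Fin N → ℝ) (m : ℕ) : Measure (Fin m → ℝ) :=
  ∑ σ : Fin m ↪ Fin N, P.map (fun ω k => X ω (σ k))

/-- `K` is a correlation kernel of the random configuration `X` of `N` real particles: for every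
`m ≤ N` the `m`-th correlation measure has the integrable Lebesgue density
`det [K (y_i, y_j)]`. -/
def IsCorrelationKernel {Ω : Type*} [MeasurableSpace Ω] (P : Measure Ω) {N : ℕ}
    (X : Ω → Fin N → ℝ) (K : ℝ → ℝ → ℝ) : Prop :=
  ∀ m ≤ N,
    let ρ : (Fin m → ℝ) → ℝ := fun y => (Matrix.of fun i j => K (y i) (y j)).det
    Integrable ρ ∧ 0 ≤ᵐ[volume] ρ ∧
      correlationMeasure P X m = volume.withDensity (fun y => ENNReal.ofReal (ρ y))

/-- The kernel `K_n((r,u),(s,v))` associated with the top level `x`, for levels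
`1 ≤ r ≤ n - 1` and `1 ≤ s ≤ n`. -/
noncomputable def kernel {n : ℕ} (x : Fin n → ℝ) (r s : ℕ) (u v : ℝ) : ℝ :=
  (∑ j : Fin n, if v ≤ u ∧ u < x j then
      (x j - u) ^ (n - r - 1) / ((n - r - 1).factorial : ℝ) *
        iteratedDeriv (n - s)
          (fun t : ℝ => ∏ i ∈ Finset.univ.erase j, (t - x i) / (x j - x i)) v
    else 0) -
  ∑ j : Fin n, if u < v ∧ x j < u then
      (x j - u) ^ (n - r - 1) / ((n - r - 1).factorial : ℝ) *
        iteratedDeriv (n - s)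
          (fun t : ℝ => ∏ i ∈ Finset.univ.erase j, (t - x i) / (x j - x i)) v
    else 0

/-! ### The limiting objects -/

/-- The empirical measure `(1/n) ∑ δ_{x_i}`. -/
noncomputable def empiricalMeasure {n : ℕ} (x : Fin n → ℝ) : Measure ℝ :=
  (n : ENNReal)⁻¹ • ∑ i : Fin n, Measure.dirac (x i)

/-- The Cauchy transform of `μ`, used for non-real `w` only. -/
noncomputable def cauchyTransform (μ : Measure ℝ) (w : ℂ) : ℂ :=
  ∫ x : ℝ, 1 / (w - (x : ℂ)) ∂μ

/-- The non-real solutions `w` of `w G_μ(w + c) = 1 - α`. -/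
def solutions (μ : Measure ℝ) (α c : ℝ) : Set ℂ :=
  {w : ℂ | w.im ≠ 0 ∧ w * cauchyTransform μ (w + (c : ℂ)) = 1 - (α : ℂ)}

/-- The set `A_α` of those `c ∈ (a, b)` for which there is a non-real solution. -/
def bulkSet (μ : Measure ℝ) (α a b : ℝ) : Set ℝ :=
  {c : ℝ | c ∈ Set.Ioo a b ∧ (solutions μ α c).Nonempty}

/-- The density `-((1 - α)/π) Im(w⁻¹)`. -/
noncomputable def density (α : ℝ) (w : ℂ) : ℝ := -((1 - α) / Real.pi) * (w⁻¹).im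

/-- The gauge constant `exp (π Re(w⁻¹) / Im(w⁻¹))`. -/
noncomputable def gauge (w : ℂ) : ℝ := Real.exp (Real.pi * ((w⁻¹).re / (w⁻¹).im))

end GelfandTsetlin

/-! Correlation kernel. Given one level, the levels below and above it are independent, so its law
has density proportional to the volume of patterns below times the volume of patterns above. The
first is a Vandermonde determinant (`lowerVolume_eq`), the second a determinant of splines built
from (x_i - t)_+^m with m = n - q - 1 (`upperVolume_eq`). The spline coefficients are derivatives of
the Lagrange basis at a point L below all nodes, which makes the splines biorthonormal to the
functions (t - L)^k / k! (`biorthonormal_spline`). The level is thus a biorthogonal ensemble, and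
its lower correlations follow by integrating out particles (`isCorrelationKernel_sumKernel`). Taylor
expansion at L identifies the resulting kernel with K_n when u is not a node
(`kernel_eq_sumKernel`).

Sine limit. Recentre at v, so that the nodes are d_j = x_j - v and u - v, from now on called u, is
of order 1/n; put k = n - q - 1 and P(w) = ∏ (w - d_j). Cauchy's formula turns K_n into an integral
over a half circle |w| = R of P(w) S(w) w^{-(k+1)}, where S collects the partial fractions of H(z) =
(z - u)^k / P(z) at nodes above u (`kernel_eq_integral`). The modulus of P(w) / w^{k+1} is exp(N ·
`pot`), and R is taken to be |W| for a critical point W of the potential near the given solution w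
(`Scaling.exists_tendsto_crit_eq_zero`). On the circle |w - t|² is affine in Re w, which makes W a
maximum there (`norm_prod_sub_le_of_norm_eq`); along the ray through W the potential has a strict
minimum near W (`Scaling.exists_pot_ray_ge`).

S(w) is a contour integral of H(z) / (z - w) around the nodes above u. The contour is a path from u
to infinity in the upper half plane, crossing the circle along the ray through W, together with its
conjugate. If the rest of the path stays where the potential exceeds its critical value, the
integral is of order exp(-N · pot(W)) up to a mild singularity as w approaches W, and the residue at
w adds H(w) exactly when arg w < arg W. Such paths exist because, inside and outside the circle, the
superlevel set of the limiting potential is connected: its slice by each circle is an arc by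
concavity, and is nonempty by the maximum principle on an annulus (`Scaling.exists_limPot_gt`). The
same principle gives uniqueness of the critical point (`Scaling.isCritical_unique`). Explicit
primitives replace path integrals throughout (`contourValue`,
`BulkScaling.exists_contourValue_bound`).

Up to an error that tends to zero and is dominated by a multiple of 1 + |θ - arg W|^{-1/2}, the
integrand is therefore (w - u)^k w^{-(k+1)} for arg w < arg W and zero otherwise
(`BulkScaling.exists_kernelIntegrand_bound`). Dominated convergence leaves the integral of z^{-1}
exp(-κ/z) over an arc ending at the solution w. This is an exact derivative, and its endpoint value
is the sine kernel times the gauge factor (`integral_limitIntegrand`). -/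

namespace GelfandTsetlin

/-! ### Dual coefficients of Lagrange interpolation, truncated powers and splines. -/

open Polynomial in
/-- The `l`-th derivative at `L` of the `i`-th Lagrange basis polynomial with nodes `x`. -/
noncomputable def dualCoeff {n : ℕ} (x : Fin n → ℝ) (L : ℝ) (l : ℕ) (i : Fin n) : ℝ :=
  (derivative^[l] (Lagrange.basis Finset.univ x i)).eval L

open Polynomial in
theorem sum_eval_smul_basis {n : ℕ} {x : Fin n → ℝ} (hx : Function.Injective x) {p : ℝ[X]}
    (hp : p.degree < n) : ∑ i, C (p.eval (x i)) * Lagrange.basis Finset.univ x i = p := by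
  have := Lagrange.eq_interpolate (s := Finset.univ) (v := x) (f := p) (hx.injOn) (by simpa using hp)
  conv_rhs => rw [this]
  simp [Lagrange.interpolate_apply]

open Polynomial in
theorem sum_eval_iterate_derivative_basis {n : ℕ} {x : Fin n → ℝ} (hx : Function.Injective x)
    {p : ℝ[X]} (hp : p.degree < n) (l : ℕ) (L : ℝ) :
    ∑ i, (derivative^[l] (Lagrange.basis Finset.univ x i)).eval L * p.eval (x i) =
      (derivative^[l] p).eval L := by
  conv_rhs => rw [← sum_eval_smul_basis hx hp]
  rw [iterate_derivative_sum, eval_finsetSum]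
  refine Finset.sum_congr rfl fun i _ => ?_
  rw [iterate_derivative_C_mul, eval_C_mul, mul_comm]

open Polynomial in
theorem sum_dualCoeff_mul_eval {n : ℕ} {x : Fin n → ℝ} (hx : Function.Injective x)
    {p : ℝ[X]} (hp : p.degree < n) (l : ℕ) (L : ℝ) :
    ∑ i, dualCoeff x L l i * p.eval (x i) = (derivative^[l] p).eval L :=
  sum_eval_iterate_derivative_basis hx hp l L

open Polynomial in
-- Interpolation reproduces (X - L)^k / k!, and its l-th derivative at L is a Kronecker delta. The
-- dual coefficients therefore invert the scaled Vandermonde matrix; all biorthogonality comes from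
-- this.
theorem sum_dualCoeff_mul_pow {n : ℕ} {x : Fin n → ℝ} (hx : Function.Injective x) {k l : ℕ}
    (hk : k < n) (L : ℝ) :
    ∑ i, dualCoeff x L l i * ((x i - L) ^ k / (k.factorial : ℝ)) = if l = k then 1 else 0 := by
  have hdeg : (C ((k.factorial : ℝ)⁻¹) * (X - C L) ^ k).degree < (n : WithBot ℕ) := by
    have : (k.factorial : ℝ)⁻¹ ≠ 0 := by positivity
    rw [degree_C_mul this, degree_pow, degree_X_sub_C]
    simpa using hk
  have := sum_dualCoeff_mul_eval hx hdeg l L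
  rw [iterate_derivative_C_mul, iterate_derivative_X_sub_pow] at this
  have h2 : ∀ i, (C ((k.factorial : ℝ)⁻¹) * (X - C L) ^ k).eval (x i)
      = (x i - L) ^ k / (k.factorial : ℝ) := by
    intro i; simp [div_eq_inv_mul]
  simp only [h2] at this
  rw [this]
  have hf : (k.factorial : ℝ) ≠ 0 := by positivity
  split_ifs with h
  · subst h; simp [Nat.descFactorial_self, hf]
  · rcases lt_or_gt_of_ne h with h | h
    · have : k - l ≠ 0 := by omega
      simp [this]
    · simp [Nat.descFactorial_of_lt h]

open Polynomial in
-- The l-th derivative kills the interpolated polynomial, whose degree is k < l. This makes the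
-- splines vanish to the left of the nodes.
theorem sum_dualCoeff_mul_sub_pow {n : ℕ} {x : Fin n → ℝ} (hx : Function.Injective x) {k l : ℕ}
    (hk : k < n) (hkl : k < l) (L t : ℝ) :
    ∑ i, dualCoeff x L l i * (x i - t) ^ k = 0 := by
  have hdeg : ((X - C t) ^ k).degree < (n : WithBot ℕ) := by
    rw [degree_pow, degree_X_sub_C]
    simpa using hk
  have := sum_dualCoeff_mul_eval hx hdeg l L
  rw [iterate_derivative_X_sub_pow, Nat.descFactorial_of_lt hkl] at this
  simpa using this

/-- The normalised truncated power `t₊ᵏ / k!`. -/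
noncomputable def truncPow (k : ℕ) (t : ℝ) : ℝ := if 0 < t then t ^ k / (k.factorial : ℝ) else 0

theorem truncPow_of_pos {k : ℕ} {t : ℝ} (h : 0 < t) : truncPow k t = t ^ k / (k.factorial : ℝ) :=
  if_pos h

theorem truncPow_of_nonpos {k : ℕ} {t : ℝ} (h : t ≤ 0) : truncPow k t = 0 := if_neg (not_lt.2 h)

theorem measurable_truncPow (k : ℕ) : Measurable (truncPow k) :=
  Measurable.ite measurableSet_Ioi (by fun_prop) measurable_const

/-- A Beta integral: integration by parts lowers k and raises j, hence the induction with j free. -/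
theorem intervalIntegral_pow_mul_pow (L y : ℝ) (k j : ℕ) :
    ∫ t in L..y, (y - t) ^ k / (k.factorial : ℝ) * ((t - L) ^ j / (j.factorial : ℝ)) =
      (y - L) ^ (k + 1 + j) / ((k + 1 + j).factorial : ℝ) := by
  induction k generalizing j with
  | zero =>
    have hd : ∀ t ∈ Set.uIcc L y, HasDerivAt
        (fun t : ℝ => (t - L) ^ (j + 1) / ((j + 1).factorial : ℝ))
        ((y - t) ^ 0 / (Nat.factorial 0 : ℝ) * ((t - L) ^ j / (j.factorial : ℝ))) t := by
      intro t _
      have := (((hasDerivAt_id t).sub_const L).pow (j + 1)).div_const ((j + 1).factorial : ℝ)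
      refine this.congr_deriv ?_
      rw [Nat.factorial_succ]
      push_cast
      have : (j.factorial : ℝ) ≠ 0 := by positivity
      field_simp
      simp
    rw [intervalIntegral.integral_eq_sub_of_hasDerivAt hd
      (Continuous.intervalIntegrable (by fun_prop) _ _)]
    simp [add_comm]
  | succ k ih =>
    have hu : ∀ t ∈ Set.uIcc L y, HasDerivAt
        (fun t : ℝ => (y - t) ^ (k + 1) / ((k + 1).factorial : ℝ))
        (-((y - t) ^ k / (k.factorial : ℝ))) t := by
      intro t _
      have := (((hasDerivAt_id t).const_sub y).pow (k + 1)).div_const ((k + 1).factorial : ℝ)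
      refine this.congr_deriv ?_
      rw [Nat.factorial_succ]
      push_cast
      have : (k.factorial : ℝ) ≠ 0 := by positivity
      field_simp
      simp
    have hv : ∀ t ∈ Set.uIcc L y, HasDerivAt
        (fun t : ℝ => (t - L) ^ (j + 1) / ((j + 1).factorial : ℝ))
        ((t - L) ^ j / (j.factorial : ℝ)) t := by
      intro t _
      have := (((hasDerivAt_id t).sub_const L).pow (j + 1)).div_const ((j + 1).factorial : ℝ)
      refine this.congr_deriv ?_
      rw [Nat.factorial_succ]
      push_cast
      have : (j.factorial : ℝ) ≠ 0 := by positivity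
      field_simp
      simp
    have := intervalIntegral.integral_mul_deriv_eq_deriv_mul hu hv
      (Continuous.intervalIntegrable (by fun_prop) _ _)
      (Continuous.intervalIntegrable (by fun_prop) _ _)
    rw [this]
    simp only [neg_mul, intervalIntegral.integral_neg, ih]
    simp
    ring_nf

theorem truncPow_mul_eq_indicator (k : ℕ) (L y : ℝ) (f : ℝ → ℝ) :
    Set.EqOn (fun t => truncPow k (y - t) * f t)
      ((Set.Iio y).indicator fun t => (y - t) ^ k / (k.factorial : ℝ) * f t) (Set.Ioi L) := by
  intro t _
  by_cases h : t < y
  · rw [Set.indicator_of_mem (Set.mem_Iio.2 h)]; simp only [truncPow_of_pos (sub_pos.2 h)]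
  · rw [Set.indicator_of_notMem (fun h' => h (Set.mem_Iio.1 h'))]; simp only [truncPow_of_nonpos (sub_nonpos.2 (not_lt.1 h)), zero_mul]

theorem integrableOn_truncPow_mul (k : ℕ) (L y : ℝ) {f : ℝ → ℝ} (hf : Continuous f) :
    IntegrableOn (fun t => truncPow k (y - t) * f t) (Set.Ioi L) := by
  rw [integrableOn_congr_fun (truncPow_mul_eq_indicator k L y f) measurableSet_Ioi,
    IntegrableOn, integrable_indicator_iff measurableSet_Iio, IntegrableOn,
    Measure.restrict_restrict measurableSet_Iio, Set.inter_comm, Set.Ioi_inter_Iio]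
  exact (Continuous.integrableOn_Icc (by fun_prop)).mono_set Set.Ioo_subset_Icc_self

theorem integral_Ioi_truncPow_mul (k j : ℕ) (L y : ℝ) :
    ∫ t in Set.Ioi L, truncPow k (y - t) * ((t - L) ^ j / (j.factorial : ℝ)) =
      truncPow (k + 1 + j) (y - L) := by
  rw [setIntegral_congr_fun measurableSet_Ioi (truncPow_mul_eq_indicator k L y _),
    setIntegral_indicator measurableSet_Iio, Set.Ioi_inter_Iio]
  by_cases h : L < y
  · rw [truncPow_of_pos (sub_pos.2 h), ← intervalIntegral_pow_mul_pow,
      intervalIntegral.integral_of_le h.le, integral_Ioc_eq_integral_Ioo]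
  · rw [truncPow_of_nonpos (sub_nonpos.2 (not_lt.1 h)), Set.Ioo_eq_empty h]; simp

/-- Linear combinations of truncated powers with the coefficients `dualCoeff`. -/
noncomputable def spline {n : ℕ} (x : Fin n → ℝ) (L : ℝ) (k l : ℕ) (t : ℝ) : ℝ :=
  ∑ i, dualCoeff x L l i * truncPow k (x i - t)

section spline

variable {n : ℕ} {x : Fin n → ℝ} {L : ℝ} {k l : ℕ}

theorem measurable_spline : Measurable (spline x L k l) :=
  Finset.measurable_sum _ fun _ _ =>
    ((measurable_truncPow k).comp (measurable_const.sub measurable_id)).const_mul _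

/-- To the left of every node no truncation is active, and the coefficients annihilate polynomials
of degree below l. -/
theorem spline_of_lt (hx : Function.Injective x) (hk : k < n) (hkl : k < l) {t : ℝ}
    (ht : ∀ i, t < x i) : spline x L k l t = 0 := by
  have h := sum_dualCoeff_mul_sub_pow hx hk hkl L t
  have : spline x L k l t = (∑ i, dualCoeff x L l i * (x i - t) ^ k) / (k.factorial : ℝ) := by
    rw [spline, Finset.sum_div]
    exact Finset.sum_congr rfl fun i _ => by rw [truncPow_of_pos (sub_pos.2 (ht i)), mul_div_assoc]
  rw [this, h, zero_div]

theorem integrableOn_Ioi_spline_mul (t : ℝ) {f : ℝ → ℝ} (hf : Continuous f) :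
    IntegrableOn (fun s => spline x L k l s * f s) (Set.Ioi t) := by
  simp only [spline, Finset.sum_mul, mul_assoc]
  exact integrable_finsetSum _ fun i _ =>
    Integrable.const_mul (integrableOn_truncPow_mul k t (x i) hf) _

theorem integrable_spline_mul (hx : Function.Injective x) (hk : k < n) (hkl : k < l)
    {f : ℝ → ℝ} (hf : Continuous f) : Integrable (fun s => spline x L k l s * f s) := by
  obtain ⟨t, ht⟩ : ∃ t, ∀ i, t < x i := by
    obtain ⟨t, ht⟩ := (Set.finite_range x).bddBelow
    exact ⟨t - 1, fun i => lt_of_lt_of_le (by linarith) (ht ⟨i, rfl⟩)⟩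
  refine (integrableOn_Ioi_spline_mul t hf).integrable_of_forall_notMem_eq_zero fun s hs => ?_
  rw [spline_of_lt hx hk hkl, zero_mul]
  exact fun i => lt_of_le_of_lt (by simpa using hs) (ht i)

theorem integrable_spline (hx : Function.Injective x) (hk : k < n) (hkl : k < l) :
    Integrable (spline x L k l) := by
  simpa using integrable_spline_mul hx hk hkl (L := L) (f := fun _ => 1) continuous_const

theorem integral_Ioi_spline (t : ℝ) :
    ∫ s in Set.Ioi t, spline x L k l s = spline x L (k + 1) l t := by
  simp only [spline]
  rw [integral_finsetSum]
  · refine Finset.sum_congr rfl fun i _ => ?_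
    rw [integral_const_mul]
    congr 1
    simpa using integral_Ioi_truncPow_mul k 0 t (x i)
  · intro i _
    simpa using (integrableOn_truncPow_mul k t (x i) (f := fun _ => 1) continuous_const).const_mul
      (dualCoeff x L l i)

/-- Integrating a truncated power against a monomial gives a truncated power of higher degree. Since
L lies below the nodes the truncation is invisible there, and the inverse Vandermonde relation
applies. -/
theorem integral_spline_mul_pow (hx : Function.Injective x) (hk : k < n) (hkl : k < l)
    (hL : ∀ i, L ≤ x i) {j : ℕ} (hj : k + 1 + j < n) :
    ∫ s, spline x L k l s * ((s - L) ^ j / (j.factorial : ℝ)) =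
      if l = k + 1 + j then 1 else 0 := by
  have h0 : ∀ s ∉ Set.Ici L, spline x L k l s * ((s - L) ^ j / (j.factorial : ℝ)) = 0 :=
    fun s hs => by
      rw [spline_of_lt hx hk hkl, zero_mul]
      exact fun i => lt_of_lt_of_le (by simpa using hs) (hL i)
  rw [← setIntegral_eq_integral_of_forall_compl_eq_zero h0, integral_Ici_eq_integral_Ioi]
  simp only [spline, Finset.sum_mul, mul_assoc]
  rw [integral_finsetSum]
  · rw [← sum_dualCoeff_mul_pow hx hj L (l := l)]
    refine Finset.sum_congr rfl fun i _ => ?_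
    rw [integral_const_mul, integral_Ioi_truncPow_mul]
    congr 1
    rcases (hL i).lt_or_eq with h | h
    · rw [truncPow_of_pos (sub_pos.2 h)]
    -- A node equal to L does no harm, because the exponent k + 1 + j is positive.
    · rw [truncPow_of_nonpos (by linarith), ← h]; simp
  · intro i _
    exact (integrableOn_truncPow_mul k L (x i) (by fun_prop)).const_mul _

theorem integral_spline (hx : Function.Injective x) (hkl : k < l) (hL : ∀ i, L ≤ x i)
    (hk : k + 1 < n) : ∫ s, spline x L k l s = if l = k + 1 then 1 else 0 := by
  simpa using integral_spline_mul_pow hx (by omega) hkl hL (j := 0) (by omega)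

end spline

/-- Subtracting consecutive rows of a matrix whose first column is constant one. -/
theorem det_of_first_column_one {N : ℕ} (A : Matrix (Fin (N + 1)) (Fin (N + 1)) ℝ)
    (hA : ∀ i, A i 0 = 1) :
    A.det = (-1) ^ N *
      (Matrix.of fun i j : Fin N => A i.castSucc j.succ - A i.succ j.succ).det := by
  let B : Matrix (Fin (N + 1)) (Fin (N + 1)) ℝ :=
    Matrix.of fun i j => Fin.cases (A 0 j) (fun i' => A i'.succ j - A i'.castSucc j) i
  have h1 : A.det = B.det := by
    refine Matrix.det_eq_of_forall_row_eq_smul_add_pred (fun _ => 1) (fun j => ?_) (fun i j => ?_)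
    · simp [B]
    · simp [B]
  rw [h1, Matrix.det_succ_column_zero, Fin.sum_univ_succ]
  have h2 : ∀ i : Fin N, B i.succ 0 = 0 := fun i => by simp [B, hA]
  have h3 : B 0 0 = 1 := by simp [B, hA]
  simp only [h2, h3, mul_zero, zero_mul, Finset.sum_const_zero, add_zero]
  have h4 : B.submatrix (Fin.succAbove 0) Fin.succ =
      -(Matrix.of fun i j : Fin N => A i.castSucc j.succ - A i.succ j.succ) := by
    ext i j
    simp [B]
  rw [h4, Matrix.det_neg]
  simp

end GelfandTsetlin

/-! ### Volumes of patterns below and above a level as determinants. -/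

namespace GelfandTsetlin

/-- Two neighbouring levels interlace. -/
def Interlaces {N : ℕ} (y : Fin N → ℝ) (z : Fin (N + 1) → ℝ) : Prop :=
  ∀ i : Fin N, y i ≤ z i.castSucc ∧ z i.succ ≤ y i

theorem Interlaces.antitone_left {N : ℕ} {y : Fin (N + 1) → ℝ} {z : Fin (N + 2) → ℝ}
    (h : Interlaces y z) : Antitone y :=
  Fin.antitone_iff_succ_le.2 fun i => (h i.succ).1.trans (h i.castSucc).2

theorem Interlaces.antitone_right {N : ℕ} {y : Fin N → ℝ} {z : Fin (N + 1) → ℝ}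
    (h : Interlaces y z) : Antitone z :=
  Fin.antitone_iff_succ_le.2 fun i => (h i).2.trans (h i).1

theorem measurableSet_interlaces (N : ℕ) :
    MeasurableSet {p : (Fin N → ℝ) × (Fin (N + 1) → ℝ) | Interlaces p.1 p.2} := by
  have : {p : (Fin N → ℝ) × (Fin (N + 1) → ℝ) | Interlaces p.1 p.2} =
      ⋂ i : Fin N, {p | p.1 i ≤ p.2 i.castSucc} ∩ {p | p.2 i.succ ≤ p.1 i} := by
    ext p; simp [Interlaces]
  rw [this]
  exact MeasurableSet.iInter fun i =>
    (measurableSet_le (by fun_prop) (by fun_prop)).inter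
      (measurableSet_le (by fun_prop) (by fun_prop))

theorem integrable_det_restrict_pi {N : ℕ} (I : Fin N → Set ℝ) (f : Fin N → ℝ → ℝ)
    (hf : ∀ i j, IntegrableOn (f j) (I i)) :
    IntegrableOn (fun y : Fin N → ℝ => (Matrix.of fun i j => f j (y i)).det)
      (Set.univ.pi I) := by
  rw [IntegrableOn, volume_pi, Measure.restrict_pi_pi]
  simp only [← Matrix.det_transpose (Matrix.of fun i j => f j _), Matrix.det_apply',
    Matrix.transpose_apply, Matrix.of_apply]
  exact integrable_finsetSum _ fun σ _ =>
    (Integrable.fintype_prod (f := fun i => f (σ i)) fun i => hf i (σ i)).const_mul _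

theorem setIntegral_det_pi {N : ℕ} (I : Fin N → Set ℝ) (f : Fin N → ℝ → ℝ)
    (hf : ∀ i j, IntegrableOn (f j) (I i)) :
    ∫ y in Set.univ.pi I, (Matrix.of fun i j => f j (y i)).det =
      (Matrix.of fun i j => ∫ t in I i, f j t).det := by
  rw [volume_pi, Measure.restrict_pi_pi]
  simp only [← Matrix.det_transpose (Matrix.of fun i j => _), Matrix.det_apply',
    Matrix.transpose_apply, Matrix.of_apply]
  rw [integral_finsetSum]
  · refine Finset.sum_congr rfl fun σ _ => ?_
    rw [integral_const_mul]
    congr 1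
    exact integral_fintype_prod_eq_prod (fun i => f (σ i))
  · exact fun σ _ =>
      (Integrable.fintype_prod (f := fun i => f (σ i)) fun i => hf i (σ i)).const_mul _

/-- Carries one step of a recursion for `ENNReal` volumes over to real determinants. Nonnegativity
travels along, so the signs of the determinants need no separate study. -/
theorem lintegral_indicator_eq_ofReal {X : Type*} [MeasurableSpace X] {μ : Measure X} {S : Set X}
    (hS : MeasurableSet S) {F : X → ENNReal} {D : X → ℝ} (hD : IntegrableOn D S μ)
    (h : ∀ᵐ y ∂μ, y ∈ S → 0 ≤ D y ∧ F y = ENNReal.ofReal (D y)) :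
    0 ≤ ∫ y in S, D y ∂μ ∧ ∫⁻ y, S.indicator F y ∂μ = ENNReal.ofReal (∫ y in S, D y ∂μ) := by
  have h' : ∀ᵐ y ∂μ.restrict S, 0 ≤ D y ∧ F y = ENNReal.ofReal (D y) :=
    (ae_restrict_iff' hS).2 h
  refine ⟨integral_nonneg_of_ae (h'.mono fun y hy => hy.1), ?_⟩
  rw [lintegral_indicator hS, ofReal_integral_eq_lintegral_ofReal hD (h'.mono fun y hy => hy.1)]
  exact lintegral_congr_ae (h'.mono fun y hy => hy.2)

/-- The volume of the set of patterns below a level with `k + 1` particles. -/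
noncomputable def lowerVolume : (k : ℕ) → (Fin (k + 1) → ℝ) → ENNReal
  | 0, _ => 1
  | k + 1, z => ∫⁻ y : Fin (k + 1) → ℝ, {y | Interlaces y z}.indicator (lowerVolume k) y

/-- The interlacing region is a box, so the determinant is integrated row by row. Each row becomes a
difference of consecutive values of the next monomials, which is the row reduction of the larger
Vandermonde matrix. Only γ ≠ 0 matters, since the normalisation fixes the constant later. -/
theorem lowerVolume_eq (L : ℝ) (k : ℕ) : ∃ γ : ℝ, γ ≠ 0 ∧ ∀ z : Fin (k + 1) → ℝ, Antitone z →
    0 ≤ γ * (Matrix.of fun i j : Fin (k + 1) =>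
      (z i - L) ^ (j : ℕ) / ((j : ℕ).factorial : ℝ)).det ∧
    lowerVolume k z = ENNReal.ofReal (γ * (Matrix.of fun i j : Fin (k + 1) =>
      (z i - L) ^ (j : ℕ) / ((j : ℕ).factorial : ℝ)).det) := by
  induction k with
  | zero => exact ⟨1, one_ne_zero, fun z _ => by simp [lowerVolume]⟩
  | succ k ih =>
    obtain ⟨γ, hγ, h⟩ := ih
    refine ⟨γ * (-1) ^ (k + 1), mul_ne_zero hγ (by simp), fun z hz => ?_⟩
    let I : Fin (k + 1) → Set ℝ := fun i => Set.Icc (z i.succ) (z i.castSucc)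
    have hset : {y : Fin (k + 1) → ℝ | Interlaces y z} = Set.univ.pi I := by
      ext y
      simp only [Interlaces, Set.mem_ofPred_eq, Set.mem_pi, Set.mem_univ, forall_const, I,
        Set.mem_Icc]
      exact forall_congr' fun i => and_comm
    let f : Fin (k + 1) → ℝ → ℝ := fun j t => (t - L) ^ (j : ℕ) / ((j : ℕ).factorial : ℝ)
    have hf : ∀ i j, IntegrableOn (f j) (I i) := fun i j =>
      Continuous.integrableOn_Icc (by fun_prop)
    have hI := (integrable_det_restrict_pi I f hf).const_mul γ
    have key := lintegral_indicator_eq_ofReal (F := lowerVolume k)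
      (MeasurableSet.univ_pi fun i => measurableSet_Icc) hI
      (Eventually.of_forall fun y hy => h y (Interlaces.antitone_left (z := z)
        (show y ∈ {y | Interlaces y z} by rw [hset]; exact hy)))
    have hval : ∫ y in Set.univ.pi I, γ * (Matrix.of fun i j => f j (y i)).det =
        γ * (-1) ^ (k + 1) * (Matrix.of fun i j : Fin (k + 1 + 1) =>
          (z i - L) ^ (j : ℕ) / ((j : ℕ).factorial : ℝ)).det := by
      rw [integral_const_mul, setIntegral_det_pi I f hf,
        det_of_first_column_one (Matrix.of fun i j : Fin (k + 1 + 1) =>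
          (z i - L) ^ (j : ℕ) / ((j : ℕ).factorial : ℝ)) (fun i => by simp),
        mul_assoc, ← mul_assoc ((-1 : ℝ) ^ (k + 1)), ← mul_pow]
      simp only [neg_mul_neg, one_mul, one_pow]
      congr 2
      ext i j
      simp only [Matrix.of_apply, f, I]
      rw [integral_Icc_eq_integral_Ioc,
        ← intervalIntegral.integral_of_le (hz (Fin.castSucc_lt_succ (i := i)).le)]
      have hd : ∀ t ∈ Set.uIcc (z i.succ) (z i.castSucc), HasDerivAt
          (fun t : ℝ => (t - L) ^ ((j : ℕ) + 1) / (((j : ℕ) + 1).factorial : ℝ))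
          ((t - L) ^ (j : ℕ) / ((j : ℕ).factorial : ℝ)) t := by
        intro t _
        have := (((hasDerivAt_id t).sub_const L).pow ((j : ℕ) + 1)).div_const
          ((((j : ℕ) + 1).factorial : ℕ) : ℝ)
        refine this.congr_deriv ?_
        rw [Nat.factorial_succ]
        push_cast
        have : ((j : ℕ).factorial : ℝ) ≠ 0 := by positivity
        field_simp
        simp
      rw [intervalIntegral.integral_eq_sub_of_hasDerivAt hd
        (Continuous.intervalIntegrable (by fun_prop) _ _)]
      simp
    simp only [lowerVolume, hset]
    rw [hval] at key
    exact key

/-- The reference measure on the level with `k + 1` particles. -/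
noncomputable def levelMeasureNat {n : ℕ} (x : Fin n → ℝ) (k : ℕ) : Measure (Fin (k + 1) → ℝ) :=
  if h : k + 1 = n then Measure.dirac (fun i => x (Fin.cast h i)) else volume

/-- The volume of the set of patterns with top level `x` above a level with `k + 1` particles,
where `m` is the number of levels above. -/
noncomputable def upperVolume {n : ℕ} (x : Fin n → ℝ) :
    (m k : ℕ) → (Fin (k + 1) → ℝ) → ENNReal
  | 0, _, _ => 1
  | m + 1, k, y => ∫⁻ z : Fin (k + 2) → ℝ, {z | Interlaces y z}.indicator
      (upperVolume x m (k + 1)) z ∂(levelMeasureNat x (k + 1))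

theorem upperVolume_of_not_antitone {n : ℕ} (x : Fin n → ℝ) (m k : ℕ) {y : Fin (k + 1) → ℝ}
    (hy : ¬ Antitone y) : upperVolume x (m + 1) k y = 0 := by
  have : {z : Fin (k + 2) → ℝ | Interlaces y z} = ∅ :=
    Set.eq_empty_of_forall_notMem fun z hz => hy (Interlaces.antitone_left hz)
  simp [upperVolume, this]

/-- The matrix of the basis splines, evaluated at the particles of a level. -/
noncomputable def splineMatrix {n : ℕ} (x : Fin n → ℝ) (L : ℝ) (m : ℕ) {N : ℕ} (y : Fin N → ℝ) :
    Matrix (Fin N) (Fin N) ℝ :=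
  Matrix.of fun i j => spline x L m (m + 1 + j) (y i)

theorem det_dualCoeff_ne_zero {n : ℕ} {x : Fin n → ℝ} (hx : Function.Injective x) (L : ℝ) :
    (Matrix.of fun l i : Fin n => dualCoeff x L l i).det ≠ 0 := by
  have : (Matrix.of fun l i : Fin n => dualCoeff x L l i) *
      (Matrix.of fun i k : Fin n => (x i - L) ^ (k : ℕ) / ((k : ℕ).factorial : ℝ)) = 1 := by
    ext l k
    rw [Matrix.mul_apply, Matrix.one_apply]
    simp only [Matrix.of_apply]
    rw [sum_dualCoeff_mul_pow hx k.2]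
    simp [Fin.ext_iff]
  exact (isUnit_iff_ne_zero.1 (Matrix.isUnit_det_of_right_inverse this))

/-- The interlacing indicator as a determinant. -/
theorem det_indicator_interlaces {k : ℕ} {x : Fin (k + 2) → ℝ} (hx : StrictAnti x)
    {y : Fin (k + 1) → ℝ} (hy : Antitone y) (hxy : ∀ i j, y j ≠ x i) :
    (Matrix.of fun i j : Fin (k + 1) =>
      truncPow 0 (x i.castSucc - y j) - truncPow 0 (x i.succ - y j)).det =
      {z | Interlaces y z}.indicator 1 x := by
  have hM : ∀ i j : Fin (k + 1), truncPow 0 (x i.castSucc - y j) - truncPow 0 (x i.succ - y j) =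
      if x i.succ < y j ∧ y j < x i.castSucc then 1 else 0 := by
    intro i j
    have h1 := hxy i.castSucc j
    have h2 := hxy i.succ j
    have h3 := hx (Fin.castSucc_lt_succ (i := i))
    simp only [truncPow, sub_pos]
    rcases lt_or_gt_of_ne h1 with h1 | h1 <;> rcases lt_or_gt_of_ne h2 with h2 | h2 <;>
      simp [h1, h2, h1.not_gt, h2.not_gt]
    all_goals linarith
  by_cases h : Interlaces y x
  · rw [Set.indicator_of_mem (show x ∈ {z | Interlaces y z} from h)]
    have : (Matrix.of fun i j : Fin (k + 1) =>
        truncPow 0 (x i.castSucc - y j) - truncPow 0 (x i.succ - y j)) = 1 := by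
      ext i j
      rw [Matrix.of_apply, hM, Matrix.one_apply]
      congr 1
      refine propext ⟨fun hij => ?_, ?_⟩
      · by_contra hne
        rcases lt_or_gt_of_ne hne with hl | hl
        · have := (h j).1.trans (hx.antitone (show i.succ ≤ j.castSucc from
            Fin.succ_le_castSucc_iff.2 hl))
          linarith [hij.1]
        · have := (hx.antitone (show j.succ ≤ i.castSucc from
            Fin.succ_le_castSucc_iff.2 hl)).trans (h j).2
          linarith [hij.2]
      · rintro rfl
        exact ⟨lt_of_le_of_ne (h i).2 (hxy _ _).symm, lt_of_le_of_ne (h i).1 (hxy _ _)⟩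
    rw [this, Matrix.det_one, Pi.one_apply]
  · rw [Set.indicator_of_notMem (show x ∉ {z | Interlaces y z} from h)]
    -- Otherwise each gap contains a particle, and choosing one per gap gives a strictly increasing
    -- self-map of `Fin (k + 1)`. That map is the identity, so the levels would interlace. An empty
    -- gap is a zero row.
    have : ∃ i : Fin (k + 1), ∀ j, ¬ (x i.succ < y j ∧ y j < x i.castSucc) := by
      by_contra! hcon
      choose φ hφ using hcon
      have hmono : StrictMono φ := by
        intro i i' hii
        by_contra hle
        have h1 := hy (not_lt.1 hle)
        have h2 := hx.antitone (show i.succ ≤ i'.castSucc from Fin.succ_le_castSucc_iff.2 hii)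
        linarith [(hφ i).1, (hφ i').2]
      have hid : φ = id := hmono.eq_id
      exact h fun i => ⟨by simpa [hid] using (hφ i).2.le, by simpa [hid] using (hφ i).1.le⟩
    obtain ⟨i, hi⟩ := this
    exact Matrix.det_eq_zero_of_row_eq_zero i fun j => by rw [Matrix.of_apply, hM, if_neg (hi j)]

/-- Border the matrix of step functions by a column of ones and multiply by the dual coefficients.
The first column becomes the first unit vector, and the remaining minor is the transposed spline
matrix. -/
theorem det_splineMatrix_zero {k : ℕ} {x : Fin (k + 2) → ℝ} (hx : StrictAnti x) (L : ℝ)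
    {y : Fin (k + 1) → ℝ} (hy : Antitone y) (hxy : ∀ i j, y j ≠ x i) :
    (splineMatrix x L 0 y).det =
      (Matrix.of fun l i : Fin (k + 2) => dualCoeff x L l i).det * (-1) ^ (k + 1) *
        {z | Interlaces y z}.indicator 1 x := by
  let B : Matrix (Fin (k + 2)) (Fin (k + 2)) ℝ :=
    Matrix.of fun i j => Fin.cases 1 (fun j' => truncPow 0 (x i - y j')) j
  have hB : B.det = (-1) ^ (k + 1) * {z | Interlaces y z}.indicator 1 x := by
    rw [det_of_first_column_one B (fun i => by simp [B]), ← det_indicator_interlaces hx hy hxy]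
    simp [B]
  have hprod : ((Matrix.of fun l i : Fin (k + 2) => dualCoeff x L l i) * B).det =
      (splineMatrix x L 0 y).det := by
    have h0 : ∀ l : Fin (k + 2), ((Matrix.of fun l i : Fin (k + 2) => dualCoeff x L l i) * B) l 0 =
        if l = 0 then 1 else 0 := by
      intro l
      have := sum_dualCoeff_mul_pow hx.injective (k := 0) (l := l) (Nat.succ_pos (k + 1)) L
      rw [Matrix.mul_apply]
      simp only [Fin.ext_iff, Fin.val_zero]
      simpa [B] using this
    rw [Matrix.det_succ_column_zero, Fin.sum_univ_succ]
    simp only [h0, Fin.succ_ne_zero, if_true, if_false, mul_zero, zero_mul,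
      Finset.sum_const_zero, add_zero, Fin.val_zero, pow_zero, one_mul]
    rw [← Matrix.det_transpose]
    congr 1
    ext i j
    simp [Matrix.mul_apply, B, splineMatrix, spline, add_comm]
  rw [← hprod, Matrix.det_mul, hB, mul_assoc]

theorem ae_forall_ne {n N : ℕ} (x : Fin n → ℝ) : ∀ᵐ y : Fin N → ℝ, ∀ i j, y j ≠ x i := by
  rw [ae_all_iff]
  intro i
  rw [ae_all_iff]
  intro j
  have := Measure.pi_hyperplane (fun _ : Fin N => (volume : Measure ℝ)) j (x i)
  rw [ae_iff]
  simpa [volume_pi] using this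

/-- The sets `I j` cut the line at the particles, so the row integrals are differences of tail
integrals, and tails of splines are splines of the next degree. Accumulating rows leaves the values
at the particles and a last row of total integrals. Only its column with l = m + 1 is nonzero, so
expanding along it shifts the column index by one. -/
theorem setIntegral_spline_rows {n : ℕ} {x : Fin n → ℝ} (hx : Function.Injective x) {L : ℝ}
    (hL : ∀ i, L ≤ x i) {m k : ℕ} (hm : m + 1 < n) {y : Fin (k + 1) → ℝ} (hy : Antitone y)
    {I : Fin (k + 2) → Set ℝ} (hI : ∀ j, I j = {t | (∀ i : Fin (k + 1), i.castSucc = j → y i ≤ t) ∧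
      ∀ i : Fin (k + 1), i.succ = j → t ≤ y i}) :
    (Matrix.of fun i j : Fin (k + 2) => ∫ t in I i, spline x L m (m + 1 + j) t).det =
      (-1) ^ (k + 1) * (splineMatrix x L (m + 1) y).det := by
  let A : Matrix (Fin (k + 2)) (Fin (k + 2)) ℝ := Matrix.of fun i j =>
    Fin.lastCases (motive := fun _ => ℝ) (if j = 0 then 1 else 0)
      (fun i' => spline x L (m + 1) (m + 1 + j) (y i')) i
  have hint : ∀ j : Fin (k + 2), Integrable (spline x L m (m + 1 + j)) := fun j =>
    integrable_spline hx (by omega) (by omega)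
  have hAC : A.det =
      (Matrix.of fun i j : Fin (k + 2) => ∫ t in I i, spline x L m (m + 1 + j) t).det := by
    refine Matrix.det_eq_of_forall_row_eq_smul_add_pred (fun _ => 1) (fun j => ?_) (fun i j => ?_)
    · have h0 : I 0 = Set.Ici (y 0) := by
        rw [hI]
        ext t
        simp only [Set.mem_ofPred_eq, Set.mem_Ici]
        refine ⟨fun h => h.1 0 rfl, fun h => ⟨fun i hi => ?_, fun i hi =>
          absurd hi (Fin.succ_ne_zero i)⟩⟩
        obtain rfl : i = 0 := Fin.castSucc_injective _ hi
        exact h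
      have hA0 : A 0 j = spline x L (m + 1) (m + 1 + j) (y 0) := by
        simp only [A, Matrix.of_apply]
        rw [← Fin.castSucc_zero, Fin.lastCases_castSucc]
      rw [hA0, Matrix.of_apply, h0, integral_Ici_eq_integral_Ioi, integral_Ioi_spline]
    · have hAi : A i.castSucc j = spline x L (m + 1) (m + 1 + j) (y i) := by simp [A]
      rw [hAi, Matrix.of_apply, one_mul]
      induction i using Fin.lastCases with
      | last =>
        have h0 : I (Fin.last k).succ = Set.Iic (y (Fin.last k)) := by
          rw [hI]
          ext t
          simp only [Set.mem_ofPred_eq, Set.mem_Iic]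
          refine ⟨fun h => h.2 _ rfl, fun h => ⟨fun i hi => ?_, fun i hi => ?_⟩⟩
          · exact absurd hi (by rw [Fin.succ_last]; exact (Fin.castSucc_lt_last i).ne)
          · rw [Fin.succ_injective _ hi]; exact h
        have hA1 : A (Fin.last k).succ j = if j = 0 then 1 else 0 := by
          simp only [A, Matrix.of_apply, Fin.succ_last, Fin.lastCases_last]
        rw [hA1, h0, ← integral_Ioi_spline]
        have := intervalIntegral.integral_Iic_add_Ioi (b := y (Fin.last k)) (hint j).integrableOn
          (hint j).integrableOn
        rw [this, integral_spline hx (by omega) hL hm]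
        simp only [Fin.ext_iff, Fin.val_zero, Nat.add_eq_left]
      | cast i =>
        have h0 : I i.castSucc.succ = Set.Icc (y i.succ) (y i.castSucc) := by
          rw [hI]
          ext t
          simp only [Set.mem_ofPred_eq, Set.mem_Icc]
          refine ⟨fun h => ⟨h.1 _ (Fin.succ_castSucc i).symm, h.2 _ rfl⟩,
            fun h => ⟨fun i' hi => ?_, fun i' hi => ?_⟩⟩
          · rw [Fin.succ_castSucc] at hi
            rw [Fin.castSucc_injective _ hi]; exact h.1
          · rw [Fin.succ_injective _ hi]; exact h.2
        have hA1 : A i.castSucc.succ j = spline x L (m + 1) (m + 1 + j) (y i.succ) := by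
          simp only [A, Matrix.of_apply]
          rw [Fin.succ_castSucc, Fin.lastCases_castSucc]
        rw [hA1, h0, ← integral_Ioi_spline, ← integral_Ioi_spline, integral_Icc_eq_integral_Ioc,
          ← setIntegral_union Set.Ioc_disjoint_Ioi_same measurableSet_Ioi (hint j).integrableOn
            (hint j).integrableOn,
          Set.Ioc_union_Ioi_eq_Ioi (hy (Fin.castSucc_lt_succ (i := i)).le)]
  rw [← hAC, Matrix.det_succ_row A (Fin.last (k + 1)), Fin.sum_univ_succ]
  have hl : ∀ j, A (Fin.last (k + 1)) j = if j = 0 then 1 else 0 := fun j => by simp [A]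
  simp only [hl, Fin.succ_ne_zero, if_true, if_false, mul_zero, zero_mul, Finset.sum_const_zero,
    add_zero, Fin.val_zero, mul_one, Fin.val_last]
  congr 2
  ext i j
  simp only [Matrix.submatrix_apply, Fin.succAbove_last, A, Matrix.of_apply,
    Fin.lastCases_castSucc, splineMatrix, Fin.succAbove_zero, Fin.val_succ]
  congr 1
  omega

/-- Induction on the distance from the top level: each integration over a level raises the spline
degree by one. The statement is almost sure because the step functions of the base case ignore
particles sitting on nodes. -/
theorem upperVolume_eq {n : ℕ} {x : Fin n → ℝ} (hx : StrictAnti x) {L : ℝ} (hL : ∀ i, L ≤ x i)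
    (m k : ℕ) (hmk : k + 1 + (m + 1) = n) : ∃ η : ℝ, η ≠ 0 ∧
      ∀ᵐ y : Fin (k + 1) → ℝ, Antitone y → 0 ≤ η * (splineMatrix x L m y).det ∧
        upperVolume x (m + 1) k y = ENNReal.ofReal (η * (splineMatrix x L m y).det) := by
  induction m generalizing k with
  | zero =>
    obtain rfl : n = k + 2 := by omega
    refine ⟨((Matrix.of fun l i : Fin (k + 2) => dualCoeff x L l i).det * (-1) ^ (k + 1))⁻¹,
      inv_ne_zero (mul_ne_zero (det_dualCoeff_ne_zero hx.injective L) (by simp)), ?_⟩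
    filter_upwards [ae_forall_ne x] with y hxy hy
    have hne := mul_ne_zero (det_dualCoeff_ne_zero hx.injective L)
      (pow_ne_zero (k + 1) (neg_ne_zero.2 (one_ne_zero (α := ℝ))))
    rw [det_splineMatrix_zero hx L hy hxy, inv_mul_cancel_left₀ hne]
    simp only [upperVolume, levelMeasureNat, dif_pos, lintegral_dirac]
    by_cases h : x ∈ {z | Interlaces y z}
    · rw [Set.indicator_of_mem h]
      have h' : (fun i => x (Fin.cast rfl i)) ∈ {z | Interlaces y z} := h
      rw [Set.indicator_of_mem h']
      simp
    · rw [Set.indicator_of_notMem h]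
      have h' : (fun i => x (Fin.cast rfl i)) ∉ {z | Interlaces y z} := h
      rw [Set.indicator_of_notMem h']
      simp
  | succ m ih =>
    obtain ⟨η, hη, h⟩ := ih (k + 1) (by omega)
    -- The exceptional null set lies on the level being integrated out, so here the identity holds
    -- everywhere.
    refine ⟨η * (-1) ^ (k + 1), mul_ne_zero hη (by simp), Eventually.of_forall fun y hy => ?_⟩
    let I : Fin (k + 2) → Set ℝ := fun j => {t | (∀ i : Fin (k + 1), i.castSucc = j → y i ≤ t) ∧
      ∀ i : Fin (k + 1), i.succ = j → t ≤ y i}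
    have hset : {z : Fin (k + 2) → ℝ | Interlaces y z} = Set.univ.pi I := by
      ext z
      simp only [Interlaces, Set.mem_ofPred_eq, Set.mem_pi, Set.mem_univ, forall_const, I]
      exact ⟨fun h j => ⟨fun i hi => hi ▸ (h i).1, fun i hi => hi ▸ (h i).2⟩,
        fun h i => ⟨(h _).1 i rfl, (h _).2 i rfl⟩⟩
    have hIm : ∀ j, MeasurableSet (I j) := fun j => by
      have : I j = (⋂ i : Fin (k + 1), ⋂ _ : i.castSucc = j, Set.Ici (y i)) ∩
          ⋂ i : Fin (k + 1), ⋂ _ : i.succ = j, Set.Iic (y i) := by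
        ext t; simp [I]
      rw [this]
      exact (MeasurableSet.iInter fun i => MeasurableSet.iInter fun _ => measurableSet_Ici).inter
        (MeasurableSet.iInter fun i => MeasurableSet.iInter fun _ => measurableSet_Iic)
    let f : Fin (k + 2) → ℝ → ℝ := fun j => spline x L m (m + 1 + j)
    have hf : ∀ i j, IntegrableOn (f j) (I i) := fun i j =>
      (integrable_spline hx.injective (by omega) (by omega)).integrableOn
    have key := lintegral_indicator_eq_ofReal (F := upperVolume x (m + 1) (k + 1))
      (MeasurableSet.univ_pi hIm) ((integrable_det_restrict_pi I f hf).const_mul η)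
      (h.mono fun z hz hzI => hz (Interlaces.antitone_right (y := y)
        (show z ∈ {z | Interlaces y z} by rw [hset]; exact hzI)))
    have hval : ∫ z in Set.univ.pi I, η * (Matrix.of fun i j => f j (z i)).det =
        η * (-1) ^ (k + 1) * (splineMatrix x L (m + 1) y).det := by
      rw [integral_const_mul, setIntegral_det_pi I f hf, mul_assoc,
        ← setIntegral_spline_rows hx.injective hL (by omega) hy (I := I) fun j => rfl]
    have hne : k + 1 + 1 ≠ n := by omega
    have hlm : levelMeasureNat x (k + 1) = volume := dif_neg hne
    rw [hval] at key
    rw [upperVolume, hlm, hset]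
    exact key

end GelfandTsetlin

/-! ### The law of one level, by integrating out the others. -/

namespace GelfandTsetlin

/-- Factors that ignore the integrated coordinates come out; this lets the product of interlacing
indicators be integrated level by level. -/
theorem lmarginal_mul_of_forall_eq {δ : Type*} [DecidableEq δ] {X : δ → Type*}
    [∀ i, MeasurableSpace (X i)] (μ : ∀ i, Measure (X i)) (s : Finset δ)
    {f c : (∀ i, X i) → ENNReal} (hf : Measurable f)
    (hc : ∀ y z, (∀ i ∉ s, y i = z i) → c y = c z) (y : ∀ i, X i) :
    lmarginal μ s (fun y => f y * c y) y = lmarginal μ s f y * c y := by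
  unfold lmarginal
  have hm : Measurable fun t => f (Function.updateFinset y s t) := hf.comp measurable_updateFinset
  rw [← lintegral_mul_const _ hm]
  refine lintegral_congr fun t => ?_
  beta_reduce
  rw [hc (Function.updateFinset y s t) y fun i hi => by simp [Function.updateFinset, hi]]

instance sigmaFinite_levelMeasureNat {n : ℕ} (x : Fin n → ℝ) (k : ℕ) :
    SigmaFinite (levelMeasureNat x k) := by
  unfold levelMeasureNat
  split_ifs <;> infer_instance

instance sigmaFinite_levelMeasure {n : ℕ} (x : Fin n → ℝ) (r : Fin n) :
    SigmaFinite (levelMeasure x r) :=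
  sigmaFinite_levelMeasureNat x r

open Classical in
/-- The indicator of interlacing between the levels with indices `k` and `k + 1`. -/
noncomputable def stepIndicator (n k : ℕ) (y : TriArray n) : ENNReal :=
  if h : k + 1 < n then if Interlaces (y ⟨k, Nat.lt_of_succ_lt h⟩) (y ⟨k + 1, h⟩) then 1 else 0
  else 1

theorem measurable_stepIndicator (n k : ℕ) : Measurable (stepIndicator n k) := by
  unfold stepIndicator
  split_ifs with h
  · refine Measurable.ite ?_ measurable_const measurable_const
    have : Measurable fun y : TriArray n =>
        (y ⟨k, Nat.lt_of_succ_lt h⟩, y ⟨k + 1, h⟩) :=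
      (measurable_pi_apply _).prodMk (measurable_pi_apply _)
    exact this (measurableSet_interlaces (k + 1))
  · exact measurable_const

theorem stepIndicator_congr {n k : ℕ} {y z : TriArray n}
    (h : ∀ i : Fin n, (i : ℕ) = k ∨ (i : ℕ) = k + 1 → y i = z i) :
    stepIndicator n k y = stepIndicator n k z := by
  unfold stepIndicator
  by_cases h' : k + 1 < n
  · rw [dif_pos h', dif_pos h', h ⟨k, _⟩ (Or.inl rfl), h ⟨k + 1, h'⟩ (Or.inr rfl)]
  · rw [dif_neg h', dif_neg h']

theorem patterns_eq {n : ℕ} (hn : 2 ≤ n) : patterns n =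
    {y | ∀ (k : ℕ) (h : k + 1 < n),
      Interlaces (y ⟨k, Nat.lt_of_succ_lt h⟩) (y ⟨k + 1, h⟩)} := by
  ext y
  refine ⟨fun hy k h i => hy.2 k h i, fun hy => ⟨fun r => ?_, fun k h i => hy k h i⟩⟩
  obtain ⟨r, hr⟩ := r
  rcases Nat.eq_zero_or_pos r with rfl | hpos
  · exact (hy 0 (by omega)).antitone_left
  · obtain ⟨k, rfl⟩ : ∃ k, r = k + 1 := ⟨r - 1, by omega⟩
    exact (hy k hr).antitone_right

theorem indicator_patterns {n : ℕ} (hn : 2 ≤ n) (y : TriArray n) :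
    (patterns n).indicator 1 y = ∏ k ∈ Finset.range (n - 1), stepIndicator n k y := by
  rw [patterns_eq hn]
  by_cases h : ∀ (k : ℕ) (h : k + 1 < n),
      Interlaces (y ⟨k, Nat.lt_of_succ_lt h⟩) (y ⟨k + 1, h⟩)
  · rw [Set.indicator_of_mem (show y ∈ {y : TriArray n | ∀ (k : ℕ) (h : k + 1 < n),
      Interlaces (y ⟨k, Nat.lt_of_succ_lt h⟩) (y ⟨k + 1, h⟩)} from h), Pi.one_apply]
    refine (Finset.prod_eq_one fun k hk => ?_).symm
    have hk' : k + 1 < n := by have := Finset.mem_range.1 hk; omega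
    rw [stepIndicator, dif_pos hk', if_pos (h k hk')]
  · rw [Set.indicator_of_notMem (show y ∉ {y : TriArray n | ∀ (k : ℕ) (h : k + 1 < n),
      Interlaces (y ⟨k, Nat.lt_of_succ_lt h⟩) (y ⟨k + 1, h⟩)} from h)]
    push Not at h
    obtain ⟨k, hk, h⟩ := h
    refine (Finset.prod_eq_zero (Finset.mem_range.2 (show k < n - 1 by omega)) ?_).symm
    rw [stepIndicator, dif_pos hk, if_neg h]

theorem measurableSet_patterns {n : ℕ} (hn : 2 ≤ n) : MeasurableSet (patterns n) := by
  have : Measurable ((patterns n).indicator (1 : TriArray n → ENNReal)) := by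
    have h := funext (indicator_patterns hn)
    rw [h]
    exact Finset.measurable_prod _ fun k _ => measurable_stepIndicator n k
  exact (measurable_indicator_const_iff (1 : ENNReal)).1 this

theorem lmarginal_lower {n : ℕ} (x : Fin n → ℝ) (k : ℕ) (hk : k < n) (y : TriArray n) :
    lmarginal (levelMeasure x) (Finset.univ.filter fun i : Fin n => (i : ℕ) < k)
      (fun y => ∏ j ∈ Finset.range k, stepIndicator n j y) y = lowerVolume k (y ⟨k, hk⟩) := by
  induction k generalizing y with
  | zero => simp [lowerVolume]
  | succ k ih =>
    have hk' : k < n := by omega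
    have hins : (Finset.univ.filter fun i : Fin n => (i : ℕ) < k + 1) =
        insert ⟨k, hk'⟩ (Finset.univ.filter fun i : Fin n => (i : ℕ) < k) := by
      ext i; simp [Fin.ext_iff]; omega
    have hm : ∀ k, Measurable fun y : TriArray n => ∏ j ∈ Finset.range k, stepIndicator n j y :=
      fun k => Finset.measurable_prod _ fun k _ => measurable_stepIndicator n k
    rw [hins, lmarginal_insert _ (hm _) (by simp)]
    simp only [Finset.prod_range_succ]
    have hvol : levelMeasure x ⟨k, hk'⟩ = volume := dif_neg (by simp; omega)
    rw [hvol, lowerVolume]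
    refine lintegral_congr fun t => ?_
    rw [lmarginal_mul_of_forall_eq _ _ (hm k), ih hk', Function.update_self]
    · rw [stepIndicator, dif_pos hk, Function.update_self, Function.update_of_ne (by simp)]
      by_cases h : Interlaces t (y ⟨k + 1, hk⟩)
      · rw [if_pos h, mul_one, Set.indicator_of_mem (show t ∈ {y' | Interlaces y' (y ⟨k + 1, hk⟩)} from h)]
      · rw [if_neg h, mul_zero, Set.indicator_of_notMem (show t ∉ {y' | Interlaces y' (y ⟨k + 1, hk⟩)} from h)]
    · intro y z hyz
      exact stepIndicator_congr fun i hi => hyz i (by simp; omega)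

theorem lmarginal_upper {n : ℕ} (x : Fin n → ℝ) (m k : ℕ) (hk : k + 1 + m = n) (y : TriArray n) :
    lmarginal (levelMeasure x) (Finset.univ.filter fun i : Fin n => k < (i : ℕ))
      (fun y => ∏ j ∈ Finset.Ico k (n - 1), stepIndicator n j y) y =
      upperVolume x m k (y ⟨k, by omega⟩) := by
  induction m generalizing k y with
  | zero =>
    have h1 : (Finset.univ.filter fun i : Fin n => k < (i : ℕ)) = ∅ := by
      ext i; simp; omega
    have h2 : Finset.Ico k (n - 1) = ∅ := Finset.Ico_eq_empty (by omega)
    simp [h1, h2, upperVolume]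
  | succ m ih =>
    have hk' : k + 1 < n := by omega
    have hins : (Finset.univ.filter fun i : Fin n => k < (i : ℕ)) =
        insert ⟨k + 1, hk'⟩ (Finset.univ.filter fun i : Fin n => k + 1 < (i : ℕ)) := by
      ext i; simp [Fin.ext_iff]; omega
    have hm : ∀ k, Measurable fun y : TriArray n =>
        ∏ j ∈ Finset.Ico k (n - 1), stepIndicator n j y :=
      fun k => Finset.measurable_prod _ fun k _ => measurable_stepIndicator n k
    rw [hins, lmarginal_insert _ (hm _) (by simp)]
    simp only [Finset.prod_eq_prod_Ico_succ_bot (show k < n - 1 by omega)]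
    rw [upperVolume]
    refine lintegral_congr fun t => ?_
    simp only [mul_comm (stepIndicator n k _)]
    rw [lmarginal_mul_of_forall_eq _ _ (hm (k + 1)), ih (k + 1) (by omega), Function.update_self]
    · rw [stepIndicator, dif_pos hk', Function.update_self, Function.update_of_ne (by simp)]
      by_cases h : Interlaces (y ⟨k, by omega⟩) t
      · rw [if_pos h, mul_one, Set.indicator_of_mem (show t ∈ {z | Interlaces (y ⟨k, by omega⟩) z} from h)]
      · rw [if_neg h, mul_zero, Set.indicator_of_notMem (show t ∉ {z | Interlaces (y ⟨k, by omega⟩) z} from h)]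
    · intro y z hyz
      exact stepIndicator_congr fun i hi => hyz i (by simp; omega)

/-- A Markov property: interlacing only links neighbouring levels, so fixing level r splits the
constraints into a part below and a part above. -/
theorem setLIntegral_patterns {n : ℕ} (x : Fin n → ℝ) (r : Fin n) (m : ℕ)
    (hm : (r : ℕ) + 1 + (m + 1) = n) {f : (Fin ((r : ℕ) + 1) → ℝ) → ENNReal} (hf : Measurable f) :
    ∫⁻ y in patterns n, f (y r) ∂(Measure.pi (levelMeasure x)) =
      ∫⁻ y, lowerVolume r y * (f y * upperVolume x (m + 1) r y) := by
  have hn : 2 ≤ n := by omega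
  rw [← lintegral_indicator (measurableSet_patterns hn)]
  have hind : ∀ y : TriArray n, (patterns n).indicator (fun y => f (y r)) y =
      (∏ j ∈ Finset.range r, stepIndicator n j y) *
        (f (y r) * ∏ j ∈ Finset.Ico (r : ℕ) (n - 1), stepIndicator n j y) := by
    intro y
    have h1 : (patterns n).indicator (fun y => f (y r)) y =
        (patterns n).indicator 1 y * f (y r) := by
      by_cases h : y ∈ patterns n <;> simp [h]
    rw [h1, indicator_patterns hn, Finset.range_eq_Ico,
      ← Finset.prod_Ico_consecutive _ (Nat.zero_le r) (show (r : ℕ) ≤ n - 1 by omega), ← Finset.range_eq_Ico]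
    ring
  simp only [hind]
  have hm1 : Measurable fun y : TriArray n => ∏ j ∈ Finset.range r, stepIndicator n j y :=
    Finset.measurable_prod _ fun k _ => measurable_stepIndicator n k
  have hm2 : Measurable fun y : TriArray n =>
      ∏ j ∈ Finset.Ico (r : ℕ) (n - 1), stepIndicator n j y :=
    Finset.measurable_prod _ fun k _ => measurable_stepIndicator n k
  have hm3 : Measurable fun y : TriArray n => f (y r) := hf.comp (measurable_pi_apply r)
  have hm4 : Measurable fun y : TriArray n => (∏ j ∈ Finset.range r, stepIndicator n j y) *
      (f (y r) * ∏ j ∈ Finset.Ico (r : ℕ) (n - 1), stepIndicator n j y) := hm1.mul (hm3.mul hm2)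
  rw [lintegral_eq_lmarginal_univ (fun _ _ => 0)]
  have huniv : (Finset.univ : Finset (Fin n)) =
      insert r ((Finset.univ.filter fun i : Fin n => (i : ℕ) < r) ∪
        (Finset.univ.filter fun i : Fin n => (r : ℕ) < i)) := by
    ext i; simp [Fin.ext_iff]; omega
  rw [huniv, lmarginal_insert _ hm4 (by simp), lmarginal_union _ _ hm4
    (Finset.disjoint_filter.2 fun i _ h1 h2 => by omega)]
  have hvol : levelMeasure x r = volume := dif_neg (by omega)
  rw [hvol]
  refine lintegral_congr fun t => ?_
  have hup : lmarginal (levelMeasure x) (Finset.univ.filter fun i : Fin n => (r : ℕ) < i)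
      (fun y => (∏ j ∈ Finset.range r, stepIndicator n j y) *
        (f (y r) * ∏ j ∈ Finset.Ico (r : ℕ) (n - 1), stepIndicator n j y)) =
      fun y => (∏ j ∈ Finset.range r, stepIndicator n j y) *
        (f (y r) * upperVolume x (m + 1) r (y r)) := by
    funext y
    rw [← lmarginal_upper x (m + 1) r hm y]
    have : ∀ y : TriArray n, (∏ j ∈ Finset.range r, stepIndicator n j y) *
        (f (y r) * ∏ j ∈ Finset.Ico (r : ℕ) (n - 1), stepIndicator n j y) =
        (∏ j ∈ Finset.Ico (r : ℕ) (n - 1), stepIndicator n j y) *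
        ((∏ j ∈ Finset.range r, stepIndicator n j y) * f (y r)) := fun y => by ring
    simp only [this]
    rw [lmarginal_mul_of_forall_eq _ _ hm2]
    · ring
    · intro y z hyz
      congr 1
      · refine Finset.prod_congr rfl fun j hj => stepIndicator_congr fun i hi => hyz i ?_
        have := Finset.mem_range.1 hj
        simp; omega
      · rw [hyz r (by simp)]
  rw [hup, lmarginal_mul_of_forall_eq _ _ hm1, lmarginal_lower x r r.2, Function.update_self]
  intro y z hyz
  rw [hyz r (by simp)]

end GelfandTsetlin

/-! ### Biorthogonal ensembles and their correlation functions. -/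

namespace GelfandTsetlin

/-- The Schur complement, freed of invertibility: the adjugate form is continuous in A, and A + ε is
singular for only finitely many ε. -/
theorem det_fromBlocks_eq_sub {m : ℕ} (A : Matrix (Fin m) (Fin m) ℝ) (B : Matrix (Fin m) Unit ℝ)
    (C : Matrix Unit (Fin m) ℝ) (D : Matrix Unit Unit ℝ) :
    (Matrix.fromBlocks A B C D).det = D () () * A.det - (C * A.adjugate * B) () () := by
  have hinv : ∀ A : Matrix (Fin m) (Fin m) ℝ, A.det ≠ 0 →
      (Matrix.fromBlocks A B C D).det = D () () * A.det - (C * A.adjugate * B) () () := by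
    intro A hA
    have : Invertible A := A.invertibleOfIsUnitDet (isUnit_iff_ne_zero.2 hA)
    rw [Matrix.det_fromBlocks₁₁, Matrix.det_unique (D - _), Matrix.sub_apply, Matrix.invOf_eq_nonsing_inv,
      Matrix.inv_def]
    simp only [PUnit.default_eq_unit, Matrix.mul_smul, Matrix.smul_mul, Matrix.smul_apply,
      smul_eq_mul, Ring.inverse_eq_inv', mul_sub]
    rw [mul_inv_cancel_left₀ hA, mul_comm]
  have hev : ∀ᶠ ε : ℝ in 𝓝[≠] 0, (Matrix.scalar (Fin m) ε + A).det ≠ 0 := by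
    have hfin : {ε : ℝ | (Matrix.scalar (Fin m) ε + A).det = 0}.Finite := by
      refine ((-A).charpoly.roots.toFinset.finite_toSet).subset fun ε hε => ?_
      have hε' : (Matrix.scalar (Fin m) ε + A).det = 0 := hε
      simp only [Finset.mem_coe, Multiset.mem_toFinset, Polynomial.mem_roots
        ((-A).charpoly_monic.ne_zero), Polynomial.IsRoot.def, Matrix.eval_charpoly, sub_neg_eq_add]
      exact hε'
    have hcl := (hfin.subset (Set.sdiff_subset (t := {0}))).isClosed
    have : ({ε : ℝ | (Matrix.scalar (Fin m) ε + A).det = 0} \ {0})ᶜ ∈ 𝓝 (0 : ℝ) :=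
      hcl.isOpen_compl.mem_nhds (by simp)
    rw [eventually_nhdsWithin_iff]
    filter_upwards [this] with ε hε hne h0
    exact hε ⟨h0, hne⟩
  have hc : Continuous fun ε : ℝ => Matrix.scalar (Fin m) ε + A := by
    simp only [Matrix.scalar_apply]
    fun_prop
  have hc1 : Continuous fun ε : ℝ =>
      (Matrix.fromBlocks (Matrix.scalar (Fin m) ε + A) B C D).det :=
    (hc.matrix_fromBlocks continuous_const continuous_const continuous_const).matrix_det
  have hc2 : Continuous fun ε : ℝ => D () () * (Matrix.scalar (Fin m) ε + A).det -
      (C * (Matrix.scalar (Fin m) ε + A).adjugate * B) () () := by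
    refine (continuous_const.mul hc.matrix_det).sub ?_
    exact ((continuous_const.matrix_mul hc.matrix_adjugate).matrix_mul
      continuous_const).matrix_elem () ()
  have h1 := (hc1.tendsto 0).mono_left (nhdsWithin_le_nhds (s := {0}ᶜ))
  have h2 := (hc2.tendsto 0).mono_left (nhdsWithin_le_nhds (s := {0}ᶜ))
  have h3 := tendsto_nhds_unique (h1.congr' (hev.mono fun ε hε => hinv _ hε)) h2
  simpa using h3

theorem measurableEmbedding_cons (m : ℕ) :
    MeasurableEmbedding fun z : ℝ × (Fin m → ℝ) => (Fin.cons z.1 z.2 : Fin (m + 1) → ℝ) := by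
  have h := (MeasurableEquiv.piFinSuccAbove (fun _ : Fin (m + 1) => ℝ) 0).symm.measurableEmbedding
  rw [MeasurableEquiv.piFinSuccAbove_symm_apply] at h
  convert h using 1
  funext z
  exact (Fin.insertNth_zero' _ _).symm

theorem measurePreserving_cons (m : ℕ) :
    MeasurePreserving (fun z : ℝ × (Fin m → ℝ) => (Fin.cons z.1 z.2 : Fin (m + 1) → ℝ))
      (volume.prod volume) volume := by
  have h := (volume_preserving_piFinSuccAbove (fun _ : Fin (m + 1) => ℝ) 0).symm
  rw [MeasurableEquiv.piFinSuccAbove_symm_apply] at h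
  have heq : (fun z : ℝ × (Fin m → ℝ) => (Fin.cons z.1 z.2 : Fin (m + 1) → ℝ)) =
      Fin.insertNthEquiv (fun _ : Fin (m + 1) => ℝ) 0 :=
    funext fun z => (Fin.insertNth_zero' _ _).symm
  rw [heq]
  exact h

/-- The matrix of a kernel at a tuple of points. -/
def kernelMatrix (K : ℝ → ℝ → ℝ) {m : ℕ} (y : Fin m → ℝ) : Matrix (Fin m) (Fin m) ℝ :=
  Matrix.of fun i j => K (y i) (y j)

/-- Isolates the dependence on t: a diagonal value and products K(·,t) K(t,·), which are what the
trace and the reproducing property integrate. -/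
theorem det_kernelMatrix_cons (K : ℝ → ℝ → ℝ) {m : ℕ} (t : ℝ) (y : Fin m → ℝ) :
    (kernelMatrix K (Fin.cons t y : Fin (m + 1) → ℝ)).det =
      K t t * (kernelMatrix K y).det -
        ∑ i, ∑ j, K (y j) t * K t (y i) * (kernelMatrix K y).adjugate i j := by
  let e : Fin m ⊕ Unit ≃ Fin (m + 1) :=
    (Equiv.optionEquivSumPUnit (Fin m)).symm.trans (finSuccEquiv m).symm
  have he : (kernelMatrix K (Fin.cons t y : Fin (m + 1) → ℝ)).submatrix e e =
      Matrix.fromBlocks (kernelMatrix K y) (Matrix.of fun i _ => K (y i) t)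
        (Matrix.of fun _ j => K t (y j)) (Matrix.of fun _ _ => K t t) := by
    ext (i | i) (j | j) <;> simp [e, kernelMatrix]
  rw [← Matrix.det_submatrix_equiv_self e, he, det_fromBlocks_eq_sub]
  simp only [Matrix.of_apply, Matrix.mul_apply, Finset.sum_mul]
  rw [Finset.sum_comm]
  congr 1
  refine Finset.sum_congr rfl fun i _ => Finset.sum_congr rfl fun j _ => ?_
  ring

theorem det_kernelMatrix_comp_perm (K : ℝ → ℝ → ℝ) {m : ℕ} (y : Fin m → ℝ)
    (σ : Equiv.Perm (Fin m)) : (kernelMatrix K (y ∘ σ)).det = (kernelMatrix K y).det :=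
  Matrix.det_submatrix_equiv_self σ (kernelMatrix K y)

/-- Integrating out one particle of a projection kernel of rank `q`. -/
theorem integral_det_kernelMatrix_cons {K : ℝ → ℝ → ℝ} {q : ℝ}
    (hI : Integrable fun t => K t t) (htr : ∫ t, K t t = q)
    (hI2 : ∀ u v, Integrable fun t => K u t * K t v) (hrep : ∀ u v, ∫ t, K u t * K t v = K u v)
    {m : ℕ} (y : Fin m → ℝ) :
    ∫ t, (kernelMatrix K (Fin.cons t y : Fin (m + 1) → ℝ)).det =
      (q - m) * (kernelMatrix K y).det := by
  simp only [det_kernelMatrix_cons]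
  rw [integral_sub (hI.mul_const _)]
  · rw [integral_mul_const, htr, integral_finsetSum]
    · have : ∀ i, ∫ t, ∑ j, K (y j) t * K t (y i) * (kernelMatrix K y).adjugate i j =
          ∑ j, (kernelMatrix K y).adjugate i j * kernelMatrix K y j i := by
        intro i
        rw [integral_finsetSum _ fun j _ => (hI2 _ _).mul_const _]
        refine Finset.sum_congr rfl fun j _ => ?_
        rw [integral_mul_const, hrep, mul_comm]
        rfl
      -- The double sum is the trace of adj(K) K = det(K) · 1, that is, m times the determinant.
      simp only [this, ← Matrix.mul_apply, Matrix.adjugate_mul]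
      simp [sub_mul]
    · exact fun i _ => integrable_finsetSum _ fun j _ => (hI2 _ _).mul_const _
  · exact integrable_finsetSum _ fun i _ => integrable_finsetSum _ fun j _ => (hI2 _ _).mul_const _

/-- Finitely many functions `ψ k` and `p k` that are biorthonormal on the real line. -/
structure Biorthonormal {q : ℕ} (ψ p : Fin q → ℝ → ℝ) : Prop where
  measurable_left : ∀ k, Measurable (ψ k)
  measurable_right : ∀ k, Measurable (p k)
  integrable : ∀ k j, Integrable fun t => ψ k t * p j t
  integral_eq : ∀ k j, ∫ t, ψ k t * p j t = if k = j then 1 else 0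

/-- The kernel `∑ ψ_k(u) p_k(v)`. -/
def sumKernel {q : ℕ} (ψ p : Fin q → ℝ → ℝ) (u v : ℝ) : ℝ := ∑ k, ψ k u * p k v

namespace Biorthonormal

variable {q : ℕ} {ψ p : Fin q → ℝ → ℝ}

theorem integrable_diag (h : Biorthonormal ψ p) : Integrable fun t => sumKernel ψ p t t :=
  integrable_finsetSum _ fun k _ => h.integrable k k

theorem integral_diag (h : Biorthonormal ψ p) : ∫ t, sumKernel ψ p t t = q := by
  simp only [sumKernel]
  rw [integral_finsetSum _ fun k _ => h.integrable k k]
  simp [h.integral_eq]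

theorem mul_eq (u v t : ℝ) : sumKernel ψ p u t * sumKernel ψ p t v =
    ∑ k, ∑ j, ψ k u * p j v * (ψ j t * p k t) := by
  simp only [sumKernel, Finset.sum_mul_sum]
  exact Finset.sum_congr rfl fun k _ => Finset.sum_congr rfl fun j _ => by ring

theorem integrable_mul (h : Biorthonormal ψ p) (u v : ℝ) :
    Integrable fun t => sumKernel ψ p u t * sumKernel ψ p t v := by
  simp only [mul_eq]
  exact integrable_finsetSum _ fun k _ => integrable_finsetSum _ fun j _ =>
    (h.integrable j k).const_mul _

theorem integral_mul (h : Biorthonormal ψ p) (u v : ℝ) :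
    ∫ t, sumKernel ψ p u t * sumKernel ψ p t v = sumKernel ψ p u v := by
  simp only [mul_eq]
  rw [integral_finsetSum _ fun k _ => integrable_finsetSum _ fun j _ =>
    (h.integrable j k).const_mul _, sumKernel]
  refine Finset.sum_congr rfl fun k _ => ?_
  rw [integral_finsetSum _ fun j _ => (h.integrable j k).const_mul _]
  simp [integral_const_mul, h.integral_eq]

theorem integral_cons (h : Biorthonormal ψ p) {m : ℕ} (y : Fin m → ℝ) :
    ∫ t, (kernelMatrix (sumKernel ψ p) (Fin.cons t y : Fin (m + 1) → ℝ)).det =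
      ((q : ℝ) - m) * (kernelMatrix (sumKernel ψ p) y).det :=
  integral_det_kernelMatrix_cons h.integrable_diag h.integral_diag h.integrable_mul h.integral_mul y

theorem measurable_det (h : Biorthonormal ψ p) (m : ℕ) :
    Measurable fun y : Fin m → ℝ => (kernelMatrix (sumKernel ψ p) y).det := by
  simp only [Matrix.det_apply, kernelMatrix, Matrix.of_apply, sumKernel]
  refine Finset.measurable_sum _ fun σ _ => Measurable.const_smul (Finset.measurable_prod _
    fun i _ => Finset.measurable_sum _ fun k _ => ?_) _
  exact ((h.measurable_left k).comp (measurable_pi_apply _)).mul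
    ((h.measurable_right k).comp (measurable_pi_apply _))

theorem integrable_det (h : Biorthonormal ψ p) (m : ℕ) :
    Integrable fun y : Fin m → ℝ => (kernelMatrix (sumKernel ψ p) y).det := by
  simp only [Matrix.det_apply', kernelMatrix, Matrix.of_apply, sumKernel]
  refine integrable_finsetSum _ fun σ _ => Integrable.const_mul ?_ _
  simp only [Finset.prod_univ_sum]
  refine integrable_finsetSum _ fun κ _ => ?_
  -- Reindexing the left functions by σ gives each coordinate a single product ψ p, which is
  -- integrable by assumption although the factors need not be.
  have : ∀ y : Fin m → ℝ, ∏ i, ψ (κ i) (y (σ i)) * p (κ i) (y i) =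
      ∏ i, (ψ (κ (σ.symm i)) (y i) * p (κ i) (y i)) := by
    intro y
    rw [Finset.prod_mul_distrib, Finset.prod_mul_distrib]
    congr 1
    exact Fintype.prod_equiv σ _ _ fun i => by simp
  simp only [this]
  exact Integrable.fintype_prod (f := fun i t => ψ (κ (σ.symm i)) t * p (κ i) t)
    fun i => h.integrable _ _

theorem integral_det (h : Biorthonormal ψ p) {m : ℕ} (hm : m ≤ q) :
    ∫ y : Fin m → ℝ, (kernelMatrix (sumKernel ψ p) y).det = q.descFactorial m := by
  induction m with
  | zero => simp [volume_pi, Measure.real]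
  | succ m ih =>
    have hi := ((measurePreserving_cons m).integrable_comp_emb (measurableEmbedding_cons m)).2
      (h.integrable_det (m + 1))
    have hprod := integral_prod_symm _ hi
    simp only [Function.comp_apply, h.integral_cons] at hprod
    rw [← (measurePreserving_cons m).integral_comp (measurableEmbedding_cons m), hprod]
    rw [integral_const_mul, ih (by omega), Nat.descFactorial_succ]
    push_cast [Nat.cast_sub (show m ≤ q by omega)]
    ring

end Biorthonormal

open Classical in
-- The sorting permutation is unique when the entries are distinct. This passes from a law on
-- ordered tuples to a symmetric density.
theorem sum_antitone_indicator {q : ℕ} {y : Fin q → ℝ} (hy : Function.Injective y) :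
    ∑ σ : Equiv.Perm (Fin q), (if Antitone (y ∘ σ) then (1 : ENNReal) else 0) = 1 := by
  let σ₀ := Tuple.sort (-y)
  have h0 : Antitone (y ∘ σ₀) := by
    have := Tuple.monotone_sort (-y)
    intro i j hij
    have h := this hij
    simp only [Function.comp_apply, Pi.neg_apply, neg_le_neg_iff] at h
    exact h
  rw [Finset.sum_eq_single σ₀]
  · rw [if_pos h0]
  · intro σ _ hne
    refine if_neg fun hσ => hne ?_
    have := Tuple.unique_antitone hσ h0
    exact Equiv.ext fun i => hy (congrFun this i)
  · simp

theorem ae_injective (q : ℕ) : ∀ᵐ y : Fin q → ℝ, Function.Injective y := by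
  have : ∀ i j : Fin q, i ≠ j → ∀ᵐ y : Fin q → ℝ, y i ≠ y j := by
    intro i j hij
    have hs : (volume : Measure (Fin q → ℝ)) (LinearMap.ker
        ((LinearMap.proj i : (Fin q → ℝ) →ₗ[ℝ] ℝ) - LinearMap.proj j) : Set (Fin q → ℝ)) = 0 := by
      refine Measure.addHaar_submodule _ _ fun htop => ?_
      have := LinearMap.ker_eq_top.1 htop
      have h1 := LinearMap.congr_fun this (Pi.single i 1)
      simp [hij.symm] at h1
    rw [ae_iff]
    convert hs using 2
    ext y
    simp [sub_eq_zero]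
  have h2 : ∀ᵐ y : Fin q → ℝ, ∀ i j : Fin q, i ≠ j → y i ≠ y j := by
    rw [ae_all_iff]; intro i
    rw [ae_all_iff]; intro j
    by_cases hij : i = j
    · simp [hij]
    · filter_upwards [this i j hij] with y hy _ using hy
  filter_upwards [h2] with y hy i j hij
  by_contra hne
  exact hy i j hne hij

theorem lintegral_comp_perm {q : ℕ} (σ : Equiv.Perm (Fin q)) (f : (Fin q → ℝ) → ENNReal) :
    ∫⁻ y, f (y ∘ σ) = ∫⁻ y, f y := by
  have h := volume_measurePreserving_piCongrLeft (fun _ : Fin q => ℝ) σ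
  rw [← h.lintegral_comp_emb (MeasurableEquiv.measurableEmbedding _)]
  refine lintegral_congr fun y => ?_
  congr 1
  funext i
  rw [MeasurableEquiv.coe_piCongrLeft]
  exact Equiv.piCongrLeft_apply_apply (fun _ : Fin q => ℝ) σ y i

theorem lintegral_correlationMeasure {Ω : Type*} [MeasurableSpace Ω] (P : Measure Ω) {N : ℕ}
    {X : Ω → Fin N → ℝ} (hX : Measurable X) (m : ℕ) {f : (Fin m → ℝ) → ENNReal}
    (hf : Measurable f) :
    ∫⁻ y, f y ∂(correlationMeasure P X m) = ∑ σ : Fin m ↪ Fin N, ∫⁻ ω, f (X ω ∘ σ) ∂P := by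
  rw [correlationMeasure, lintegral_finsetSum_measure]
  refine Finset.sum_congr rfl fun σ _ => ?_
  have hm : Measurable fun ω k => X ω (σ k) :=
    measurable_pi_lambda _ fun k => (measurable_pi_apply (σ k)).comp hX
  rw [lintegral_map hf hm]
  rfl

/-- An injective labelling of m particles extends to m + 1 in N - m ways. -/
theorem sum_embedding_succ {m N : ℕ} (F : (Fin m ↪ Fin N) → ENNReal) :
    ∑ τ : Fin (m + 1) ↪ Fin N, F ((Fin.succEmb m).trans τ) =
      ((N - m : ℕ) : ENNReal) * ∑ σ : Fin m ↪ Fin N, F σ := by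
  have h := Fintype.sum_equiv (Equiv.embeddingFinSucc m (Fin N))
    (fun τ => F ((Fin.succEmb m).trans τ)) (fun s => F s.1) (fun τ => by
      congr 1)
  rw [h, Fintype.sum_sigma, Finset.mul_sum]
  refine Finset.sum_congr rfl fun σ _ => ?_
  simp only [Finset.sum_const, Finset.card_univ, nsmul_eq_mul]
  congr 2
  rw [Fintype.card_subtype_compl, Fintype.card_fin]
  congr 1
  exact (Set.card_range_of_injective σ.injective).trans (Fintype.card_fin m)

theorem lintegral_correlationMeasure_succ {Ω : Type*} [MeasurableSpace Ω] (P : Measure Ω) {N : ℕ}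
    {X : Ω → Fin N → ℝ} (hX : Measurable X) (m : ℕ) {f : (Fin m → ℝ) → ENNReal}
    (hf : Measurable f) :
    ∫⁻ y, f (Fin.tail y) ∂(correlationMeasure P X (m + 1)) =
      ((N - m : ℕ) : ENNReal) * ∫⁻ y, f y ∂(correlationMeasure P X m) := by
  rw [lintegral_correlationMeasure P hX _ hf, ← sum_embedding_succ,
    lintegral_correlationMeasure P hX (m + 1) (f := fun y => f (Fin.tail y))
      (hf.comp (measurable_pi_lambda _ fun i => measurable_pi_apply _))]
  rfl

theorem ae_ae_swap_of_ae_prod {α β : Type*} [MeasurableSpace α] [MeasurableSpace β]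
    {μ : Measure α} {ν : Measure β} [SFinite μ] [SFinite ν] {D : α × β → ℝ}
    (h : ∀ᵐ z ∂(μ.prod ν), 0 ≤ D z) : ∀ᵐ y ∂ν, ∀ᵐ t ∂μ, 0 ≤ D (t, y) :=
  Measure.ae_ae_of_ae_prod
    ((Measure.measurePreserving_swap (μ := ν) (ν := μ)).quasiMeasurePreserving.ae h)

/-- A configuration whose law has, up to ordering of the labels, the density `det K` for a
projection kernel `K` of full rank, has `K` as correlation kernel. -/
theorem isCorrelationKernel_sumKernel {Ω : Type*} [MeasurableSpace Ω] (P : Measure Ω) {q : ℕ}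
    {X : Ω → Fin q → ℝ} (hX : Measurable X) {ψ p : Fin q → ℝ → ℝ} (h : Biorthonormal ψ p)
    (hnn : 0 ≤ᵐ[volume] fun y : Fin q → ℝ => (kernelMatrix (sumKernel ψ p) y).det)
    (hq : correlationMeasure P X q = volume.withDensity
      fun y => ENNReal.ofReal (kernelMatrix (sumKernel ψ p) y).det) :
    IsCorrelationKernel P X (sumKernel ψ p) := by
  -- Descent from m = q, where the full density is known; d counts the particles integrated out.
  suffices H : ∀ d m, m + d = q →
      (0 ≤ᵐ[volume] fun y : Fin m → ℝ => (kernelMatrix (sumKernel ψ p) y).det) ∧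
      correlationMeasure P X m = volume.withDensity
        fun y => ENNReal.ofReal (kernelMatrix (sumKernel ψ p) y).det by
    intro m hm
    obtain ⟨h1, h2⟩ := H (q - m) m (by omega)
    exact ⟨h.integrable_det m, h1, h2⟩
  intro d
  induction d with
  | zero => rintro m rfl; exact ⟨hnn, hq⟩
  | succ d ih =>
    intro m hm
    obtain ⟨h1, h2⟩ := ih (m + 1) (by omega)
    have hmp := measurePreserving_cons m
    have hi : Integrable (fun z : ℝ × (Fin m → ℝ) =>
        (kernelMatrix (sumKernel ψ p) (Fin.cons z.1 z.2 : Fin (m + 1) → ℝ)).det)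
        (volume.prod volume) :=
      (hmp.integrable_comp_emb (measurableEmbedding_cons m)).2 (h.integrable_det (m + 1))
    have h1' : ∀ᵐ z : ℝ × (Fin m → ℝ) ∂(volume.prod volume),
        0 ≤ (kernelMatrix (sumKernel ψ p) (Fin.cons z.1 z.2 : Fin (m + 1) → ℝ)).det :=
      hmp.quasiMeasurePreserving.ae h1
    have h1'' : ∀ᵐ y : Fin m → ℝ, ∀ᵐ t : ℝ,
        0 ≤ (kernelMatrix (sumKernel ψ p) (Fin.cons t y : Fin (m + 1) → ℝ)).det :=
      ae_ae_swap_of_ae_prod (D := fun z : ℝ × (Fin m → ℝ) =>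
        (kernelMatrix (sumKernel ψ p) (Fin.cons z.1 z.2 : Fin (m + 1) → ℝ)).det) h1'
    have hi' : ∀ᵐ y : Fin m → ℝ, Integrable fun t : ℝ =>
        (kernelMatrix (sumKernel ψ p) (Fin.cons t y : Fin (m + 1) → ℝ)).det :=
      hi.prod_left_ae
    have hqm : (0 : ℝ) < (q : ℝ) - m := by
      rw [← hm]; push_cast; linarith [Nat.cast_nonneg (α := ℝ) d]
    -- Nonnegativity descends as well: integrating the larger determinant in one variable gives q -
    -- m > 0 times the smaller one.
    have hnn' : 0 ≤ᵐ[volume] fun y : Fin m → ℝ => (kernelMatrix (sumKernel ψ p) y).det := by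
      filter_upwards [h1''] with y hy
      have := integral_nonneg_of_ae hy
      rw [h.integral_cons] at this
      exact nonneg_of_mul_nonneg_right this hqm
    refine ⟨hnn', ?_⟩
    refine Measure.ext_of_lintegral _ fun f hf => ?_
    have hqm' : ((q - m : ℕ) : ENNReal) ≠ 0 := by
      rw [Nat.cast_ne_zero]; omega
    have hft : Measurable fun y : Fin (m + 1) → ℝ => f (Fin.tail y) :=
      hf.comp (measurable_pi_lambda _ fun i => measurable_pi_apply _)
    -- After multiplication by q - m, one side counts extensions of label tuples and the other is an
    -- integrated determinant.
    rw [← ENNReal.mul_right_inj hqm' (ENNReal.natCast_ne_top _),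
      ← lintegral_correlationMeasure_succ P hX m hf, h2,
      lintegral_withDensity_eq_lintegral_mul _ (h.measurable_det _).ennreal_ofReal
        hft,
      lintegral_withDensity_eq_lintegral_mul _ (h.measurable_det _).ennreal_ofReal hf,
      ← hmp.lintegral_comp_emb (measurableEmbedding_cons m)]
    have hmeas : Measurable fun z : ℝ × (Fin m → ℝ) => ENNReal.ofReal
        (kernelMatrix (sumKernel ψ p) (Fin.cons z.1 z.2 : Fin (m + 1) → ℝ)).det * f z.2 :=
      (((h.measurable_det (m + 1)).ennreal_ofReal).comp
        (measurableEmbedding_cons m).measurable).mul (hf.comp measurable_snd)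
    have hmd : Measurable fun y : Fin m → ℝ =>
        ENNReal.ofReal (kernelMatrix (sumKernel ψ p) y).det * f y :=
      (h.measurable_det _).ennreal_ofReal.mul hf
    simp only [Pi.mul_apply, Fin.tail_cons]
    rw [lintegral_prod_symm _ hmeas.aemeasurable, ← lintegral_const_mul _ hmd]
    refine lintegral_congr_ae ?_
    filter_upwards [h1'', hi', hnn'] with y hy hiy hny
    have hm1 : Measurable fun t : ℝ => ENNReal.ofReal
        (kernelMatrix (sumKernel ψ p) (Fin.cons t y : Fin (m + 1) → ℝ)).det := by
      have hcm : Measurable fun t : ℝ => (Fin.cons t y : Fin (m + 1) → ℝ) := by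
        refine measurable_pi_lambda _ fun i => ?_
        induction i using Fin.cases with
        | zero => simpa using measurable_id'
        | succ i => simp
      exact (h.measurable_det (m + 1)).ennreal_ofReal.comp hcm
    rw [lintegral_mul_const _ hm1, ← ofReal_integral_eq_lintegral_ofReal hiy hy, h.integral_cons,
      ENNReal.ofReal_mul hqm.le, ← Nat.cast_sub (by omega : m ≤ q), ENNReal.ofReal_natCast,
      mul_assoc]

end GelfandTsetlin

/-! ### Identification of the kernel; the correlation statement. -/

namespace GelfandTsetlin

theorem iteratedDeriv_polynomial_eval (p : Polynomial ℝ) (k : ℕ) :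
    iteratedDeriv k (fun t => p.eval t) = fun t => (Polynomial.derivative^[k] p).eval t := by
  induction k with
  | zero => simp
  | succ k ih =>
    rw [iteratedDeriv_succ, ih, Function.iterate_succ_apply']
    funext t
    exact Polynomial.deriv _

theorem eval_lagrange_basis {n : ℕ} (x : Fin n → ℝ) (j : Fin n) (t : ℝ) :
    (Lagrange.basis Finset.univ x j).eval t =
      ∏ i ∈ Finset.univ.erase j, (t - x i) / (x j - x i) := by
  rw [Lagrange.basis, Polynomial.eval_prod]
  refine Finset.prod_congr rfl fun i _ => ?_
  simp [Lagrange.basisDivisor, div_eq_inv_mul]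

/-- The sum of the same terms over all nodes is the (m+1)-th derivative of (X - u)^m, hence zero. So
for u < v, minus the sum over nodes below u equals the sum over nodes above u. A node at u
contributes 0^m, which is why m ≠ 0 or u off the nodes is required. -/
theorem kernel_eq_sum {n : ℕ} {x : Fin n → ℝ} (hx : Function.Injective x) {q m : ℕ}
    (hq : q + (m + 1) = n) (u v : ℝ) (hu : m ≠ 0 ∨ ∀ i, u ≠ x i) :
    kernel x q q u v = ∑ j, truncPow m (x j - u) *
      (Polynomial.derivative^[m + 1] (Lagrange.basis Finset.univ x j)).eval v := by
  have h2 : n - q = m + 1 := by omega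
  have h3 : ∀ j, (fun t : ℝ => ∏ i ∈ Finset.univ.erase j, (t - x i) / (x j - x i)) =
      fun t => (Lagrange.basis Finset.univ x j).eval t := fun j =>
    funext fun t => (eval_lagrange_basis x j t).symm
  simp only [kernel, h2, h3, Nat.add_sub_cancel, iteratedDeriv_polynomial_eval]
  rcases le_or_gt v u with hvu | huv
  · simp only [hvu, hvu.not_gt, true_and, false_and, if_false, Finset.sum_const_zero, sub_zero]
    refine Finset.sum_congr rfl fun j _ => ?_
    split_ifs with h
    · rw [truncPow_of_pos (sub_pos.2 h)]
    · rw [truncPow_of_nonpos (sub_nonpos.2 (not_lt.1 h)), zero_mul]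
  · simp only [huv, huv.not_ge, true_and, false_and, if_false, Finset.sum_const_zero, zero_sub]
    have hdeg : ((Polynomial.X - Polynomial.C u) ^ m : Polynomial ℝ).degree < (n : WithBot ℕ) := by
      rw [Polynomial.degree_pow, Polynomial.degree_X_sub_C, nsmul_eq_mul, mul_one]
      exact_mod_cast (show m < n by omega)
    have hz := sum_eval_iterate_derivative_basis hx hdeg (m + 1) v
    rw [Polynomial.iterate_derivative_X_sub_pow, Nat.descFactorial_of_lt (Nat.lt_succ_self m),
      zero_smul, Polynomial.eval_zero] at hz
    rw [neg_eq_iff_add_eq_zero, ← Finset.sum_add_distrib]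
    have hz' := congrArg (fun t => t / (m.factorial : ℝ)) hz
    simp only [zero_div, Finset.sum_div] at hz'
    refine Eq.trans (Finset.sum_congr rfl fun j _ => ?_) hz'
    simp only [Polynomial.eval_pow, Polynomial.eval_sub, Polynomial.eval_X, Polynomial.eval_C]
    rcases lt_trichotomy (x j) u with h | h | h
    · rw [if_pos h, truncPow_of_nonpos (by linarith)]; ring
    · rw [if_neg h.not_lt, truncPow_of_nonpos (by linarith)]
      rcases hu with hm | hu
      · rw [h, sub_self, zero_pow hm]; ring
      · exact absurd h.symm (hu j)
    · rw [if_neg h.not_gt, truncPow_of_pos (by linarith)]; ring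

/-- Taylor expansion at L of a polynomial of degree below q. It separates the variables of the
kernel and produces the right-hand functions of the biorthogonal system. -/
theorem eval_iterate_derivative_basis {n : ℕ} {x : Fin n → ℝ} (hx : Function.Injective x)
    (L : ℝ) {q m : ℕ} (hq : q + (m + 1) = n) (hq0 : 0 < q) (j : Fin n) (v : ℝ) :
    (Polynomial.derivative^[m + 1] (Lagrange.basis Finset.univ x j)).eval v =
      ∑ k : Fin q, dualCoeff x L (m + 1 + k) j * ((v - L) ^ (k : ℕ) / ((k : ℕ).factorial : ℝ)) := by
  set P := Polynomial.derivative^[m + 1] (Lagrange.basis Finset.univ x j) with hP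
  have hdeg : P.natDegree < q := by
    have h1 := Polynomial.natDegree_iterate_derivative (Lagrange.basis Finset.univ x j) (m + 1)
    rw [Lagrange.natDegree_basis hx.injOn (Finset.mem_univ j)] at h1
    simp only [Finset.card_univ, Fintype.card_fin] at h1
    rw [← hP] at h1
    omega
  rw [← Polynomial.taylor_eval_sub L P v,
    Polynomial.eval_eq_sum_range' (by rwa [Polynomial.natDegree_taylor]),
    ← Fin.sum_univ_eq_sum_range (fun k => (Polynomial.taylor L P).coeff k * (v - L) ^ k)]
  refine Finset.sum_congr rfl fun k _ => ?_
  have hk : ((k : ℕ).factorial : ℝ) * (Polynomial.taylor L P).coeff k =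
      dualCoeff x L (m + 1 + k) j := by
    rw [Polynomial.taylor_coeff, dualCoeff, add_comm (m + 1), Function.iterate_add_apply, ← hP,
      ← Polynomial.factorial_smul_hasseDeriv]
    simp
  rw [← hk]
  have : ((k : ℕ).factorial : ℝ) ≠ 0 := by positivity
  field_simp

theorem kernel_eq_sumKernel {n : ℕ} {x : Fin n → ℝ} (hx : Function.Injective x) (L : ℝ) {q m : ℕ}
    (hq : q + (m + 1) = n) (hq0 : 0 < q) (u v : ℝ) (hu : ∀ i, u ≠ x i) :
    kernel x q q u v = sumKernel (fun k : Fin q => spline x L m (m + 1 + k))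
      (fun k t => (t - L) ^ (k : ℕ) / ((k : ℕ).factorial : ℝ)) u v := by
  rw [kernel_eq_sum hx hq u v (Or.inr hu), sumKernel]
  simp only [eval_iterate_derivative_basis hx L hq hq0, spline, Finset.mul_sum, Finset.sum_mul]
  rw [Finset.sum_comm]
  exact Finset.sum_congr rfl fun k _ => Finset.sum_congr rfl fun j _ => by ring

theorem biorthonormal_spline {n : ℕ} {x : Fin n → ℝ} (hx : Function.Injective x) {L : ℝ}
    (hL : ∀ i, L ≤ x i) {q m : ℕ} (hq : q + (m + 1) = n) :
    Biorthonormal (fun k : Fin q => spline x L m (m + 1 + k))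
      (fun k t => (t - L) ^ (k : ℕ) / ((k : ℕ).factorial : ℝ)) where
  measurable_left _ := measurable_spline
  measurable_right _ := by fun_prop
  integrable k j := integrable_spline_mul hx (by omega) (by omega) (by fun_prop)
  integral_eq k j := by
    rw [integral_spline_mul_pow hx (by omega) (by omega) hL (by omega)]
    simp [Fin.ext_iff]

theorem det_kernelMatrix_spline {n : ℕ} (x : Fin n → ℝ) (L : ℝ) {q m : ℕ} (y : Fin q → ℝ) :
    (kernelMatrix (sumKernel (fun k : Fin q => spline x L m (m + 1 + k))
      (fun k t => (t - L) ^ (k : ℕ) / ((k : ℕ).factorial : ℝ))) y).det =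
      (splineMatrix x L m y).det *
        (Matrix.of fun i j : Fin q => (y i - L) ^ (j : ℕ) / ((j : ℕ).factorial : ℝ)).det := by
  rw [← Matrix.det_transpose (Matrix.of fun i j : Fin q => _), ← Matrix.det_mul]
  rfl

open Classical in
/-- The law of a level is the kernel determinant on the ordered configurations, up to a factor. -/
theorem setLIntegral_patterns_eq {n : ℕ} {x : Fin n → ℝ} (hx : StrictAnti x) {L : ℝ}
    (hL : ∀ i, L ≤ x i) (r : Fin n) (m : ℕ) (hm : (r : ℕ) + 1 + (m + 1) = n) :
    ∃ κ : ℝ, κ ≠ 0 ∧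
      (∀ᵐ y : Fin ((r : ℕ) + 1) → ℝ, Antitone y → 0 ≤ κ * (kernelMatrix
        (sumKernel (fun k : Fin ((r : ℕ) + 1) => spline x L m (m + 1 + k))
          (fun k t => (t - L) ^ (k : ℕ) / ((k : ℕ).factorial : ℝ))) y).det) ∧
      ∀ f : (Fin ((r : ℕ) + 1) → ℝ) → ENNReal, Measurable f →
        ∫⁻ y in patterns n, f (y r) ∂(Measure.pi (levelMeasure x)) =
          ∫⁻ y, f y * ((if Antitone y then 1 else 0) * ENNReal.ofReal (κ * (kernelMatrix
            (sumKernel (fun k : Fin ((r : ℕ) + 1) => spline x L m (m + 1 + k))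
              (fun k t => (t - L) ^ (k : ℕ) / ((k : ℕ).factorial : ℝ))) y).det)) := by
  obtain ⟨γ, hγ, hlow⟩ := lowerVolume_eq L r
  obtain ⟨η, hη, hup⟩ := upperVolume_eq hx hL m r hm
  refine ⟨γ * η, mul_ne_zero hγ hη, ?_, fun f hf => ?_⟩
  · filter_upwards [hup] with y hy ha
    rw [det_kernelMatrix_spline]
    have := mul_nonneg (hlow y ha).1 (hy ha).1
    linarith
  · rw [setLIntegral_patterns x r m hm hf]
    refine lintegral_congr_ae ?_
    filter_upwards [hup] with y hy
    by_cases ha : Antitone y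
    · rw [if_pos ha, one_mul, (hlow y ha).2, (hy ha).2, det_kernelMatrix_spline,
        show γ * η * ((splineMatrix x L m y).det * (Matrix.of fun i j : Fin ((r : ℕ) + 1) =>
          (y i - L) ^ (j : ℕ) / ((j : ℕ).factorial : ℝ)).det) =
          (γ * (Matrix.of fun i j : Fin ((r : ℕ) + 1) =>
          (y i - L) ^ (j : ℕ) / ((j : ℕ).factorial : ℝ)).det) * (η * (splineMatrix x L m y).det)
          by ring, ENNReal.ofReal_mul (hlow y ha).1]
      ring
    · rw [if_neg ha, upperVolume_of_not_antitone x m r ha]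
      simp

theorem isCorrelationKernel_spline {n : ℕ} {x : Fin n → ℝ} (hx : StrictAnti x) {L : ℝ}
    (hL : ∀ i, L ≤ x i) (r : Fin n) (m : ℕ) (hm : (r : ℕ) + 1 + (m + 1) = n) :
    IsCorrelationKernel (uniformPattern x) (fun y : TriArray n => y r)
      (sumKernel (fun k : Fin ((r : ℕ) + 1) => spline x L m (m + 1 + k))
        (fun k t => (t - L) ^ (k : ℕ) / ((k : ℕ).factorial : ℝ))) := by
  classical
  have hB := biorthonormal_spline hx.injective hL hm
  obtain ⟨κ, hκ, hnn, hlaw⟩ := setLIntegral_patterns_eq hx hL r m hm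
  set K := sumKernel (fun k : Fin ((r : ℕ) + 1) => spline x L m (m + 1 + k))
        (fun k t => (t - L) ^ (k : ℕ) / ((k : ℕ).factorial : ℝ)) with hK
  have hn : 2 ≤ n := by omega
  set q := (r : ℕ) + 1 with hq
  have hX : Measurable fun y : TriArray n => y r := measurable_pi_apply r
  have hmeas : Measurable fun y : Fin q → ℝ => ENNReal.ofReal (κ * (kernelMatrix K y).det) :=
    ((hB.measurable_det q).const_mul κ).ennreal_ofReal
  -- symmetrisation over the labels
  have hsym : ∀ f : (Fin q → ℝ) → ENNReal, Measurable f →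
      ∑ σ : Fin q ↪ Fin q, ∫⁻ y in patterns n, f (y r ∘ σ) ∂(Measure.pi (levelMeasure x)) =
        ∫⁻ y, f y * ENNReal.ofReal (κ * (kernelMatrix K y).det) := by
    intro f hf
    have hmf : ∀ σ : Equiv.Perm (Fin q), Measurable fun y : Fin q → ℝ => f (y ∘ σ) := fun σ =>
      hf.comp (measurable_pi_lambda _ fun i => measurable_pi_apply _)
    have hanti : MeasurableSet {y : Fin q → ℝ | Antitone y} := by
      have : {y : Fin q → ℝ | Antitone y} =
          ⋂ i : Fin q, ⋂ j : Fin q, ⋂ _ : i ≤ j, {y | y j ≤ y i} := by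
        ext y; simp [Antitone]
      rw [this]
      exact MeasurableSet.iInter fun i => MeasurableSet.iInter fun j => MeasurableSet.iInter
        fun _ => measurableSet_le (measurable_pi_apply _) (measurable_pi_apply _)
    have hind : Measurable fun y : Fin q → ℝ => if Antitone y then (1 : ENNReal) else 0 :=
      Measurable.ite hanti measurable_const measurable_const
    have h1 := Fintype.sum_equiv (Equiv.embeddingEquivOfFinite (Fin q))
      (fun σ : Fin q ↪ Fin q =>
        ∫⁻ y in patterns n, f (y r ∘ σ) ∂(Measure.pi (levelMeasure x)))
      (fun σ : Equiv.Perm (Fin q) =>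
        ∫⁻ y in patterns n, f (y r ∘ σ) ∂(Measure.pi (levelMeasure x))) (fun σ => rfl)
    rw [h1]
    have h2 : ∀ σ : Equiv.Perm (Fin q),
        ∫⁻ y in patterns n, f (y r ∘ σ) ∂(Measure.pi (levelMeasure x)) =
          ∫⁻ y, f y * ((if Antitone (y ∘ σ.symm) then 1 else 0) *
            ENNReal.ofReal (κ * (kernelMatrix K y).det)) := by
      intro σ
      rw [hlaw _ (hmf σ), ← lintegral_comp_perm σ.symm]
      refine lintegral_congr fun y => ?_
      rw [det_kernelMatrix_comp_perm]
      congr 2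
      funext i
      simp
    simp only [h2]
    rw [← lintegral_finsetSum]
    · refine lintegral_congr_ae ?_
      filter_upwards [ae_injective q] with y hy
      rw [← Finset.mul_sum, ← Finset.sum_mul]
      have h3 := Fintype.sum_equiv (Equiv.symmEquiv (Fin q) (Fin q))
        (fun σ : Equiv.Perm (Fin q) => if Antitone (y ∘ σ.symm) then (1 : ENNReal) else 0)
        (fun σ => if Antitone (y ∘ σ) then (1 : ENNReal) else 0) (fun σ => rfl)
      rw [h3, sum_antitone_indicator hy, one_mul]
    · intro σ _
      exact hf.mul ((hind.comp (measurable_pi_lambda _ fun i => measurable_pi_apply _)).mul hmeas)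
  -- nonnegativity
  have hnn' : ∀ᵐ y : Fin q → ℝ, 0 ≤ κ * (kernelMatrix K y).det := by
    have hall : ∀ σ : Equiv.Perm (Fin q), ∀ᵐ y : Fin q → ℝ, Antitone (y ∘ σ) →
        0 ≤ κ * (kernelMatrix K y).det := by
      intro σ
      have hmp := volume_measurePreserving_piCongrLeft (fun _ : Fin q => ℝ) σ.symm
      filter_upwards [hmp.quasiMeasurePreserving.ae hnn] with y hy ha
      have heq : MeasurableEquiv.piCongrLeft (fun _ : Fin q => ℝ) σ.symm y = y ∘ σ := by
        funext i
        obtain ⟨j, rfl⟩ := σ.symm.surjective i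
        rw [MeasurableEquiv.coe_piCongrLeft, Equiv.piCongrLeft_apply_apply]
        simp
      rw [heq] at hy
      have := hy ha
      rwa [det_kernelMatrix_comp_perm] at this
    filter_upwards [ae_injective q, ae_all_iff.2 hall] with y hy hally
    by_contra hneg
    have hsum := sum_antitone_indicator hy
    have hz : ∑ σ : Equiv.Perm (Fin q), (if Antitone (y ∘ σ) then (1 : ENNReal) else 0) = 0 :=
      Finset.sum_eq_zero fun σ _ => if_neg fun ha => hneg (hally σ ha)
    rw [hz] at hsum
    exact zero_ne_one hsum
  -- the normalising constant
  have hint : ∫ y : Fin q → ℝ, κ * (kernelMatrix K y).det = κ * (q.factorial : ℝ) := by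
    rw [integral_const_mul, hB.integral_det le_rfl, Nat.descFactorial_self]
  -- The sign of κ, left open by the volume formulas, is decided here: κ det is nonnegative and
  -- integrates to κ q!. The total mass of the patterns then turns out to be κ itself.
  have hκpos : 0 < κ := by
    have h1 := integral_nonneg_of_ae hnn'
    rw [hint] at h1
    have h2 := nonneg_of_mul_nonneg_left h1 (by positivity : (0 : ℝ) < (q.factorial : ℝ))
    exact lt_of_le_of_ne h2 hκ.symm
  have hZ : (Measure.pi (levelMeasure x)) (patterns n) = ENNReal.ofReal κ := by
    have h1 := hsym (fun _ => 1) measurable_const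
    simp only [lintegral_const, one_mul, Measure.restrict_apply MeasurableSet.univ,
      Set.univ_inter, Finset.sum_const, Finset.card_univ, Fintype.card_embedding_eq,
      Fintype.card_fin, Nat.descFactorial_self, nsmul_eq_mul] at h1
    rw [← ofReal_integral_eq_lintegral_ofReal ((hB.integrable_det q).const_mul κ) hnn', hint,
      mul_comm κ, ENNReal.ofReal_mul (by positivity), ENNReal.ofReal_natCast] at h1
    exact (ENNReal.mul_right_inj (Nat.cast_ne_zero.2 (Nat.factorial_ne_zero q))
      (ENNReal.natCast_ne_top _)).1 h1
  have hdetnn : 0 ≤ᵐ[volume] fun y : Fin q → ℝ => (kernelMatrix K y).det := by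
    filter_upwards [hnn'] with y hy using nonneg_of_mul_nonneg_right hy hκpos
  refine isCorrelationKernel_sumKernel _ hX hB hdetnn ?_
  refine Measure.ext_of_lintegral _ fun f hf => ?_
  have hfm : Measurable fun y => f y * ENNReal.ofReal (κ * (kernelMatrix K y).det) := hf.mul hmeas
  rw [lintegral_correlationMeasure _ hX _ hf, uniformPattern, ProbabilityTheory.cond]
  simp only [lintegral_smul_measure]
  rw [← Finset.smul_sum, hsym f hf, hZ,
    lintegral_withDensity_eq_lintegral_mul _ (hB.measurable_det q).ennreal_ofReal hf,
    smul_eq_mul, ← lintegral_const_mul _ hfm]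
  refine lintegral_congr fun y => ?_
  rw [ENNReal.ofReal_mul hκpos.le, Pi.mul_apply]
  have hne : ENNReal.ofReal κ ≠ 0 := by simpa using hκpos
  calc (ENNReal.ofReal κ)⁻¹ * (f y * (ENNReal.ofReal κ * ENNReal.ofReal (kernelMatrix K y).det))
      = ((ENNReal.ofReal κ)⁻¹ * ENNReal.ofReal κ) *
        (ENNReal.ofReal (kernelMatrix K y).det * f y) := by ring
    _ = _ := by rw [ENNReal.inv_mul_cancel hne ENNReal.ofReal_ne_top, one_mul]

/-- Needed because the identification with the spline kernel is only available for u off the nodes.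
-/
theorem IsCorrelationKernel.congr_ae {Ω : Type*} [MeasurableSpace Ω] {P : Measure Ω} {N : ℕ}
    {X : Ω → Fin N → ℝ} {K K' : ℝ → ℝ → ℝ} (h : IsCorrelationKernel P X K)
    (hK : ∀ᵐ u : ℝ, ∀ v, K u v = K' u v) : IsCorrelationKernel P X K' := by
  intro m hm
  obtain ⟨h1, h2, h3⟩ := h m hm
  have hae : (fun y : Fin m → ℝ => (Matrix.of fun i j => K (y i) (y j)).det) =ᵐ[volume]
      fun y => (Matrix.of fun i j => K' (y i) (y j)).det := by
    have : ∀ᵐ y : Fin m → ℝ, ∀ i, ∀ v, K (y i) v = K' (y i) v := by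
      rw [ae_all_iff]
      intro i
      exact (Measure.quasiMeasurePreserving_eval (fun _ : Fin m => (volume : Measure ℝ)) i).ae hK
    filter_upwards [this] with y hy
    congr 1
    ext i j
    exact hy i (y j)
  refine ⟨h1.congr hae, ?_, ?_⟩
  · filter_upwards [h2, hae] with y hy he
    rw [← he]; exact hy
  · rw [h3]
    exact withDensity_congr_ae (hae.mono fun y hy => by simp only [hy])

/-- The kernel is a correlation kernel of the particles of a level below the top. -/
theorem isCorrelationKernel_kernel {n : ℕ} {x : Fin n → ℝ} (hx : StrictAnti x) (r : Fin n)
    (hr : (r : ℕ) + 1 < n) :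
    IsCorrelationKernel (uniformPattern x) (fun y : TriArray n => y r)
      (fun u v => kernel x ((r : ℕ) + 1) ((r : ℕ) + 1) u v) := by
  obtain ⟨L, hL⟩ := (Set.finite_range x).bddBelow
  have hm : (r : ℕ) + 1 + ((n - ((r : ℕ) + 1) - 1) + 1) = n := by omega
  refine (isCorrelationKernel_spline hx (fun i => hL ⟨i, rfl⟩) r _ hm).congr_ae ?_
  have : ∀ᵐ u : ℝ, ∀ i, u ≠ x i := by
    rw [ae_all_iff]
    exact fun i => Measure.ae_ne volume (x i)
  filter_upwards [this] with u hu v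
  exact (kernel_eq_sumKernel hx.injective L hm (Nat.succ_pos _) u v hu).symm

end GelfandTsetlin

/-! ### Empirical averages with parameters. -/

namespace GelfandTsetlin

section Averages

variable {E : Type*} [NormedAddCommGroup E] [NormedSpace ℝ E]

/-- The average of `f` over the points `d`. -/
noncomputable def avg {N : ℕ} (d : Fin N → ℝ) (f : ℝ → E) : E := (N : ℝ)⁻¹ • ∑ j, f (d j)

theorem avg_sub {N : ℕ} (d : Fin N → ℝ) (f g : ℝ → E) :
    avg d (fun t => f t - g t) = avg d f - avg d g := by
  simp [avg, smul_sub]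

theorem norm_avg_le {N : ℕ} {d : Fin N → ℝ} {f : ℝ → E} {C : ℝ} (hC : 0 ≤ C)
    (h : ∀ j, ‖f (d j)‖ ≤ C) : ‖avg d f‖ ≤ C := by
  rcases Nat.eq_zero_or_pos N with rfl | hN
  · simpa [avg] using hC
  rw [avg, norm_smul, norm_inv, Real.norm_natCast]
  have : ‖∑ j, f (d j)‖ ≤ N * C := by
    simpa using norm_sum_le_of_le Finset.univ (fun j _ => h j)
  have hN' : (0 : ℝ) < N := by exact_mod_cast hN
  calc (N : ℝ)⁻¹ * ‖∑ j, f (d j)‖ ≤ (N : ℝ)⁻¹ * (N * C) := by gcongr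
    _ = C := by field_simp

theorem avg_const_mul {N : ℕ} (d : Fin N → ℝ) (a : ℂ) (f : ℝ → ℂ) :
    avg d (fun t => a * f t) = a * avg d f := by
  simp [avg, ← Finset.mul_sum, mul_left_comm]

theorem avg_re {N : ℕ} (d : Fin N → ℝ) (f : ℝ → ℂ) : (avg d f).re = avg d fun t => (f t).re := by
  simp [avg, Complex.re_sum]

theorem avg_im {N : ℕ} (d : Fin N → ℝ) (f : ℝ → ℂ) : (avg d f).im = avg d fun t => (f t).im := by
  simp [avg, Complex.im_sum]

end Averages

theorem integrable_of_continuous_of_compl_Icc {E : Type*} [NormedAddCommGroup E]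
    {A B : ℝ} {ν : Measure ℝ} [IsFiniteMeasure ν] (hν : ν (Set.Icc A B)ᶜ = 0)
    {f : ℝ → E} (hf : Continuous f) : Integrable f ν := by
  have := hf.continuousOn.integrableOn_compact (μ := ν) (isCompact_Icc (a := A) (b := B))
  rwa [IntegrableOn, Measure.restrict_eq_self_of_ae_mem] at this
  exact mem_ae_iff.2 hν

/-- Joint continuity along the compact interval becomes uniform in t, by the tube lemma. -/
theorem eventually_forall_norm_sub_lt {Y E : Type*} [TopologicalSpace Y] [NormedAddCommGroup E]
    {A B : ℝ} {φ : Y → ℝ → E} {y : Y}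
    (hφ : ∀ t ∈ Set.Icc A B, ContinuousAt (Function.uncurry φ) (y, t)) {ε : ℝ} (hε : 0 < ε) :
    ∀ᶠ y' in 𝓝 y, ∀ t ∈ Set.Icc A B, ‖φ y' t - φ y t‖ < ε := by
  refine (isCompact_Icc).eventually_forall_of_forall_eventually fun t ht => ?_
  have h1 : Tendsto (fun z : Y × ℝ => φ z.1 z.2) (𝓝 (y, t)) (𝓝 (φ y t)) := hφ t ht
  have h2 : Tendsto (fun z : Y × ℝ => φ y z.2) (𝓝 (y, t)) (𝓝 (φ y t)) := by
    have : Tendsto (fun z : Y × ℝ => (y, z.2)) (𝓝 (y, t)) (𝓝 (y, t)) :=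
      (Continuous.tendsto (by fun_prop) (y, t))
    exact h1.comp this
  have := (h1.sub h2).norm
  simp only [sub_self, norm_zero] at this
  exact this.eventually (gt_mem_nhds hε)

theorem continuousAt_integral_param {Y E : Type*} [TopologicalSpace Y] [NormedAddCommGroup E]
    [NormedSpace ℝ E] {A B : ℝ} {ν : Measure ℝ} [IsProbabilityMeasure ν]
    (hν : ν (Set.Icc A B)ᶜ = 0) {φ : Y → ℝ → E} {y : Y}
    (hφ : ∀ t ∈ Set.Icc A B, ContinuousAt (Function.uncurry φ) (y, t))
    (hint : ∀ᶠ y' in 𝓝 y, Integrable (φ y') ν) :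
    ContinuousAt (fun y => ∫ t, φ y t ∂ν) y := by
  refine Metric.tendsto_nhds.2 fun ε hε => ?_
  filter_upwards [eventually_forall_norm_sub_lt hφ (half_pos hε), hint] with y' h h1
  have h2 := hint.self_of_nhds
  rw [dist_eq_norm, ← integral_sub h1 h2]
  have hae : ∀ᵐ t ∂ν, ‖φ y' t - φ y t‖ ≤ ε / 2 := by
    filter_upwards [mem_ae_iff.2 hν] with t ht using (h t ht).le
  calc _ ≤ ε / 2 * ν.real Set.univ := norm_integral_le_of_norm_le_const hae
    _ < ε := by simp; linarith

/-- A family of finite point configurations in `[A, B]`, together with integers `m`, whose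
empirical measures converge to `ν` and for which the ratio of `m` to the number of points converges
to `β`. -/
structure Scaling {ι : Type*} (l : Filter ι) (A B β : ℝ) (ν : Measure ℝ) (N m : ι → ℕ)
    (d : (i : ι) → Fin (N i) → ℝ) : Prop where
  tendsto_card : Tendsto N l atTop
  tendsto_ratio : Tendsto (fun i => (m i : ℝ) / N i) l (𝓝 β)
  mem_Icc : ∀ᶠ i in l, ∀ j, d i j ∈ Set.Icc A B
  tendsto_avg_real : ∀ f : ℝ → ℝ, Continuous f →
    Tendsto (fun i => avg (d i) f) l (𝓝 (∫ t, f t ∂ν))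

namespace Scaling

variable {ι : Type*} {l : Filter ι} {A B β : ℝ} {ν : Measure ℝ} {N m : ι → ℕ}
  {d : (i : ι) → Fin (N i) → ℝ}

theorem tendsto_avg [IsProbabilityMeasure ν] (hν : ν (Set.Icc A B)ᶜ = 0)
    (h : Scaling l A B β ν N m d) {f : ℝ → ℂ} (hf : Continuous f) :
    Tendsto (fun i => avg (d i) f) l (𝓝 (∫ t, f t ∂ν)) := by
  have h1 := h.tendsto_avg_real (fun t => (f t).re) (Complex.continuous_re.comp hf)
  have h2 := h.tendsto_avg_real (fun t => (f t).im) (Complex.continuous_im.comp hf)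
  have h3 := ((Complex.continuous_ofReal.tendsto _).comp h1).add
    (((Complex.continuous_ofReal.tendsto _).comp h2).mul_const Complex.I)
  have h4 := integral_re_add_im (integrable_of_continuous_of_compl_Icc hν hf)
  simp only [RCLike.re_eq_complex_re, RCLike.im_eq_complex_im, RCLike.I_to_complex] at h4
  rw [← h4]
  refine h3.congr fun i => ?_
  simp only [Function.comp_apply, ← avg_re, ← avg_im, Complex.re_add_im]

/-- All points lie in one compact interval, so moving the parameter changes every average by a
uniformly small amount. Limits joint in index and parameter are what later gives uniformity in the
two spatial variables. -/
theorem tendsto_avg_param {E Y : Type*} [NormedAddCommGroup E] [NormedSpace ℝ E]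
    [TopologicalSpace Y] (h : Scaling l A B β ν N m d) {φ : Y → ℝ → E} {y : Y} {L : E}
    (hφ : ∀ t ∈ Set.Icc A B, ContinuousAt (Function.uncurry φ) (y, t))
    (hL : Tendsto (fun i => avg (d i) (φ y)) l (𝓝 L)) :
    Tendsto (fun p : ι × Y => avg (d p.1) (φ p.2)) (l ×ˢ 𝓝 y) (𝓝 L) := by
  have h0 : Tendsto (fun p : ι × Y => avg (d p.1) (φ p.2) - avg (d p.1) (φ y)) (l ×ˢ 𝓝 y)
      (𝓝 0) := by
    refine Metric.tendsto_nhds.2 fun ε hε => ?_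
    filter_upwards [(h.mem_Icc).prod_mk (eventually_forall_norm_sub_lt hφ (half_pos hε))]
      with p hp
    rw [dist_zero_right, ← avg_sub]
    exact (norm_avg_le (half_pos hε).le fun j => (hp.2 _ (hp.1 j)).le).trans_lt (half_lt_self hε)
  simpa using h0.add (hL.comp tendsto_fst)

theorem eventually_card_pos (h : Scaling l A B β ν N m d) : ∀ᶠ i in l, 0 < N i :=
  h.tendsto_card.eventually (eventually_gt_atTop 0)

end Scaling

/-! ### The logarithmic potential -/

theorem sub_ofReal_ne_zero {z : ℂ} (hz : 0 < z.im) (t : ℝ) : z - t ≠ 0 := by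
  intro h
  have := congrArg Complex.im h
  simp at this
  exact hz.ne' this

theorem continuousAt_log_norm_sub {z : ℂ} (hz : 0 < z.im) (t : ℝ) :
    ContinuousAt (Function.uncurry fun (z : ℂ) (t : ℝ) => Real.log ‖z - t‖) (z, t) := by
  refine ContinuousAt.log (by fun_prop) ?_
  simpa using sub_ofReal_ne_zero hz t

theorem continuous_log_norm_sub {z : ℂ} (hz : 0 < z.im) :
    Continuous fun t : ℝ => Real.log ‖z - t‖ :=
  Continuous.log (by fun_prop) fun t => by simpa using sub_ofReal_ne_zero hz t

theorem eventually_im_pos {z : ℂ} (hz : 0 < z.im) : ∀ᶠ z' : ℂ in 𝓝 z, 0 < z'.im :=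
  (Complex.continuous_im.tendsto z).eventually (lt_mem_nhds hz)

theorem ne_zero_of_im_pos {z : ℂ} (hz : 0 < z.im) : z ≠ 0 := by
  rintro rfl; simp at hz

/-- The limiting potential. -/
noncomputable def limPot (ν : Measure ℝ) (β : ℝ) (z : ℂ) : ℝ :=
  (∫ t : ℝ, Real.log ‖z - t‖ ∂ν) - β * Real.log ‖z‖

/-- The potential of a finite configuration. -/
noncomputable def pot {N : ℕ} (d : Fin N → ℝ) (m : ℕ) (z : ℂ) : ℝ :=
  avg d (fun t => Real.log ‖z - t‖) - (m / N : ℝ) * Real.log ‖z‖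

/-- The dictionary between the potential and the holomorphic function ∏ (z - d_j) / z^m. -/
theorem exp_card_mul_pot {N : ℕ} (d : Fin N → ℝ) (m : ℕ) {z : ℂ} (hN : 0 < N) (hz : 0 < z.im) :
    Real.exp (N * pot d m z) = ‖∏ j, (z - d j)‖ / ‖z‖ ^ m := by
  have hN' : (N : ℝ) ≠ 0 := by exact_mod_cast hN.ne'
  have hz0 : 0 < ‖z‖ := norm_pos_iff.2 (ne_zero_of_im_pos hz)
  rw [pot, mul_sub, avg, smul_eq_mul, ← mul_assoc, mul_inv_cancel₀ hN', one_mul, ← mul_assoc,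
    mul_div_cancel₀ _ hN', Real.exp_sub, Real.exp_sum, norm_prod, ← Real.log_pow,
    Real.exp_log (by positivity)]
  congr 1
  refine Finset.prod_congr rfl fun j _ => Real.exp_log ?_
  exact norm_pos_iff.2 (sub_ofReal_ne_zero hz _)

theorem continuousAt_limPot {A B β : ℝ} {ν : Measure ℝ} [IsProbabilityMeasure ν]
    (hν : ν (Set.Icc A B)ᶜ = 0) {z : ℂ} (hz : 0 < z.im) : ContinuousAt (limPot ν β) z := by
  refine ContinuousAt.sub (continuousAt_integral_param hν
    (fun t _ => continuousAt_log_norm_sub hz t) ?_) ?_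
  · filter_upwards [eventually_im_pos hz] with z' hz'
    exact integrable_of_continuous_of_compl_Icc hν (continuous_log_norm_sub hz')
  · exact continuousAt_const.mul (ContinuousAt.log (by fun_prop)
      (by simpa using ne_zero_of_im_pos hz))

theorem Scaling.tendsto_pot {ι : Type*} {l : Filter ι} {A B β : ℝ} {ν : Measure ℝ} {N m : ι → ℕ}
    {d : (i : ι) → Fin (N i) → ℝ} (h : Scaling l A B β ν N m d) {z : ℂ} (hz : 0 < z.im) :
    Tendsto (fun p : ι × ℂ => pot (d p.1) (m p.1) p.2) (l ×ˢ 𝓝 z) (𝓝 (limPot ν β z)) := by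
  refine (h.tendsto_avg_param (fun t _ => continuousAt_log_norm_sub hz t)
    (h.tendsto_avg_real _ (continuous_log_norm_sub hz))).sub ?_
  refine (h.tendsto_ratio.comp tendsto_fst).mul ?_
  have : ContinuousAt (fun z : ℂ => Real.log ‖z‖) z :=
    ContinuousAt.log (by fun_prop) (by simpa using ne_zero_of_im_pos hz)
  exact this.tendsto.comp tendsto_snd

theorem tendsto_prodMk_self {ι Y : Type*} {l : Filter ι} {l' : Filter Y} {W : ι → Y}
    (hW : Tendsto W l l') : Tendsto (fun i => (i, W i)) l (l ×ˢ l') :=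
  tendsto_id.prodMk hW

theorem Scaling.tendsto_pot_comp {ι : Type*} {l : Filter ι} {A B β : ℝ} {ν : Measure ℝ}
    {N m : ι → ℕ} {d : (i : ι) → Fin (N i) → ℝ} (h : Scaling l A B β ν N m d) {z : ℂ}
    (hz : 0 < z.im) {W : ι → ℂ} (hW : Tendsto W l (𝓝 z)) :
    Tendsto (fun i => pot (d i) (m i) (W i)) l (𝓝 (limPot ν β z)) := by
  have h1 := (h.tendsto_pot hz).comp (tendsto_prodMk_self hW)
  simp only [Function.comp_def] at h1
  exact h1

end GelfandTsetlin

namespace GelfandTsetlin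

/-! ### Critical points of the potential -/

/-- The logarithmic derivative `z ↦ z f'(z)` of the complex potential. -/
noncomputable def crit {N : ℕ} (d : Fin N → ℝ) (m : ℕ) (z : ℂ) : ℂ :=
  avg d (fun t => z / (z - t)) - (m / N : ℝ)

/-- The difference quotient of `crit`. -/
noncomputable def critSlope {N : ℕ} (d : Fin N → ℝ) (z w : ℂ) : ℂ :=
  avg d fun t => -t / ((z - t) * (w - t))

theorem crit_sub {N : ℕ} (d : Fin N → ℝ) (m : ℕ) {z w : ℂ} (hz : 0 < z.im) (hw : 0 < w.im) :
    crit d m z - crit d m w = (z - w) * critSlope d z w := by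
  rw [crit, crit, sub_sub_sub_cancel_right, ← avg_sub, critSlope, ← avg_const_mul]
  congr 1
  ext t
  have h1 := sub_ofReal_ne_zero hz t
  have h2 := sub_ofReal_ne_zero hw t
  field_simp
  ring

theorem norm_sub_ofReal_sq (w : ℂ) (t : ℝ) :
    ‖w - t‖ ^ 2 = ‖w‖ ^ 2 - 2 * w.re * t + t ^ 2 := by
  rw [Complex.sq_norm, Complex.sq_norm, Complex.normSq_apply, Complex.normSq_apply]
  simp
  ring

theorem norm_sub_ofReal_sq' (w : ℂ) (t : ℝ) :
    ‖w - t‖ ^ 2 = (w.re - t) ^ 2 + w.im ^ 2 := by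
  rw [Complex.sq_norm, Complex.normSq_apply]
  simp
  ring

theorem div_sub_ofReal_im (w : ℂ) (t : ℝ) :
    (w / (w - t)).im = -w.im * (t / ‖w - t‖ ^ 2) := by
  rw [Complex.div_im, ← Complex.normSq_eq_norm_sq]
  simp
  ring

theorem div_sub_ofReal_re (w : ℂ) (t : ℝ) :
    (w / (w - t)).re = (‖w‖ ^ 2 - w.re * t) / ‖w - t‖ ^ 2 := by
  rw [Complex.div_re, ← Complex.normSq_eq_norm_sq, ← Complex.normSq_eq_norm_sq,
    Complex.normSq_apply w]
  simp
  ring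

theorem re_mul_slope {w : ℂ} (hw : 0 < w.im) (t : ℝ) :
    (w * (-t / ((w - t) * (w - t)))).re =
      -w.re * (t / ‖w - t‖ ^ 2) + 2 * w.im ^ 2 * (t / ‖w - t‖ ^ 2) ^ 2 := by
  have h0 : ‖w - t‖ ^ 2 ≠ 0 := by simpa using sub_ofReal_ne_zero hw t
  rw [norm_sub_ofReal_sq'] at *
  have h1 : (w * (-t / ((w - t) * (w - t)))) = (-t * w) / ((w - t) * (w - t)) := by ring
  rw [h1, Complex.div_re, Complex.normSq_mul, Complex.normSq_apply]
  simp
  have h2 : (w.re - t) * (w.re - t) + w.im * w.im = (w.re - t) ^ 2 + w.im ^ 2 := by ring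
  rw [h2]
  field_simp
  ring

theorem continuous_div_sub {w : ℂ} (hw : 0 < w.im) : Continuous fun t : ℝ => w / (w - t) :=
  Continuous.div₀ (by fun_prop) (by fun_prop) fun t => sub_ofReal_ne_zero hw t

theorem continuous_div_norm_sq {w : ℂ} (hw : 0 < w.im) : Continuous fun t : ℝ => t / ‖w - t‖ ^ 2 :=
  Continuous.div₀ (by fun_prop) (by fun_prop) fun t => by simpa using sub_ofReal_ne_zero hw t

theorem continuous_slope {w : ℂ} (hw : 0 < w.im) :
    Continuous fun t : ℝ => -(t : ℂ) / ((w - t) * (w - t)) :=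
  Continuous.div₀ (by fun_prop) (by fun_prop) fun t =>
    mul_ne_zero (sub_ofReal_ne_zero hw t) (sub_ofReal_ne_zero hw t)

/-- The imaginary part of the critical equation. It says that the potential is stationary at w along
the circle |z| = |w|. -/
theorem avg_div_norm_sq_eq_zero {N : ℕ} {d : Fin N → ℝ} {m : ℕ} {w : ℂ} (hw : 0 < w.im)
    (h : crit d m w = 0) : avg d (fun t => t / ‖w - t‖ ^ 2) = 0 := by
  have := congrArg Complex.im h
  rw [crit, Complex.sub_im, avg_im, Complex.ofReal_im, sub_zero] at this
  simp only [div_sub_ofReal_im, avg, ← Finset.mul_sum, smul_eq_mul, Complex.zero_im] at this ⊢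
  rw [mul_left_comm] at this
  exact (mul_eq_zero.1 this).resolve_left (by simpa using hw.ne')

/-- `w` is a critical point in the upper half plane of the limiting potential. -/
structure IsCritical (ν : Measure ℝ) (β : ℝ) (w : ℂ) : Prop where
  im_pos : 0 < w.im
  integral_eq : ∫ t : ℝ, w / (w - t) ∂ν = β

namespace IsCritical

variable {A B β : ℝ} {ν : Measure ℝ} [IsProbabilityMeasure ν] {w : ℂ}

theorem integral_div_norm_sq (hν : ν (Set.Icc A B)ᶜ = 0) (h : IsCritical ν β w) :
    ∫ t : ℝ, t / ‖w - t‖ ^ 2 ∂ν = 0 := by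
  have h1 := integral_im (integrable_of_continuous_of_compl_Icc hν (continuous_div_sub h.im_pos))
  simp only [h.integral_eq, RCLike.im_eq_complex_im, Complex.ofReal_im, div_sub_ofReal_im,
    integral_const_mul] at h1
  exact (mul_eq_zero.1 h1).resolve_left (by simpa using h.im_pos.ne')

theorem integral_sq_div (hν : ν (Set.Icc A B)ᶜ = 0) (h : IsCritical ν β w) :
    ∫ t : ℝ, ‖w‖ ^ 2 / ‖w - t‖ ^ 2 ∂ν = β := by
  have h1 := integral_re (integrable_of_continuous_of_compl_Icc hν (continuous_div_sub h.im_pos))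
  simp only [h.integral_eq, RCLike.re_eq_complex_re, Complex.ofReal_re, div_sub_ofReal_re] at h1
  have h2 : (fun t : ℝ => ‖w‖ ^ 2 / ‖w - t‖ ^ 2) = fun t : ℝ =>
      (‖w‖ ^ 2 - w.re * t) / ‖w - t‖ ^ 2 + w.re * (t / ‖w - t‖ ^ 2) := by
    ext t; ring
  rw [h2, integral_add, h1, integral_const_mul, h.integral_div_norm_sq hν]
  · simp
  · refine integrable_of_continuous_of_compl_Icc hν (Continuous.div₀ (by fun_prop) (by fun_prop)
      fun t => by simpa using sub_ofReal_ne_zero h.im_pos t)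
  · exact (integrable_of_continuous_of_compl_Icc hν (continuous_div_norm_sq h.im_pos)).const_mul _

end IsCritical

theorem measure_compl_zero_pos {ν : Measure ℝ} [IsProbabilityMeasure ν]
    (h0 : ν ≠ Measure.dirac 0) : 0 < ν {0}ᶜ := by
  rw [pos_iff_ne_zero]
  intro h
  refine h0 ?_
  have h1 : ∀ᵐ t ∂ν, t = 0 := mem_ae_iff.2 h
  have h2 : ν.map id = ν.map fun _ => (0 : ℝ) := Measure.map_congr h1
  simpa using h2

/-- An integral of a continuous nonnegative function which is positive off the origin. -/
theorem integral_pos_of_pos_off_zero {ν : Measure ℝ} [IsProbabilityMeasure ν]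
    (h0 : ν ≠ Measure.dirac 0) {f : ℝ → ℝ} (hint : Integrable f ν) (hf : ∀ t, 0 ≤ f t)
    (hpos : ∀ t, t ≠ 0 → 0 < f t) : 0 < ∫ t, f t ∂ν := by
  rw [integral_pos_iff_support_of_nonneg hf hint]
  refine (measure_compl_zero_pos h0).trans_le (measure_mono fun t ht => ?_)
  exact (hpos t ht).ne'

/-- The term linear in t / |w - t|² integrates to zero by criticality, and what remains is a square,
positive unless ν sits at 0. It gives both nondegeneracy of the critical point and convexity along
the ray. -/
theorem IsCritical.re_mul_integral_slope_pos {A B β : ℝ} {ν : Measure ℝ} [IsProbabilityMeasure ν]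
    (hν : ν (Set.Icc A B)ᶜ = 0) (h0 : ν ≠ Measure.dirac 0) {w : ℂ} (h : IsCritical ν β w) :
    0 < (w * ∫ t : ℝ, -(t : ℂ) / ((w - t) * (w - t)) ∂ν).re := by
  have hw := h.im_pos
  have hi1 := integrable_of_continuous_of_compl_Icc hν (continuous_div_norm_sq hw)
  have hi2 : Integrable (fun t : ℝ => (t / ‖w - t‖ ^ 2) ^ 2) ν :=
    integrable_of_continuous_of_compl_Icc hν ((continuous_div_norm_sq hw).pow 2)
  rw [← integral_const_mul]
  have h1 := integral_re ((integrable_of_continuous_of_compl_Icc hν (continuous_slope hw)).const_mul w)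
  simp only [RCLike.re_eq_complex_re] at h1
  rw [← h1]
  simp only [re_mul_slope hw]
  rw [integral_add (hi1.const_mul _) (hi2.const_mul _), integral_const_mul,
    h.integral_div_norm_sq hν, mul_zero, zero_add, integral_const_mul]
  refine mul_pos (by positivity) (integral_pos_of_pos_off_zero h0 hi2 (fun t => sq_nonneg _)
    fun t ht => ?_)
  have : ‖w - t‖ ≠ 0 := by simpa using sub_ofReal_ne_zero hw t
  positivity

/-! ### The potential on circles -/

/-- On a circle |z - t|² is affine in Re z, so log x ≤ x - 1 puts the logarithm below its tangent at
w. The tangent terms average to zero at a critical point. -/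
theorem log_norm_sub_le {z w : ℂ} (hz : 0 < z.im) (hw : 0 < w.im) (h : ‖z‖ = ‖w‖) (t : ℝ) :
    Real.log ‖z - t‖ ≤ Real.log ‖w - t‖ - (z.re - w.re) * (t / ‖w - t‖ ^ 2) := by
  have h1 : 0 < ‖z - t‖ := norm_pos_iff.2 (sub_ofReal_ne_zero hz t)
  have h2 : 0 < ‖w - t‖ := norm_pos_iff.2 (sub_ofReal_ne_zero hw t)
  have h3 := Real.log_le_sub_one_of_pos (x := ‖z - t‖ ^ 2 / ‖w - t‖ ^ 2) (by positivity)
  rw [Real.log_div (by positivity) (by positivity), Real.log_pow, Real.log_pow] at h3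
  have h4 : ‖z - t‖ ^ 2 / ‖w - t‖ ^ 2 - 1 = -2 * ((z.re - w.re) * (t / ‖w - t‖ ^ 2)) := by
    rw [div_sub_one (by positivity), norm_sub_ofReal_sq z, norm_sub_ofReal_sq w, h]
    ring
  rw [h4] at h3
  push_cast at h3
  linarith

theorem log_norm_sub_lt {z w : ℂ} (hz : 0 < z.im) (hw : 0 < w.im) (h : ‖z‖ = ‖w‖) (hne : z ≠ w)
    {t : ℝ} (ht : t ≠ 0) :
    Real.log ‖z - t‖ < Real.log ‖w - t‖ - (z.re - w.re) * (t / ‖w - t‖ ^ 2) := by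
  have h1 : 0 < ‖z - t‖ := norm_pos_iff.2 (sub_ofReal_ne_zero hz t)
  have h2 : 0 < ‖w - t‖ := norm_pos_iff.2 (sub_ofReal_ne_zero hw t)
  have hre : z.re ≠ w.re := by
    intro hre
    refine hne (Complex.ext hre ?_)
    have h3 : ‖z‖ ^ 2 = ‖w‖ ^ 2 := by rw [h]
    rw [Complex.sq_norm, Complex.sq_norm, Complex.normSq_apply, Complex.normSq_apply, hre] at h3
    nlinarith
  have h4 : ‖z - t‖ ^ 2 / ‖w - t‖ ^ 2 - 1 = -2 * ((z.re - w.re) * (t / ‖w - t‖ ^ 2)) := by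
    rw [div_sub_one (by positivity), norm_sub_ofReal_sq z, norm_sub_ofReal_sq w, h]
    ring
  have h3 := Real.log_lt_sub_one_of_pos (x := ‖z - t‖ ^ 2 / ‖w - t‖ ^ 2) (by positivity) (by
    rw [← sub_ne_zero, h4]
    have := sub_ne_zero.2 hre
    have h5 : ‖w - t‖ ≠ 0 := h2.ne'
    positivity)
  rw [Real.log_div (by positivity) (by positivity), Real.log_pow, Real.log_pow, h4] at h3
  push_cast at h3
  linarith

/-- The multiplicative form of the tangent bound. It imposes nothing on Im z, so it covers the whole
circle, as the maximum principle requires. -/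
theorem norm_sub_le_mul_exp {z w : ℂ} (hw : 0 < w.im) (h : ‖z‖ = ‖w‖) (t : ℝ) :
    ‖z - t‖ ≤ ‖w - t‖ * Real.exp (-(z.re - w.re) * (t / ‖w - t‖ ^ 2)) := by
  have h2 : 0 < ‖w - t‖ := norm_pos_iff.2 (sub_ofReal_ne_zero hw t)
  refine le_of_sq_le_sq ?_ (by positivity)
  have h3 : ‖z - t‖ ^ 2 = ‖w - t‖ ^ 2 * (2 * (-(z.re - w.re) * (t / ‖w - t‖ ^ 2)) + 1) := by
    have : ‖w - t‖ ^ 2 * (2 * (-(z.re - w.re) * (t / ‖w - t‖ ^ 2)) + 1) =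
        ‖w - t‖ ^ 2 - 2 * (z.re - w.re) * t := by
      field_simp
      ring
    rw [this, norm_sub_ofReal_sq z, norm_sub_ofReal_sq w, h]
    ring
  rw [h3, mul_pow, ← Real.exp_nat_mul]
  gcongr
  exact_mod_cast Real.add_one_le_exp _

theorem norm_prod_sub_le_of_norm_eq {N : ℕ} {d : Fin N → ℝ} {m : ℕ} {z w : ℂ}
    (hw : 0 < w.im) (hcrit : crit d m w = 0) (h : ‖z‖ = ‖w‖) :
    ‖∏ j, (z - d j)‖ ≤ ‖∏ j, (w - d j)‖ := by
  have h0 := avg_div_norm_sq_eq_zero hw hcrit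
  have h1 : ∑ j, d j / ‖w - d j‖ ^ 2 = 0 := by
    rcases Nat.eq_zero_or_pos N with rfl | hN
    · simp
    rw [avg, smul_eq_mul, mul_eq_zero] at h0
    exact h0.resolve_left (by positivity)
  rw [norm_prod, norm_prod]
  calc ∏ j, ‖z - d j‖
      ≤ ∏ j, ‖w - d j‖ * Real.exp (-(z.re - w.re) * (d j / ‖w - d j‖ ^ 2)) :=
        Finset.prod_le_prod (fun _ _ => norm_nonneg _) fun j _ => norm_sub_le_mul_exp hw h _
    _ = _ := by
        rw [Finset.prod_mul_distrib, ← Real.exp_sum, ← Finset.mul_sum, h1]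
        simp

theorem IsCritical.limPot_lt {A B β : ℝ} {ν : Measure ℝ} [IsProbabilityMeasure ν]
    (hν : ν (Set.Icc A B)ᶜ = 0) (h0 : ν ≠ Measure.dirac 0) {z w : ℂ} (hc : IsCritical ν β w)
    (hz : 0 < z.im) (h : ‖z‖ = ‖w‖) (hne : z ≠ w) : limPot ν β z < limPot ν β w := by
  have hw := hc.im_pos
  rw [limPot, limPot, h]
  refine sub_lt_sub_right ?_ _
  have hi0 := integrable_of_continuous_of_compl_Icc hν (continuous_log_norm_sub hz)
  have hi1 := integrable_of_continuous_of_compl_Icc hν (continuous_log_norm_sub hw)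
  have hi2 := (integrable_of_continuous_of_compl_Icc hν (continuous_div_norm_sq hw)).const_mul
    (z.re - w.re)
  have h1 := integral_pos_of_pos_off_zero h0 ((hi1.sub hi2).sub hi0)
    (fun t => sub_nonneg.2 (log_norm_sub_le hz hw h t))
    (fun t ht => sub_pos.2 (log_norm_sub_lt hz hw h hne ht))
  simp only [Pi.sub_apply] at h1
  rw [integral_sub (f := fun t : ℝ => Real.log ‖w - t‖ - (z.re - w.re) * (t / ‖w - t‖ ^ 2))
    (hi1.sub hi2) hi0, integral_sub hi1 hi2, integral_const_mul,
    hc.integral_div_norm_sq hν] at h1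
  linarith

/-! ### Critical points of finite configurations -/

namespace Scaling

variable {ι : Type*} {l : Filter ι} {A B β : ℝ} {ν : Measure ℝ} [IsProbabilityMeasure ν]
  {N m : ι → ℕ} {d : (i : ι) → Fin (N i) → ℝ} {w : ℂ}

theorem tendsto_critSlope (h : Scaling l A B β ν N m d) (hν : ν (Set.Icc A B)ᶜ = 0)
    (hw : 0 < w.im) :
    Tendsto (fun p : ι × (ℂ × ℂ) => critSlope (d p.1) p.2.1 p.2.2) (l ×ˢ 𝓝 (w, w))
      (𝓝 (∫ t : ℝ, -(t : ℂ) / ((w - t) * (w - t)) ∂ν)) := by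
  refine h.tendsto_avg_param (φ := fun (p : ℂ × ℂ) (t : ℝ) => -(t : ℂ) / ((p.1 - t) * (p.2 - t)))
    (fun t _ => ?_) (h.tendsto_avg hν (continuous_slope hw))
  refine ContinuousAt.div₀ (by fun_prop) (by fun_prop) ?_
  exact mul_ne_zero (sub_ofReal_ne_zero hw t) (sub_ofReal_ne_zero hw t)

theorem tendsto_crit (h : Scaling l A B β ν N m d) (hν : ν (Set.Icc A B)ᶜ = 0)
    (hc : IsCritical ν β w) : Tendsto (fun i => crit (d i) (m i) w) l (𝓝 0) := by
  have h1 := (h.tendsto_avg hν (continuous_div_sub hc.im_pos)).sub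
    ((Complex.continuous_ofReal.tendsto _).comp h.tendsto_ratio)
  rw [hc.integral_eq, sub_self] at h1
  exact h1

theorem differentiableAt_crit {N : ℕ} (d : Fin N → ℝ) (m : ℕ) {z : ℂ} (hz : 0 < z.im) :
    DifferentiableAt ℂ (crit d m) z := by
  unfold crit avg
  refine DifferentiableAt.sub_const ?_ _
  refine DifferentiableAt.const_smul ?_ _
  refine DifferentiableAt.fun_sum fun j _ => ?_
  exact differentiableAt_id.div (by fun_prop) (sub_ofReal_ne_zero hz _)

/-- A Hurwitz-type argument: the difference quotients of `crit` stay away from zero near w,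
uniformly in the index, so `crit` is injective there and its image covers a ball of fixed size
around a value tending to 0. -/
theorem exists_tendsto_crit_eq_zero (h : Scaling l A B β ν N m d) (hν : ν (Set.Icc A B)ᶜ = 0)
    (h0 : ν ≠ Measure.dirac 0) (hc : IsCritical ν β w) :
    ∃ W : ι → ℂ, Tendsto W l (𝓝 w) ∧ ∀ᶠ i in l, crit (d i) (m i) (W i) = 0 := by
  have hw := hc.im_pos
  set G := ∫ t : ℝ, -(t : ℂ) / ((w - t) * (w - t)) ∂ν with hG
  have hG0 : G ≠ 0 := by
    intro hG0
    have := hc.re_mul_integral_slope_pos hν h0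
    rw [← hG, hG0] at this
    simp at this
  have hGpos : 0 < ‖G‖ := norm_pos_iff.2 hG0
  have h1 : ∀ᶠ p : ι × (ℂ × ℂ) in l ×ˢ 𝓝 (w, w), ‖G‖ / 2 < ‖critSlope (d p.1) p.2.1 p.2.2‖ :=
    (h.tendsto_critSlope hν hw).norm.eventually (lt_mem_nhds (by linarith))
  obtain ⟨p, hp, q, hq, hpq⟩ := eventually_prod_iff.1 h1
  rw [nhds_prod_eq] at hq
  obtain ⟨s, hs, hsq⟩ := eventually_prod_self_iff (r := fun x y => q (x, y)) |>.1 hq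
  obtain ⟨r0, hr0, hball⟩ := Metric.nhds_basis_closedBall.mem_iff.1
    (inter_mem hs (eventually_im_pos hw))
  have hslope : ∀ i, p i → ∀ z ∈ Metric.closedBall w r0, ∀ z' ∈ Metric.closedBall w r0,
      ‖G‖ / 2 < ‖critSlope (d i) z z'‖ := fun i hi z hz z' hz' =>
    hpq (x := i) hi (y := (z, z')) (hsq z (hball hz).1 z' (hball hz').1)
  have hb : ∀ z ∈ Metric.closedBall w r0, z ∈ s ∧ 0 < z.im := fun z hz => hball hz
  have key : ∀ r, 0 < r → r ≤ r0 → ∀ᶠ i in l, ∃ z ∈ Metric.closedBall w r,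
      crit (d i) (m i) z = 0 := by
    intro r hr hrr
    have hsub : Metric.closedBall w r ⊆ Metric.closedBall w r0 := Metric.closedBall_subset_closedBall hrr
    filter_upwards [hp, (h.tendsto_crit hν hc).norm.eventually (gt_mem_nhds
      (show ‖(0 : ℂ)‖ < r * (‖G‖ / 2) / 2 by rw [norm_zero]; positivity))] with i hi hci
    have hwmem : w ∈ Metric.closedBall w r0 := Metric.mem_closedBall_self hr0.le
    have hdiff : DiffContOnCl ℂ (crit (d i) (m i)) (Metric.ball w r) := by
      refine DifferentiableOn.diffContOnCl fun z hz => ?_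
      rw [closure_ball w hr.ne'] at hz
      exact (differentiableAt_crit _ _ (hb z (hsub hz)).2).differentiableWithinAt
    have hne : ∀ z ∈ Metric.closedBall w r0, ‖crit (d i) (m i) z - crit (d i) (m i) w‖
        = dist z w * ‖critSlope (d i) z w‖ ∧ ‖G‖ / 2 < ‖critSlope (d i) z w‖ := by
      intro z hz
      refine ⟨?_, hslope i hi z hz w hwmem⟩
      rw [crit_sub (d i) (m i) (hb z hz).2 hw, norm_mul, dist_eq_norm]
    have hev : ∀ᶠ z in 𝓝[≠] w, crit (d i) (m i) z ≠ crit (d i) (m i) w := by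
      filter_upwards [mem_nhdsWithin_of_mem_nhds (Metric.closedBall_mem_nhds w hr0),
        self_mem_nhdsWithin] with z hz hzw
      rw [← sub_ne_zero, ← norm_ne_zero_iff, (hne z hz).1]
      have h2 := (hne z hz).2
      exact (mul_pos (dist_pos.2 hzw) (by linarith)).ne'
    -- The quantitative open mapping theorem; it halves the radius, which explains the bound
    -- required of `crit` at w.
    have himg := hdiff.ball_subset_image_closedBall hr (ε := r * (‖G‖ / 2)) (fun z hz => by
      have h2 := hne z (hsub (Metric.sphere_subset_closedBall hz))
      rw [h2.1, Metric.mem_sphere.1 hz]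
      exact mul_le_mul_of_nonneg_left h2.2.le hr.le) (hev.frequently.filter_mono
      nhdsWithin_le_nhds)
    have h3 : (0 : ℂ) ∈ Metric.ball (crit (d i) (m i) w) (r * (‖G‖ / 2) / 2) := by
      rw [Metric.mem_ball, dist_zero_left]; exact hci
    exact himg h3
  classical
  refine ⟨fun i => if hi : ∃ z ∈ Metric.closedBall w r0, crit (d i) (m i) z = 0 then hi.choose
    else 0, ?_, ?_⟩
  · refine Metric.tendsto_nhds.2 fun ε hε => ?_
    have hr : 0 < min r0 (ε / 2) := lt_min hr0 (half_pos hε)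
    filter_upwards [hp, key _ hr (min_le_left _ _)] with i hi hz
    obtain ⟨z, hz, hz0⟩ := hz
    have hz' := Metric.closedBall_subset_closedBall (min_le_left r0 (ε / 2)) hz
    have hex : ∃ z ∈ Metric.closedBall w r0, crit (d i) (m i) z = 0 := ⟨z, hz', hz0⟩
    rw [dif_pos hex]
    obtain ⟨hy, hy0⟩ := hex.choose_spec
    set y := hex.choose
    -- The nonvanishing quotient identifies the chosen root with one lying in the smaller ball.
    have h2 := crit_sub (d i) (m i) (hb _ hy).2 (hb _ hz').2
    have h3 := hslope i hi y hy z hz'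
    rw [hy0, hz0, sub_zero, eq_comm, mul_eq_zero] at h2
    have h4 : critSlope (d i) y z ≠ 0 := by
      intro h5; simp only [h5, norm_zero] at h3; linarith
    rw [sub_eq_zero.1 (h2.resolve_right h4)]
    have := (Metric.mem_closedBall.1 hz).trans (min_le_right _ _)
    linarith
  · filter_upwards [key r0 hr0 le_rfl] with i hi
    rw [dif_pos hi]
    exact hi.choose_spec.2

end Scaling

/-! ### The potential on rays -/

theorem mul_exp_im (w : ℂ) (s : ℝ) : (w * Real.exp s).im = w.im * Real.exp s := by
  simp [Complex.mul_im, -Complex.ofReal_exp]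

theorem mul_exp_im_pos {w : ℂ} (hw : 0 < w.im) (s : ℝ) : 0 < (w * Real.exp s).im := by
  rw [mul_exp_im]; positivity

theorem norm_mul_exp (w : ℂ) (s : ℝ) : ‖w * Real.exp s‖ = ‖w‖ * Real.exp s := by
  rw [norm_mul, Complex.norm_real, Real.norm_eq_abs, abs_of_pos (Real.exp_pos s)]

theorem hasDerivAt_mul_exp (w : ℂ) (s : ℝ) :
    HasDerivAt (fun s : ℝ => w * (Real.exp s : ℂ)) (w * Real.exp s) s :=
  ((Real.hasDerivAt_exp s).ofReal_comp).const_mul w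

theorem hasDerivAt_log_norm_ray {w : ℂ} (hw : 0 < w.im) (t s : ℝ) :
    HasDerivAt (fun s : ℝ => Real.log ‖w * Real.exp s - t‖)
      (w * Real.exp s / (w * Real.exp s - t)).re s := by
  have him : 0 < (w * Real.exp s - t).im := by
    rw [Complex.sub_im, Complex.ofReal_im, sub_zero]; exact mul_exp_im_pos hw s
  have h1 : HasDerivAt (fun s : ℝ => Complex.log (w * Real.exp s - t))
      (w * Real.exp s / (w * Real.exp s - t)) s :=
    ((hasDerivAt_mul_exp w s).sub_const _).clog_real (Or.inr him.ne')
  have h2 := (Complex.reCLM.hasFDerivAt).comp_hasDerivAt s h1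
  simpa [Function.comp_def, Complex.log_re] using h2

theorem hasDerivAt_pot_ray {N : ℕ} (d : Fin N → ℝ) (m : ℕ) {w : ℂ} (hw : 0 < w.im) (s : ℝ) :
    HasDerivAt (fun s : ℝ => pot d m (w * Real.exp s)) (crit d m (w * Real.exp s)).re s := by
  have h0 := hasDerivAt_log_norm_ray hw 0 s
  have hne : w * Real.exp s ≠ 0 := ne_zero_of_im_pos (mul_exp_im_pos hw s)
  simp only [Complex.ofReal_zero, sub_zero, div_self hne, Complex.one_re] at h0
  have h1 : HasDerivAt (fun s : ℝ => avg d fun t => Real.log ‖w * Real.exp s - t‖)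
      (avg d fun t => (w * Real.exp s / (w * Real.exp s - t)).re) s := by
    unfold avg
    exact (HasDerivAt.fun_sum fun j _ => hasDerivAt_log_norm_ray hw (d j) s).const_smul
      (R := ℝ) (N : ℝ)⁻¹
  have h2 := h1.sub (h0.const_mul (m / N : ℝ))
  rw [mul_one] at h2
  rw [crit, Complex.sub_re, avg_re, Complex.ofReal_re]
  exact h2

/-- Along the ray the derivative in s is Re crit(W e^s) = (e^s - 1) Re(W · slope), and Re(W · slope)
exceeds κ near the critical point. Comparison with κ (e^s - s) on both sides of s = 0 gives the
bound. -/
theorem Scaling.exists_pot_ray_ge {ι : Type*} {l : Filter ι} {A B β : ℝ} {ν : Measure ℝ}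
    [IsProbabilityMeasure ν] {N m : ι → ℕ} {d : (i : ι) → Fin (N i) → ℝ} {w : ℂ}
    (h : Scaling l A B β ν N m d) (hν : ν (Set.Icc A B)ᶜ = 0) (h0 : ν ≠ Measure.dirac 0)
    (hc : IsCritical ν β w) {W : ι → ℂ} (hW : Tendsto W l (𝓝 w))
    (hW0 : ∀ᶠ i in l, crit (d i) (m i) (W i) = 0) :
    ∃ δ > 0, ∃ κ > 0, ∀ᶠ i in l, ∀ s ∈ Set.Icc (-δ) δ,
      pot (d i) (m i) (W i) + κ * (Real.exp s - 1 - s) ≤ pot (d i) (m i) (W i * Real.exp s) := by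
  have hw := hc.im_pos
  set G := ∫ t : ℝ, -(t : ℂ) / ((w - t) * (w - t)) ∂ν with hG
  have hpos : 0 < (w * G).re := hc.re_mul_integral_slope_pos hν h0
  set κ := (w * G).re / 2 with hκ
  have h1 : Tendsto (fun p : ι × (ℂ × ℂ) => p.2.2 * critSlope (d p.1) p.2.1 p.2.2)
      (l ×ˢ 𝓝 (w, w)) (𝓝 (w * G)) :=
    ((continuous_snd.tendsto (w, w)).comp tendsto_snd).mul (h.tendsto_critSlope hν hw)
  have h2 : ∀ᶠ p : ι × (ℂ × ℂ) in l ×ˢ 𝓝 (w, w), κ < (p.2.2 * critSlope (d p.1) p.2.1 p.2.2).re :=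
    ((Complex.continuous_re.tendsto _).comp h1).eventually (lt_mem_nhds (by linarith))
  obtain ⟨p, hp, q, hq, hpq⟩ := eventually_prod_iff.1 h2
  have hcont : Tendsto (fun x : ℂ × ℝ => (x.1 * Real.exp x.2, x.1)) (𝓝 (w, 0)) (𝓝 (w, w)) := by
    have : Continuous (fun x : ℂ × ℝ => (x.1 * (Real.exp x.2 : ℂ), x.1)) := by fun_prop
    simpa using this.tendsto (w, 0)
  have h3 := hcont.eventually hq
  rw [nhds_prod_eq] at h3
  obtain ⟨p', hp', q', hq', hpq'⟩ := eventually_prod_iff.1 h3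
  obtain ⟨δ, hδ, hball⟩ := Metric.nhds_basis_closedBall.mem_iff.1 hq'
  refine ⟨δ, hδ, κ, by positivity, ?_⟩
  filter_upwards [hp, hW.eventually hp', hW0, hW.eventually (eventually_im_pos hw)]
    with i hpi hpi' hWi him s hs
  have hre : ∀ s ∈ Set.Icc (-δ) δ, (crit (d i) (m i) (W i * Real.exp s)).re =
      (Real.exp s - 1) * (W i * critSlope (d i) (W i * Real.exp s) (W i)).re ∧
      κ < (W i * critSlope (d i) (W i * Real.exp s) (W i)).re := by
    intro s hs
    refine ⟨?_, hpq hpi (hpq' hpi' (hball ?_))⟩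
    · have := crit_sub (d i) (m i) (mul_exp_im_pos him s) him
      rw [hWi, sub_zero] at this
      rw [this]
      have h4 : (W i * Real.exp s - W i) * critSlope (d i) (W i * Real.exp s) (W i) =
        ((Real.exp s - 1 : ℝ) : ℂ) * (W i * critSlope (d i) (W i * Real.exp s) (W i)) := by
        push_cast; ring
      rw [h4, Complex.re_ofReal_mul]
    · rw [Metric.mem_closedBall, Real.dist_eq, sub_zero]; exact abs_le.2 hs
  set F : ℝ → ℝ := fun s => pot (d i) (m i) (W i * Real.exp s) - κ * (Real.exp s - s) with hF
  have hderiv : ∀ s, HasDerivAt F ((crit (d i) (m i) (W i * Real.exp s)).re - κ * (Real.exp s - 1)) s :=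
    fun s => (hasDerivAt_pot_ray (d i) (m i) him s).sub
      (((Real.hasDerivAt_exp s).sub (hasDerivAt_id s)).const_mul κ)
  have hcontF : Continuous F := continuous_iff_continuousAt.2 fun s => (hderiv s).continuousAt
  have hF0 : F 0 ≤ F s := by
    rcases le_total 0 s with h5 | h5
    · refine monotoneOn_of_deriv_nonneg (convex_Icc 0 δ) hcontF.continuousOn
        (fun s _ => (hderiv s).differentiableAt.differentiableWithinAt) (fun s hs => ?_)
        (Set.left_mem_Icc.2 hδ.le) ⟨h5, hs.2⟩ h5
      rw [interior_Icc] at hs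
      have h6 := hre s ⟨by linarith [hs.1], hs.2.le⟩
      rw [(hderiv s).deriv, h6.1]
      have : 0 < Real.exp s - 1 := by linarith [Real.add_one_le_exp s, hs.1]
      nlinarith [h6.2]
    · refine antitoneOn_of_deriv_nonpos (convex_Icc (-δ) 0) hcontF.continuousOn
        (fun s _ => (hderiv s).differentiableAt.differentiableWithinAt) (fun s hs => ?_)
        ⟨hs.1, h5⟩ (Set.right_mem_Icc.2 (by linarith)) h5
      rw [interior_Icc] at hs
      have h6 := hre s ⟨hs.1.le, by linarith [hs.2]⟩
      rw [(hderiv s).deriv, h6.1]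
      have : Real.exp s < 1 := Real.exp_lt_one_iff.2 hs.2
      nlinarith [h6.2]
  simp only [hF, Real.exp_zero, Complex.ofReal_one, mul_one] at hF0
  linarith

end GelfandTsetlin

/-! ### The maximum principle on annuli and uniqueness of the critical point. -/

namespace GelfandTsetlin

theorem eventually_forall_of_isCompact {ι Y : Type*} [TopologicalSpace Y] {l : Filter ι}
    {K : Set Y} (hK : IsCompact K) {P : ι → Y → Prop}
    (h : ∀ y ∈ K, ∀ᶠ p in l ×ˢ 𝓝 y, P p.1 p.2) : ∀ᶠ i in l, ∀ y ∈ K, P i y := by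
  have h1 : ∀ᶠ p in l ×ˢ 𝓝ˢ K, P p.1 p.2 := by
    rw [hK.prod_nhdsSet_eq_biSup]
    simpa [Filter.eventually_iSup] using h
  obtain ⟨p, hp, q, hq, hpq⟩ := eventually_prod_iff.1 h1
  filter_upwards [hp] with i hi y hy
  exact hpq hi (hq.self_of_nhdsSet y hy)

theorem norm_le_of_annulus {f : ℂ → ℂ} {a b M : ℝ} (ha : 0 < a)
    (hf : ∀ z, z ≠ 0 → DifferentiableAt ℂ f z) (h1 : ∀ z, ‖z‖ = a → ‖f z‖ ≤ M)
    (h2 : ∀ z, ‖z‖ = b → ‖f z‖ ≤ M) {z : ℂ} (hz : a < ‖z‖) (hz' : ‖z‖ < b) : ‖f z‖ ≤ M := by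
  set U : Set ℂ := {z | a < ‖z‖ ∧ ‖z‖ < b} with hU
  have hopen : IsOpen U := (isOpen_lt continuous_const continuous_norm).inter
    (isOpen_lt continuous_norm continuous_const)
  have hcl : closure U ⊆ {z | a ≤ ‖z‖ ∧ ‖z‖ ≤ b} := by
    refine closure_minimal (fun z hz => ⟨hz.1.le, hz.2.le⟩) ?_
    exact (isClosed_le continuous_const continuous_norm).inter
      (isClosed_le continuous_norm continuous_const)
  refine Complex.norm_le_of_forall_mem_frontier_norm_le (U := U) ?_ ?_ ?_ (subset_closure ⟨hz, hz'⟩)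
  · refine (Metric.isBounded_ball (x := (0 : ℂ)) (r := b)).subset fun z hz => ?_
    simpa using hz.2
  · refine DifferentiableOn.diffContOnCl fun z hz => ?_
    have h3 := (hcl hz).1
    exact (hf z (norm_pos_iff.1 (ha.trans_le h3))).differentiableWithinAt
  · intro z hz
    rw [hopen.frontier_eq] at hz
    obtain ⟨h3, h4⟩ := hcl hz.1
    rcases h3.eq_or_lt with h5 | h5
    · exact h1 z h5.symm
    rcases h4.eq_or_lt with h6 | h6
    · exact h2 z h6
    exact absurd ⟨h5, h6⟩ hz.2

/-- The point of the upper half plane with given modulus and real part. -/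
noncomputable def upperPoint (r x : ℝ) : ℂ := ⟨x, √(r ^ 2 - x ^ 2)⟩

theorem upperPoint_im_pos {r x : ℝ} (hx : x ∈ Set.Ioo (-r) r) : 0 < (upperPoint r x).im :=
  Real.sqrt_pos.2 (by nlinarith [hx.1, hx.2])

theorem norm_upperPoint {r x : ℝ} (hx : x ∈ Set.Icc (-r) r) : ‖upperPoint r x‖ = r := by
  have hr : 0 ≤ r := by linarith [hx.1, hx.2]
  rw [Complex.norm_def, Complex.normSq_apply, upperPoint]
  simp only
  rw [Real.mul_self_sqrt (by nlinarith [hx.1, hx.2])]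
  rw [show x * x + (r ^ 2 - x ^ 2) = r ^ 2 by ring, Real.sqrt_sq hr]

theorem continuous_upperPoint (r : ℝ) : Continuous (upperPoint r) := by
  have : upperPoint r = fun x : ℝ => (x : ℂ) + ((√(r ^ 2 - x ^ 2) : ℝ) : ℂ) * Complex.I := by
    ext x; exact (Complex.mk_eq_add_mul_I _ _)
  rw [this]
  fun_prop

theorem eq_upperPoint {z : ℂ} (hz : 0 < z.im) : z = upperPoint ‖z‖ z.re := by
  refine Complex.ext rfl ?_
  rw [upperPoint, Complex.sq_norm, Complex.normSq_apply]
  simp only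
  rw [show z.re * z.re + z.im * z.im - z.re ^ 2 = z.im ^ 2 by ring, Real.sqrt_sq hz.le]

theorem re_mem_Ioo {z : ℂ} (hz : 0 < z.im) : z.re ∈ Set.Ioo (-‖z‖) ‖z‖ :=
  abs_lt.1 (Complex.abs_re_lt_norm.2 hz.ne')

theorem exists_shrink_factor {a b δ : ℝ} (ha : 0 < a) (hb : 0 < b) (hab : a ≠ b) (hδ : 0 < δ) :
    ∃ s ∈ Set.Icc (-δ) δ, s ≠ 0 ∧ (a < b → a < b * Real.exp s ∧ b * Real.exp s < b) ∧
      (b < a → b * Real.exp s < a ∧ b < b * Real.exp s) := by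
  have hs0 : Real.log (a / b) ≠ 0 := by
    refine Real.log_ne_zero_of_pos_of_ne_one (by positivity) ?_
    rwa [Ne, div_eq_one_iff_eq hb.ne']
  have hae : a = b * Real.exp (Real.log (a / b)) := by
    rw [Real.exp_log (by positivity)]; field_simp
  set s0 := Real.log (a / b) with hs0'
  -- The factor 1/2 keeps b e^s strictly between a and b; the other bound keeps s in the window
  -- where the ray estimate holds.
  set τ := min (1 / 2) (δ / |s0|) with hτ
  have habs : 0 < |s0| := abs_pos.2 hs0
  have hτ0 : 0 < τ := lt_min (by norm_num) (by positivity)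
  have hτ1 : τ ≤ 1 / 2 := min_le_left _ _
  have hτ2 : τ * |s0| ≤ δ := (le_div_iff₀ habs).1 (min_le_right _ _)
  refine ⟨τ * s0, abs_le.1 (by rwa [abs_mul, abs_of_pos hτ0]), mul_ne_zero hτ0.ne' hs0, ?_, ?_⟩
  · intro h
    have : s0 < 0 := Real.log_neg (by positivity) ((div_lt_one hb).2 h)
    refine ⟨?_, mul_lt_of_lt_one_right hb (Real.exp_lt_one_iff.2 (mul_neg_of_pos_of_neg hτ0 this))⟩
    rw [hae]
    exact mul_lt_mul_of_pos_left (Real.exp_lt_exp.2 (by nlinarith)) hb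
  · intro h
    have : 0 < s0 := Real.log_pos ((one_lt_div hb).2 h)
    refine ⟨?_, lt_mul_of_one_lt_right hb (Real.one_lt_exp_iff.2 (mul_pos hτ0 this))⟩
    rw [hae]
    exact mul_lt_mul_of_pos_left (Real.exp_lt_exp.2 (by nlinarith)) hb

/-- Shrinking the real part by e = exp(-2a) moves z away from the real axis at bounded cost: e (r² -
2xt + t²) ≤ r² - 2ext + t². The potential then only has to be controlled on a compact arc. -/
theorem norm_sub_le_exp_mul_norm_upperPoint {r a : ℝ} (hr : 0 < r) (ha : 0 < a) {z : ℂ}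
    (hz : ‖z‖ = r) (t : ℝ) :
    ‖z - t‖ ≤ Real.exp a * ‖upperPoint r (z.re * Real.exp (-(2 * a))) - t‖ := by
  obtain ⟨e, he⟩ : ∃ e, e = Real.exp (-(2 * a)) := ⟨_, rfl⟩
  have he0 : 0 < e := he ▸ Real.exp_pos _
  have he1 : e < 1 := he ▸ Real.exp_lt_one_iff.2 (by linarith)
  have h3 := abs_le.1 (hz ▸ Complex.abs_re_le_norm z)
  have hx : z.re * e ∈ Set.Icc (-r) r := by constructor <;> nlinarith [h3.1, h3.2]
  refine le_of_sq_le_sq ?_ (by positivity)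
  rw [← he, mul_pow, ← Real.exp_nat_mul, norm_sub_ofReal_sq, norm_sub_ofReal_sq, hz,
    norm_upperPoint hx]
  have h4 : ((2 : ℕ) : ℝ) * a = -(-(2 * a)) := by push_cast; ring
  rw [h4, Real.exp_neg, ← he, le_inv_mul_iff₀ he0]
  have h5 : (upperPoint r (z.re * e)).re = z.re * e := rfl
  rw [h5]
  nlinarith [mul_nonneg (sub_pos.2 he1).le (add_nonneg (sq_nonneg r) (sq_nonneg t))]

/-- The maximum principle on the annulus between the circle through a critical point and another
circle. -/
theorem pot_le_max_of_between {N : ℕ} {d : Fin N → ℝ} {m : ℕ} (hN : 0 < N) {w : ℂ}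
    (hw : 0 < w.im) (hcrit : crit d m w = 0) {r a L : ℝ} (hr : 0 < r) (ha : 0 < a)
    (hL : ∀ x ∈ Set.Icc (-(r * Real.exp (-(2 * a)))) (r * Real.exp (-(2 * a))),
      pot d m (upperPoint r x) ≤ L) {z : ℂ} (hz : 0 < z.im)
    (hbet : r < ‖z‖ ∧ ‖z‖ < ‖w‖ ∨ ‖w‖ < ‖z‖ ∧ ‖z‖ < r) :
    pot d m z ≤ max (pot d m w) (L + a) := by
  have hNpos : (0 : ℝ) < N := by exact_mod_cast hN
  -- The maximum principle is applied to this function on the full annulus, including its real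
  -- points; in the upper half plane its modulus is exp(N · `pot`).
  have hfd : ∀ z : ℂ, z ≠ 0 → DifferentiableAt ℂ (fun z : ℂ => (∏ j, (z - d j)) / z ^ m) z := by
    intro z hz
    refine DifferentiableAt.div ?_ (by fun_prop) (pow_ne_zero _ hz)
    exact DifferentiableAt.fun_finsetProd fun j _ => by fun_prop
  have hfpot : ∀ z : ℂ, 0 < z.im →
      ‖(∏ j, (z - d j)) / z ^ m‖ = Real.exp (N * pot d m z) := fun z hz => by
    rw [exp_card_mul_pot _ _ hN hz, norm_div, norm_pow]
  have hM1 : Real.exp (N * pot d m w) ≤ Real.exp (N * max (pot d m w) (L + a)) :=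
    Real.exp_le_exp.2 (mul_le_mul_of_nonneg_left (le_max_left _ _) hNpos.le)
  have hM2 : Real.exp (N * (L + a)) ≤ Real.exp (N * max (pot d m w) (L + a)) :=
    Real.exp_le_exp.2 (mul_le_mul_of_nonneg_left (le_max_right _ _) hNpos.le)
  have hcircW : ∀ z : ℂ, ‖z‖ = ‖w‖ →
      ‖(∏ j, (z - d j)) / z ^ m‖ ≤ Real.exp (N * max (pot d m w) (L + a)) := by
    intro z hz
    refine le_trans ?_ hM1
    rw [← hfpot _ hw, norm_div, norm_div, norm_pow, norm_pow, hz]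
    exact div_le_div_of_nonneg_right (norm_prod_sub_le_of_norm_eq hw hcrit hz) (by positivity)
  have hcircr : ∀ z : ℂ, ‖z‖ = r →
      ‖(∏ j, (z - d j)) / z ^ m‖ ≤ Real.exp (N * max (pot d m w) (L + a)) := by
    intro z hz
    refine le_trans ?_ hM2
    have he0 : 0 < Real.exp (-(2 * a)) := Real.exp_pos _
    have he1 : Real.exp (-(2 * a)) < 1 := Real.exp_lt_one_iff.2 (by linarith)
    have h3 := abs_le.1 (hz ▸ Complex.abs_re_le_norm z)
    have hx : z.re * Real.exp (-(2 * a)) ∈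
        Set.Icc (-(r * Real.exp (-(2 * a)))) (r * Real.exp (-(2 * a))) := by
      constructor <;> nlinarith [h3.1, h3.2]
    have hx' : z.re * Real.exp (-(2 * a)) ∈ Set.Ioo (-r) r := by
      constructor <;> nlinarith [hx.1, hx.2]
    have hpot := hL _ hx
    have hn := norm_upperPoint (Set.Ioo_subset_Icc_self hx')
    have hb : ‖∏ j, (z - d j)‖ ≤ Real.exp a ^ N *
        ‖∏ j, (upperPoint r (z.re * Real.exp (-(2 * a))) - d j)‖ := by
      rw [norm_prod, norm_prod]
      calc ∏ j, ‖z - d j‖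
          ≤ ∏ j, Real.exp a * ‖upperPoint r (z.re * Real.exp (-(2 * a))) - d j‖ :=
            Finset.prod_le_prod (fun _ _ => norm_nonneg _) fun j _ =>
              norm_sub_le_exp_mul_norm_upperPoint hr ha hz _
        _ = _ := by rw [Finset.prod_mul_distrib]; simp
    have hf := hfpot _ (upperPoint_im_pos hx')
    rw [norm_div, norm_pow, hn] at hf
    calc ‖(∏ j, (z - d j)) / z ^ m‖ = ‖∏ j, (z - d j)‖ / r ^ m := by rw [norm_div, norm_pow, hz]
      _ ≤ Real.exp a ^ N * ‖∏ j, (upperPoint r (z.re * Real.exp (-(2 * a))) - d j)‖ / r ^ m :=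
          div_le_div_of_nonneg_right hb (by positivity)
      _ = Real.exp (N * a) *
            Real.exp (N * pot d m (upperPoint r (z.re * Real.exp (-(2 * a))))) := by
          rw [← hf, Real.exp_nat_mul, mul_div_assoc]
      _ ≤ _ := by
          rw [← Real.exp_add]
          refine Real.exp_le_exp.2 ?_
          nlinarith
  have hw0 := norm_pos_iff.2 (ne_zero_of_im_pos hw)
  have hmid : ‖(∏ j, (z - d j)) / z ^ m‖ ≤ Real.exp (N * max (pot d m w) (L + a)) := by
    rcases hbet with ⟨h3, h4⟩ | ⟨h3, h4⟩
    · exact norm_le_of_annulus (f := fun z : ℂ => (∏ j, (z - d j)) / z ^ m) hr hfd hcircr hcircW h3 h4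
    · exact norm_le_of_annulus (f := fun z : ℂ => (∏ j, (z - d j)) / z ^ m) hw0 hfd hcircW hcircr h3 h4
  rwa [hfpot _ hz, Real.exp_le_exp, mul_le_mul_iff_right₀ hNpos] at hmid

/-- On every circle around the origin other than the one through the critical point, the potential
exceeds its critical value somewhere. -/
theorem Scaling.exists_limPot_gt {ι : Type*} {l : Filter ι} [l.NeBot] {A B β : ℝ} {ν : Measure ℝ}
    [IsProbabilityMeasure ν] {N m : ι → ℕ} {d : (i : ι) → Fin (N i) → ℝ} {w : ℂ}
    (h : Scaling l A B β ν N m d) (hν : ν (Set.Icc A B)ᶜ = 0) (h0 : ν ≠ Measure.dirac 0)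
    (hc : IsCritical ν β w) {r : ℝ} (hr : 0 < r) (hrw : r ≠ ‖w‖) :
    ∃ z : ℂ, 0 < z.im ∧ ‖z‖ = r ∧ limPot ν β w < limPot ν β z := by
  by_contra! hcon
  have hw := hc.im_pos
  have hRpos : 0 < ‖w‖ := norm_pos_iff.2 (ne_zero_of_im_pos hw)
  obtain ⟨W, hW, hW0⟩ := h.exists_tendsto_crit_eq_zero hν h0 hc
  obtain ⟨δ, hδ, κ, hκ, hray⟩ := h.exists_pot_ray_ge hν h0 hc hW hW0
  obtain ⟨s, hs, hs0, hs1, hs2⟩ := exists_shrink_factor hr hRpos hrw hδ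
  -- The gain 8a on the ray beats the three losses of size a: convergence on the arc, convergence at
  -- W, and the move away from the real axis.
  obtain ⟨a, ha⟩ : ∃ a, κ * (Real.exp s - 1 - s) = 8 * a :=
    ⟨κ * (Real.exp s - 1 - s) / 8, by ring⟩
  have hapos : 0 < a := by
    have : 0 < κ * (Real.exp s - 1 - s) := mul_pos hκ (by linarith [Real.add_one_lt_exp hs0])
    linarith
  have hKpot : ∀ᶠ i in l, ∀ x ∈ Set.Icc (-(r * Real.exp (-(2 * a)))) (r * Real.exp (-(2 * a))),
      pot (d i) (m i) (upperPoint r x) ≤ limPot ν β w + a := by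
    refine eventually_forall_of_isCompact isCompact_Icc fun x hx => ?_
    have hre : r * Real.exp (-(2 * a)) < r :=
      mul_lt_of_lt_one_right hr (Real.exp_lt_one_iff.2 (by linarith))
    have hx' : x ∈ Set.Ioo (-r) r := ⟨by linarith [hx.1], by linarith [hx.2]⟩
    have him := upperPoint_im_pos hx'
    have h1 : Tendsto (fun p : ι × ℝ => (p.1, upperPoint r p.2)) (l ×ˢ 𝓝 x)
        (l ×ˢ 𝓝 (upperPoint r x)) :=
      tendsto_fst.prodMk (((continuous_upperPoint r).tendsto x).comp tendsto_snd)
    have h2 := ((h.tendsto_pot him).comp h1).eventually (gt_mem_nhds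
      (show limPot ν β (upperPoint r x) < limPot ν β w + a by
        linarith [hcon _ him (norm_upperPoint (Set.Ioo_subset_Icc_self hx'))]))
    filter_upwards [h2] with p hp using hp.le
  have hpotW : Tendsto (fun i => pot (d i) (m i) (W i)) l (𝓝 (limPot ν β w)) :=
    h.tendsto_pot_comp hw hW
  have hnW : ∀ᶠ i in l, r < ‖W i * Real.exp s‖ ∧ ‖W i * Real.exp s‖ < ‖W i‖ ∨
      ‖W i‖ < ‖W i * Real.exp s‖ ∧ ‖W i * Real.exp s‖ < r := by
    simp only [norm_mul_exp]
    have hn : Tendsto (fun i => ‖W i‖ * Real.exp s) l (𝓝 (‖w‖ * Real.exp s)) := hW.norm.mul_const _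
    have hn0 := hW.norm.eventually (lt_mem_nhds hRpos)
    rcases lt_or_gt_of_ne hrw with h3 | h3
    · filter_upwards [hn.eventually (lt_mem_nhds (hs1 h3).1), hn0] with i hi hi0
      exact Or.inl ⟨hi, mul_lt_of_lt_one_right hi0 ((mul_lt_iff_lt_one_right hRpos).1 (hs1 h3).2)⟩
    · filter_upwards [hn.eventually (gt_mem_nhds (hs2 h3).1), hn0] with i hi hi0
      exact Or.inr ⟨lt_mul_of_one_lt_right hi0 ((lt_mul_iff_one_lt_right hRpos).1 (hs2 h3).2), hi⟩
  have hpotW' := hpotW.eventually (lt_mem_nhds (show limPot ν β w - a < limPot ν β w by linarith))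
  obtain ⟨i, hrayi, hKi, hWi, hNi, him, hcri, hnWi⟩ := (hray.and (hKpot.and (hpotW'.and
    (h.eventually_card_pos.and ((hW.eventually (eventually_im_pos hw)).and
    (hW0.and hnW)))))).exists
  have h5 := pot_le_max_of_between hNi him hcri hr hapos hKi (mul_exp_im_pos him s) hnWi
  have h6 := hrayi s hs
  rw [ha] at h6
  rcases le_max_iff.1 h5 with h3 | h3 <;> linarith

/-- The critical point in the upper half plane is unique. -/
theorem Scaling.isCritical_unique {ι : Type*} {l : Filter ι} [l.NeBot] {A B β : ℝ} {ν : Measure ℝ}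
    [IsProbabilityMeasure ν] {N m : ι → ℕ} {d : (i : ι) → Fin (N i) → ℝ} {w w' : ℂ}
    (h : Scaling l A B β ν N m d) (hν : ν (Set.Icc A B)ᶜ = 0) (h0 : ν ≠ Measure.dirac 0)
    (hc : IsCritical ν β w) (hc' : IsCritical ν β w') : w' = w := by
  by_contra hne
  -- Some point of the circle through z' beats z, and z' is the maximum of its own circle.
  -- Exchanging z and z' gives the contradiction.
  have hle : ∀ {z z' : ℂ}, IsCritical ν β z → IsCritical ν β z' → ‖z'‖ ≠ ‖z‖ →
      limPot ν β z < limPot ν β z' := by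
    intro z z' hz hz' hn
    obtain ⟨y, hy, hyn, hyl⟩ := h.exists_limPot_gt hν h0 hz
      (norm_pos_iff.2 (ne_zero_of_im_pos hz'.im_pos)) hn
    rcases eq_or_ne y z' with rfl | h1
    · exact hyl
    · exact hyl.trans (hz'.limPot_lt hν h0 hy hyn h1)
  by_cases hn : ‖w'‖ = ‖w‖
  · exact lt_asymm (hc.limPot_lt hν h0 hc'.im_pos hn hne)
      (hc'.limPot_lt hν h0 hc.im_pos hn.symm (Ne.symm hne))
  · exact lt_asymm (hle hc hc' hn) (hle hc' hc (Ne.symm hn))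

end GelfandTsetlin

namespace GelfandTsetlin

/-! ### Superlevel sets of the limiting potential -/

theorem upperPoint_re (r x : ℝ) : (upperPoint r x).re = x := rfl

/-- With the modulus fixed, the squared distance to t is affine in the real part, so its logarithm
is concave. -/
theorem log_norm_upperPoint_concave {r x y a b : ℝ} (hx : x ∈ Set.Ioo (-r) r)
    (hy : y ∈ Set.Ioo (-r) r) (ha : 0 ≤ a) (hb : 0 ≤ b) (hab : a + b = 1) (t : ℝ) :
    a * Real.log ‖upperPoint r x - t‖ + b * Real.log ‖upperPoint r y - t‖ ≤
      Real.log ‖upperPoint r (a * x + b * y) - t‖ := by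
  have hxy : a * x + b * y ∈ Set.Ioo (-r) r := (convex_Ioo (-r) r) hx hy ha hb hab
  have key : ∀ s ∈ Set.Ioo (-r) r, 2 * Real.log ‖upperPoint r s - t‖ =
      Real.log (r ^ 2 - 2 * s * t + t ^ 2) ∧ 0 < r ^ 2 - 2 * s * t + t ^ 2 := by
    intro s hs
    have h1 := norm_sub_ofReal_sq (upperPoint r s) t
    rw [norm_upperPoint (Set.Ioo_subset_Icc_self hs), upperPoint_re] at h1
    have h2 := norm_pos_iff.2 (sub_ofReal_ne_zero (upperPoint_im_pos hs) t)
    rw [← h1, Real.log_pow]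
    exact ⟨by push_cast; ring, by positivity⟩
  have h := strictConcaveOn_log_Ioi.concaveOn.2 (key x hx).2 (key y hy).2 ha hb hab
  simp only [smul_eq_mul] at h
  have h3 : a * (r ^ 2 - 2 * x * t + t ^ 2) + b * (r ^ 2 - 2 * y * t + t ^ 2) =
      r ^ 2 - 2 * (a * x + b * y) * t + t ^ 2 := by
    have : b = 1 - a := by linarith
    subst this; ring
  rw [h3, ← (key x hx).1, ← (key y hy).1, ← (key _ hxy).1] at h
  linarith

section Superlevel

variable {A B β : ℝ} {ν : Measure ℝ} [IsProbabilityMeasure ν]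

theorem limPot_upperPoint_concave (hν : ν (Set.Icc A B)ᶜ = 0) {r x y a b : ℝ}
    (hx : x ∈ Set.Ioo (-r) r) (hy : y ∈ Set.Ioo (-r) r) (ha : 0 ≤ a) (hb : 0 ≤ b)
    (hab : a + b = 1) :
    a * limPot ν β (upperPoint r x) + b * limPot ν β (upperPoint r y) ≤
      limPot ν β (upperPoint r (a * x + b * y)) := by
  have hxy : a * x + b * y ∈ Set.Ioo (-r) r := (convex_Ioo (-r) r) hx hy ha hb hab
  have hi : ∀ s ∈ Set.Ioo (-r) r, Integrable (fun t : ℝ => Real.log ‖upperPoint r s - t‖) ν :=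
    fun s hs => integrable_of_continuous_of_compl_Icc hν
      (continuous_log_norm_sub (upperPoint_im_pos hs))
  have h1 := integral_mono (((hi x hx).const_mul a).add ((hi y hy).const_mul b)) (hi _ hxy)
    fun t => log_norm_upperPoint_concave hx hy ha hb hab t
  simp only [Pi.add_apply] at h1
  rw [integral_add ((hi x hx).const_mul a) ((hi y hy).const_mul b), integral_const_mul,
    integral_const_mul] at h1
  simp only [limPot, norm_upperPoint (Set.Ioo_subset_Icc_self hx),
    norm_upperPoint (Set.Ioo_subset_Icc_self hy), norm_upperPoint (Set.Ioo_subset_Icc_self hxy)]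
  have : b = 1 - a := by linarith
  subst this
  linarith

theorem isPreconnected_superlevel_slice (hν : ν (Set.Icc A B)ᶜ = 0) (L r : ℝ) :
    IsPreconnected {z : ℂ | 0 < z.im ∧ ‖z‖ = r ∧ L < limPot ν β z} := by
  have h1 : {z : ℂ | 0 < z.im ∧ ‖z‖ = r ∧ L < limPot ν β z} =
      upperPoint r '' {x | x ∈ Set.Ioo (-r) r ∧ L < limPot ν β (upperPoint r x)} := by
    ext z
    constructor
    · rintro ⟨hz, rfl, hL⟩
      refine ⟨z.re, ⟨re_mem_Ioo hz, ?_⟩, (eq_upperPoint hz).symm⟩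
      rwa [← eq_upperPoint hz]
    · rintro ⟨x, ⟨hx, hL⟩, rfl⟩
      exact ⟨upperPoint_im_pos hx, norm_upperPoint (Set.Ioo_subset_Icc_self hx), hL⟩
  rw [h1]
  refine IsPreconnected.image ?_ _ (continuous_upperPoint r).continuousOn
  refine Convex.isPreconnected fun x hx y hy a b ha hb hab => ⟨?_, ?_⟩
  · exact (convex_Ioo (-r) r) hx.1 hy.1 ha hb hab
  · have h2 := limPot_upperPoint_concave (β := β) hν hx.1 hy.1 ha hb hab
    have h3 := hx.2
    have h4 := hy.2
    simp only [smul_eq_mul]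
    have : b = 1 - a := by linarith
    subst this
    rcases ha.eq_or_lt with rfl | ha'
    · linarith
    · nlinarith

/-- Slices by circles are connected and nonempty for every modulus in J, and neighbouring slices are
joined radially. Connectedness of J then puts all slices in one component. -/
theorem isPreconnected_superlevel (hν : ν (Set.Icc A B)ᶜ = 0) {J : Set ℝ} (hJ : J.OrdConnected)
    (hJ0 : J ⊆ Set.Ioi 0) {L : ℝ}
    (hne : ∀ r ∈ J, ∃ z : ℂ, 0 < z.im ∧ ‖z‖ = r ∧ L < limPot ν β z) :
    IsPreconnected {z : ℂ | 0 < z.im ∧ ‖z‖ ∈ J ∧ L < limPot ν β z} := by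
  set S : Set ℂ := {z : ℂ | 0 < z.im ∧ ‖z‖ ∈ J ∧ L < limPot ν β z} with hS
  have hcc : ∀ (t : Set ℂ) (x y : ℂ), t ⊆ S → IsPreconnected t → x ∈ t → y ∈ t →
      connectedComponentIn S x = connectedComponentIn S y := fun t x y hts ht hx hy =>
    connectedComponentIn_eq (ht.subset_connectedComponentIn hx hts hy)
  have hslice : ∀ r ∈ J, ∀ x y : ℂ, x ∈ S → y ∈ S → ‖x‖ = r → ‖y‖ = r →
      connectedComponentIn S x = connectedComponentIn S y := fun r hr x y hx hy hxr hyr =>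
    hcc {z : ℂ | 0 < z.im ∧ ‖z‖ = r ∧ L < limPot ν β z} x y (fun z hz => ⟨hz.1, hz.2.1.symm ▸ hr, hz.2.2⟩)
      (isPreconnected_superlevel_slice hν L r) ⟨hx.1, hxr, hx.2.2⟩ ⟨hy.1, hyr, hy.2.2⟩
  have hP : ∀ r ∈ J, ∀ r' ∈ J, ∀ x y : ℂ, x ∈ S → y ∈ S → ‖x‖ = r → ‖y‖ = r' →
      connectedComponentIn S x = connectedComponentIn S y := by
    intro r hr r' hr'
    refine hJ.isPreconnected.induction₂ (fun r r' => ∀ x y : ℂ, x ∈ S → y ∈ S → ‖x‖ = r →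
      ‖y‖ = r' → connectedComponentIn S x = connectedComponentIn S y) (fun r hr => ?_) ?_ ?_ hr hr'
    · obtain ⟨z, hz, hzr, hzL⟩ := hne r hr
      have hr0 : 0 < r := hJ0 hr
      -- By continuity a point of the slice remains in the superlevel set when rescaled to nearby
      -- moduli; these segments join the slices.
      have hev : ∀ᶠ s in 𝓝 r, 0 < s ∧ L < limPot ν β ((s / r : ℝ) * z) := by
        refine (lt_mem_nhds hr0).and ?_
        have hz1 : ((r / r : ℝ) : ℂ) * z = z := by rw [div_self hr0.ne']; simp
        have h1 : Tendsto (fun s : ℝ => ((s / r : ℝ) : ℂ) * z) (𝓝 r) (𝓝 z) := by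
          have : Continuous (fun s : ℝ => ((s / r : ℝ) : ℂ) * z) := by fun_prop
          have h2 := this.tendsto r
          rwa [hz1] at h2
        exact ((continuousAt_limPot hν hz).tendsto.comp h1).eventually (lt_mem_nhds hzL)
      obtain ⟨ε, hε, hball⟩ := Metric.eventually_nhds_iff_ball.1 hev
      filter_upwards [inter_mem_nhdsWithin J (Metric.ball_mem_nhds r hε)] with r' hr' x y hx hy hxr hyr
      have hsub : Set.uIcc r r' ⊆ Metric.ball r ε :=
        (convex_ball r ε).ordConnected.uIcc_subset (Metric.mem_ball_self hε) hr'.2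
      have hsubJ : Set.uIcc r r' ⊆ J := hJ.uIcc_subset hr hr'.1
      have hmem : ∀ s ∈ Set.uIcc r r', ((s / r : ℝ) : ℂ) * z ∈ S ∧ ‖((s / r : ℝ) : ℂ) * z‖ = s := by
        intro s hs
        obtain ⟨hs0, hsL⟩ := hball s (hsub hs)
        have hn : ‖((s / r : ℝ) : ℂ) * z‖ = s := by
          rw [norm_mul, Complex.norm_real, hzr, Real.norm_of_nonneg (by positivity)]
          field_simp
        refine ⟨⟨?_, hn.symm ▸ hsubJ hs, hsL⟩, hn⟩
        rw [Complex.im_ofReal_mul]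
        positivity
      have hl := hmem r Set.left_mem_uIcc
      have hr'' := hmem r' Set.right_mem_uIcc
      rw [hslice r hr x _ hx hl.1 hxr hl.2, ← hslice r' hr'.1 _ y hr''.1 hy hr''.2 hyr]
      refine hcc ((fun s : ℝ => ((s / r : ℝ) : ℂ) * z) '' Set.uIcc r r') _ _ ?_ ?_
        ⟨r, Set.left_mem_uIcc, rfl⟩ ⟨r', Set.right_mem_uIcc, rfl⟩
      · rintro _ ⟨s, hs, rfl⟩
        exact (hmem s hs).1
      · exact isPreconnected_uIcc.image _ (by fun_prop)
    · intro r1 r2 r3 _ h2 _ h12 h23 x y hx hy hxr hyr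
      obtain ⟨z, hz, hzr, hzL⟩ := hne r2 h2
      have hzS : z ∈ S := ⟨hz, hzr.symm ▸ h2, hzL⟩
      rw [h12 x z hx hzS hxr hzr, h23 z y hzS hy hzr hyr]
    · intro r1 r2 _ _ h12 x y hx hy hxr hyr
      exact (h12 y x hy hx hyr hxr).symm
  refine isPreconnected_of_forall_pair fun x hx y hy => ⟨connectedComponentIn S x,
    connectedComponentIn_subset S x, mem_connectedComponentIn hx, ?_,
    isPreconnected_connectedComponentIn⟩
  rw [hP _ hx.2.1 _ hy.2.1 x y hx hy rfl rfl]
  exact mem_connectedComponentIn hy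

end Superlevel

/-! ### The potential on vertical lines -/

/-- The exponent in the vertical growth of `‖u + i y - t‖` at height `ε`. -/
noncomputable def vertWeight (u ε t : ℝ) : ℝ := ε ^ 2 / ‖(⟨u, ε⟩ : ℂ) - t‖ ^ 2

theorem norm_vert_sq (u ε t : ℝ) : ‖(⟨u, ε⟩ : ℂ) - t‖ ^ 2 = (u - t) ^ 2 + ε ^ 2 :=
  norm_sub_ofReal_sq' _ _

theorem norm_vert_zero {y : ℝ} (hy : 0 < y) : ‖(⟨0, y⟩ : ℂ)‖ = y := by
  have := norm_vert_sq 0 y 0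
  simp only [Complex.ofReal_zero, sub_zero] at this
  exact (pow_left_inj₀ (norm_nonneg _) hy.le two_ne_zero).1 (by simpa using this)

theorem vertWeight_le_one (u ε t : ℝ) : vertWeight u ε t ≤ 1 := by
  rw [vertWeight, norm_vert_sq]
  exact div_le_one_of_le₀ (by nlinarith [sq_nonneg (u - t)]) (by positivity)

theorem vertWeight_nonneg (u ε t : ℝ) : 0 ≤ vertWeight u ε t := by
  rw [vertWeight]; positivity

/-- The ratio of squared distances is the mean of (y/ε)² and 1 with weights `vertWeight` and its
complement, so concavity of the logarithm applies. It holds for y on either side of ε. -/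
theorem log_norm_vert_ge (u t : ℝ) {ε y : ℝ} (hε : 0 < ε) (hy : 0 < y) :
    Real.log ‖(⟨u, ε⟩ : ℂ) - t‖ + vertWeight u ε t * Real.log (y / ε) ≤
      Real.log ‖(⟨u, y⟩ : ℂ) - t‖ := by
  have hX : 0 < (u - t) ^ 2 + ε ^ 2 := by positivity
  have hY : 0 < (u - t) ^ 2 + y ^ 2 := by positivity
  have h := strictConcaveOn_log_Ioi.concaveOn.2 (show (y / ε) ^ 2 ∈ Set.Ioi (0 : ℝ) by
    rw [Set.mem_Ioi]; positivity) (show (1 : ℝ) ∈ Set.Ioi (0 : ℝ) by simp)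
    (vertWeight_nonneg u ε t) (sub_nonneg.2 (vertWeight_le_one u ε t)) (by ring)
  simp only [smul_eq_mul, Real.log_one, mul_zero, add_zero, mul_one] at h
  have h1 : vertWeight u ε t * (y / ε) ^ 2 + (1 - vertWeight u ε t) =
      ((u - t) ^ 2 + y ^ 2) / ((u - t) ^ 2 + ε ^ 2) := by
    rw [vertWeight, norm_vert_sq]
    field_simp
    ring
  rw [h1, Real.log_div hY.ne' hX.ne', ← norm_vert_sq, ← norm_vert_sq, Real.log_pow, Real.log_pow,
    Real.log_pow] at h
  push_cast at h
  linarith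

theorem vertWeight_mono {ε ε' : ℝ} (hε : 0 < ε) (h : ε ≤ ε') (u t : ℝ) :
    vertWeight u ε t ≤ vertWeight u ε' t := by
  rw [vertWeight, vertWeight, norm_vert_sq, norm_vert_sq, div_le_div_iff₀ (by positivity)
    (by have := hε.trans_le h; positivity)]
  have : ε ^ 2 ≤ ε' ^ 2 := by gcongr
  nlinarith [sq_nonneg (u - t)]

theorem continuous_vertWeight (u : ℝ) {ε : ℝ} (hε : 0 < ε) : Continuous (vertWeight u ε) := by
  refine Continuous.div₀ (by fun_prop) (by fun_prop) fun t => ?_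
  rw [norm_vert_sq]
  positivity

section Heights

variable {A B β : ℝ} {ν : Measure ℝ} [IsProbabilityMeasure ν]

theorem integrable_vertWeight (hν : ν (Set.Icc A B)ᶜ = 0) (u : ℝ) {ε : ℝ} (hε : 0 < ε) :
    Integrable (vertWeight u ε) ν :=
  integrable_of_continuous_of_compl_Icc hν (continuous_vertWeight u hε)

/-- The function |w|² / |w - t|² has integral β, equals 1 at t = 0 and is positive elsewhere. -/
theorem IsCritical.measure_zero_lt (hν : ν (Set.Icc A B)ᶜ = 0) (h0 : ν ≠ Measure.dirac 0) {w : ℂ}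
    (hc : IsCritical ν β w) : ν.real {0} < β := by
  have hw := hc.im_pos
  have hw0 := norm_pos_iff.2 (ne_zero_of_im_pos hw)
  have hi1 : Integrable (fun t : ℝ => ‖w‖ ^ 2 / ‖w - t‖ ^ 2) ν :=
    integrable_of_continuous_of_compl_Icc hν (Continuous.div₀ (by fun_prop) (by fun_prop)
      fun t => by simpa using sub_ofReal_ne_zero hw t)
  have hi2 : Integrable (Set.indicator {(0 : ℝ)} fun _ => (1 : ℝ)) ν :=
    (integrable_const 1).indicator (measurableSet_singleton 0)
  have hpos : ∀ t : ℝ, t ≠ 0 →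
      0 < ‖w‖ ^ 2 / ‖w - t‖ ^ 2 - Set.indicator {(0 : ℝ)} (fun _ => (1 : ℝ)) t := by
    intro t ht
    have := norm_pos_iff.2 (sub_ofReal_ne_zero hw t)
    rw [Set.indicator_of_notMem (by simpa using ht), sub_zero]
    positivity
  have h1 := integral_pos_of_pos_off_zero h0 (hi1.sub hi2) (fun t => by
    rcases eq_or_ne t 0 with rfl | ht
    · simp [hw0.ne']
    · exact (hpos t ht).le) hpos
  simp only [Pi.sub_apply] at h1
  rw [integral_sub hi1 hi2, hc.integral_sq_div hν,
    integral_indicator_const _ (measurableSet_singleton 0)] at h1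
  simpa using h1

theorem tendsto_integral_vertWeight_zero :
    Tendsto (fun ε => ∫ t, vertWeight 0 ε t ∂ν) (𝓝[>] 0) (𝓝 (ν.real {0})) := by
  have h1 : ν.real {0} = ∫ t, Set.indicator {(0 : ℝ)} (fun _ => (1 : ℝ)) t ∂ν := by
    rw [integral_indicator_const _ (measurableSet_singleton 0)]; simp
  rw [h1]
  refine tendsto_integral_filter_of_dominated_convergence (fun _ => 1) ?_ ?_
    (integrable_const 1) ?_
  · filter_upwards [self_mem_nhdsWithin] with ε hε
    exact (continuous_vertWeight 0 hε).aestronglyMeasurable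
  · refine Eventually.of_forall fun ε => Eventually.of_forall fun t => ?_
    rw [Real.norm_of_nonneg (vertWeight_nonneg _ _ _)]
    exact vertWeight_le_one _ _ _
  · refine Eventually.of_forall fun t => ?_
    simp only [vertWeight, norm_vert_sq, zero_sub, neg_sq]
    rcases eq_or_ne t 0 with rfl | ht
    · refine tendsto_const_nhds.congr' ?_
      filter_upwards [self_mem_nhdsWithin] with ε hε
      have : ε ≠ 0 := ne_of_gt hε
      simp [this]
    · rw [Set.indicator_of_notMem (by simpa using ht)]
      have h2 : ContinuousAt (fun ε : ℝ => ε ^ 2 / (t ^ 2 + ε ^ 2)) 0 :=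
        ContinuousAt.div₀ (by fun_prop) (by fun_prop) (by simpa using ht)
      have h3 := h2.tendsto
      simp only [ne_eq, OfNat.ofNat_ne_zero, not_false_eq_true, zero_pow, zero_div] at h3
      exact h3.mono_left nhdsWithin_le_nhds

theorem tendsto_integral_vertWeight_atTop :
    Tendsto (fun ε => ∫ t, vertWeight 0 ε t ∂ν) atTop (𝓝 1) := by
  have h1 : (1 : ℝ) = ∫ _, 1 ∂ν := by simp
  rw [h1]
  refine tendsto_integral_filter_of_dominated_convergence (fun _ => 1) ?_ ?_
    (integrable_const 1) ?_
  · filter_upwards [eventually_gt_atTop 0] with ε hε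
    exact (continuous_vertWeight 0 hε).aestronglyMeasurable
  · refine Eventually.of_forall fun ε => Eventually.of_forall fun t => ?_
    rw [Real.norm_of_nonneg (vertWeight_nonneg _ _ _)]
    exact vertWeight_le_one _ _ _
  · refine Eventually.of_forall fun t => ?_
    have h2 : Tendsto (fun ε : ℝ => 1 - t ^ 2 / (t ^ 2 + ε ^ 2)) atTop (𝓝 (1 - 0)) := by
      refine tendsto_const_nhds.sub (Tendsto.const_div_atTop ?_ _)
      exact tendsto_atTop_add_const_left _ _ (tendsto_pow_atTop two_ne_zero)
    rw [sub_zero] at h2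
    refine h2.congr' ?_
    filter_upwards [eventually_gt_atTop 0] with ε hε
    rw [vertWeight, norm_vert_sq]
    have : t ^ 2 + ε ^ 2 ≠ 0 := by positivity
    field_simp
    ring

/-- As ε tends to 0 the mean weight tends to ν{0} < β, so -β log ε dominates and the potential tends
to infinity down the imaginary axis. The weight inequality is kept for the final descent to u. -/
theorem IsCritical.exists_low_point (hν : ν (Set.Icc A B)ᶜ = 0) (h0 : ν ≠ Measure.dirac 0) {w : ℂ}
    (hc : IsCritical ν β w) (L : ℝ) {r : ℝ} (hr : 0 < r) :
    ∃ ε, 0 < ε ∧ ε < r ∧ L < limPot ν β ⟨0, ε⟩ ∧ ∫ t, vertWeight 0 ε t ∂ν < β := by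
  obtain ⟨ε₁, hε₁, hlt⟩ := ((eventually_mem_nhdsWithin (a := (0 : ℝ)) (s := Set.Ioi 0)).and
    (tendsto_integral_vertWeight_zero.eventually
    (gt_mem_nhds (hc.measure_zero_lt hν h0)))).exists
  have hε₁ : 0 < ε₁ := hε₁
  set γ := β - ∫ t, vertWeight 0 ε₁ t ∂ν with hγ
  have hγ0 : 0 < γ := sub_pos.2 hlt
  have hev : ∀ᶠ ε in 𝓝[>] (0 : ℝ), L < limPot ν β ⟨0, ε₁⟩ - γ * Real.log (ε / ε₁) := by
    have h1 : Tendsto (fun ε : ℝ => ε / ε₁) (𝓝[>] 0) (𝓝[>] 0) := by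
      refine tendsto_nhdsWithin_iff.2 ⟨?_, ?_⟩
      · have : Continuous fun ε : ℝ => ε / ε₁ := by fun_prop
        have h2 := this.tendsto 0
        rw [zero_div] at h2
        exact h2.mono_left nhdsWithin_le_nhds
      · filter_upwards [self_mem_nhdsWithin] with ε hε
        exact div_pos hε hε₁
    have h2 := (Real.tendsto_log_nhdsGT_zero.comp h1).const_mul_atBot hγ0
    filter_upwards [h2.eventually (eventually_lt_atBot (limPot ν β ⟨0, ε₁⟩ - L))] with ε hε
    simp only [Function.comp_apply] at hε
    linarith
  obtain ⟨ε, ⟨⟨hε, hεL⟩, hεr⟩⟩ := ((eventually_mem_nhdsWithin (a := (0 : ℝ)) (s := Set.Ioi 0)).and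
    hev |>.and (mem_nhdsWithin_of_mem_nhds (gt_mem_nhds (lt_min hr hε₁)))).exists
  have hε : 0 < ε := hε
  have hεr' := lt_min_iff.1 (show ε < min r ε₁ from hεr)
  refine ⟨ε, hε, hεr'.1, hεL.trans_le ?_, ?_⟩
  · have hi1 := integrable_of_continuous_of_compl_Icc hν
      (continuous_log_norm_sub (z := ⟨0, ε₁⟩) hε₁)
    have hi2 := integrable_of_continuous_of_compl_Icc hν (continuous_log_norm_sub (z := ⟨0, ε⟩) hε)
    have hi3 := (integrable_vertWeight hν 0 hε₁).mul_const (Real.log (ε / ε₁))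
    have h1 := integral_mono (hi1.add hi3) hi2 fun t => log_norm_vert_ge 0 t hε₁ hε
    simp only [Pi.add_apply] at h1
    rw [integral_add hi1 hi3, integral_mul_const] at h1
    rw [limPot, limPot, norm_vert_zero hε, norm_vert_zero hε₁, hγ]
    rw [Real.log_div hε.ne' hε₁.ne'] at h1 ⊢
    linarith
  · exact (integral_mono (integrable_vertWeight hν 0 hε) (integrable_vertWeight hν 0 hε₁)
      fun t => vertWeight_mono hε hεr'.2.le 0 t).trans_lt hlt

/-- On the imaginary axis the potential is at least (1 - β) log ε, and the mean weight tends to 1 >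
β. -/
theorem exists_high_point (hν : ν (Set.Icc A B)ᶜ = 0) (hβ : β < 1) (L r : ℝ) :
    ∃ ε, 0 < ε ∧ r < ε ∧ L < limPot ν β ⟨0, ε⟩ ∧ β < ∫ t, vertWeight 0 ε t ∂ν := by
  have h1 := Real.tendsto_log_atTop.const_mul_atTop (sub_pos.2 hβ)
  obtain ⟨ε, hε, hr, hL, hint⟩ := ((eventually_gt_atTop (0 : ℝ)).and ((eventually_gt_atTop r).and
    ((h1.eventually (eventually_gt_atTop L)).and
    ((tendsto_integral_vertWeight_atTop (ν := ν)).eventually (lt_mem_nhds hβ))))).exists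
  refine ⟨ε, hε, hr, hL.trans_le ?_, hint⟩
  have hi2 := integrable_of_continuous_of_compl_Icc hν (continuous_log_norm_sub (z := ⟨0, ε⟩) hε)
  have h2 := integral_mono (integrable_const (Real.log ε)) hi2 fun t => by
    refine Real.log_le_log hε ((pow_le_pow_iff_left₀ hε.le (norm_nonneg _) two_ne_zero).1 ?_)
    rw [norm_vert_sq]
    nlinarith [sq_nonneg (0 - t)]
  rw [limPot, norm_vert_zero hε]
  simp only [integral_const, probReal_univ, one_smul] at h2
  linarith

end Heights

end GelfandTsetlin

namespace GelfandTsetlin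

/-! ### Partial fractions -/

theorem sub_ofReal_ne_zero_of_im_ne_zero {z : ℂ} (hz : z.im ≠ 0) (t : ℝ) : z - t ≠ 0 := by
  intro h
  have := congrArg Complex.im h
  simp at this
  exact hz this

open Polynomial in
theorem aeval_lagrange_basis {n : ℕ} (x : Fin n → ℝ) (j : Fin n) (z : ℂ) :
    aeval z (Lagrange.basis Finset.univ x j) =
      ∏ i ∈ Finset.univ.erase j, (z - x i) / (x j - x i) := by
  rw [Lagrange.basis, map_prod]
  refine Finset.prod_congr rfl fun i _ => ?_
  simp [Lagrange.basisDivisor, div_eq_inv_mul]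

section Resolvent

variable {N : ℕ} (d : Fin N → ℝ) (k : ℕ) (u : ℝ)

/-- The residues of `(z - u) ^ k / ∏ (z - d j)`. -/
noncomputable def nodeCoeff (j : Fin N) : ℝ :=
  (d j - u) ^ k / ∏ i ∈ Finset.univ.erase j, (d j - d i)

/-- The partial fraction expansion of `(z - u) ^ k / ∏ (z - d j)`. -/
noncomputable def resolvent (z : ℂ) : ℂ := ∑ j, (nodeCoeff d k u j : ℂ) / (z - d j)

/-- The part of the partial fraction expansion coming from the nodes above `u`. -/
noncomputable def upperResolvent (z : ℂ) : ℂ :=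
  ∑ j, if u < d j then (nodeCoeff d k u j : ℂ) / (z - d j) else 0

variable {d k u}

open Polynomial in
-- Lagrange interpolation of (X - u)^k, whose degree is below N, divided by the nodal polynomial.
theorem resolvent_eq (hd : Function.Injective d) (hk : k < N) {z : ℂ} (hz : z.im ≠ 0) :
    resolvent d k u z = (z - u) ^ k / ∏ j, (z - d j) := by
  have hdeg : ((X - C u) ^ k : ℝ[X]).degree < N := by
    rw [degree_pow, degree_X_sub_C]
    simpa using hk
  have h1 := congrArg (aeval z) (sum_eval_smul_basis hd hdeg)
  simp only [map_sum, map_mul, aeval_C, aeval_lagrange_basis, map_pow, map_sub, aeval_X, eval_pow,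
    eval_sub, eval_X, eval_C, Complex.coe_algebraMap] at h1
  rw [← h1, resolvent, Finset.sum_div]
  refine Finset.sum_congr rfl fun j _ => ?_
  rw [← Finset.mul_prod_erase Finset.univ (fun j => z - (d j : ℂ)) (Finset.mem_univ j),
    Finset.prod_div_distrib, nodeCoeff]
  have h2 : ∏ i ∈ Finset.univ.erase j, (z - (d i : ℂ)) ≠ 0 :=
    Finset.prod_ne_zero_iff.2 fun i _ => sub_ofReal_ne_zero_of_im_ne_zero hz _
  have h3 : ∏ i ∈ Finset.univ.erase j, ((d j : ℂ) - d i) ≠ 0 :=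
    Finset.prod_ne_zero_iff.2 fun i hi => by
      rw [sub_ne_zero]
      exact_mod_cast fun h => (Finset.ne_of_mem_erase hi) (hd h).symm
  have h4 := sub_ofReal_ne_zero_of_im_ne_zero hz (d j)
  push_cast
  field_simp

theorem conj_resolvent (z : ℂ) :
    resolvent d k u (starRingEnd ℂ z) = starRingEnd ℂ (resolvent d k u z) := by
  simp [resolvent]

/-! ### Primitives of `z ↦ resolvent z / (z - w)` -/

variable (d k u)

/-- A sum of logarithms common to the two primitives. -/
noncomputable def logSum (w z : ℂ) : ℂ :=
  ∑ j, (nodeCoeff d k u j : ℂ) / (w - d j) * Complex.log (z - d j)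

/-- The primitive of `resolvent z / (z - w)` used for `‖z‖ < ‖w‖`. -/
noncomputable def primIn (w z : ℂ) : ℂ :=
  resolvent d k u w * Complex.log (1 - z / w) - logSum d k u w z

/-- The primitive of `resolvent z / (z - w)` used for `‖w‖ < ‖z‖`. -/
noncomputable def primOut (w z : ℂ) : ℂ :=
  resolvent d k u w * (Complex.log z + Complex.log (1 - w / z)) - logSum d k u w z

/-- The boundary value of `primIn` at the real point `u`, from above. -/
noncomputable def primInBdry (w : ℂ) : ℂ :=
  resolvent d k u w * Complex.log (1 - u / w) -
    ∑ j, (nodeCoeff d k u j : ℂ) / (w - d j) *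
      (Real.log |u - d j| + if u < d j then Real.pi * Complex.I else 0)

variable {d k u}

theorem mem_slitPlane_of_im_pos {z : ℂ} (hz : 0 < z.im) : z ∈ Complex.slitPlane := Or.inr hz.ne'

theorem one_sub_div_mem_slitPlane {z w : ℂ} (h : ‖z‖ < ‖w‖) : 1 - z / w ∈ Complex.slitPlane := by
  have := Complex.mem_slitPlane_of_norm_lt_one (z := -(z / w)) (by
    rw [norm_neg, norm_div, div_lt_one ((norm_nonneg z).trans_lt h)]; exact h)
  rwa [← sub_eq_add_neg] at this

theorem abs_arg_one_sub_div_lt {z w : ℂ} (h : ‖z‖ < ‖w‖) :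
    |Complex.arg (1 - z / w)| < Real.pi / 2 := by
  rw [Complex.abs_arg_lt_pi_div_two_iff]
  left
  have h1 : ‖z / w‖ < 1 := by
    rw [norm_div, div_lt_one ((norm_nonneg z).trans_lt h)]; exact h
  have h2 := (Complex.abs_re_le_norm (z / w)).trans_lt h1
  rw [Complex.sub_re, Complex.one_re]
  linarith [(abs_lt.1 h2).2]

/-- The defect of additivity of the argument is a multiple of 2π, hence zero as soon as it is
smaller than 2π. -/
theorem log_mul_of_abs_arg_lt {x y : ℂ} (hx : x ≠ 0) (hy : y ≠ 0)
    (h : |Complex.arg x + Complex.arg y - Complex.arg (x * y)| < 2 * Real.pi) :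
    Complex.log (x * y) = Complex.log x + Complex.log y := by
  refine Complex.log_mul hx hy ?_
  have h1 := Complex.arg_mul_coe_angle hx hy
  rw [← Real.Angle.coe_add, eq_comm, Real.Angle.angle_eq_iff_two_pi_dvd_sub] at h1
  obtain ⟨n, hn⟩ := h1
  have hn0 : n = 0 := by
    rw [hn, abs_mul, abs_of_pos Real.two_pi_pos, mul_lt_iff_lt_one_right Real.two_pi_pos] at h
    exact_mod_cast Int.abs_lt_one_iff.1 (by exact_mod_cast h)
  rw [hn0, Int.cast_zero, mul_zero, sub_eq_zero] at hn
  rw [hn]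
  exact Complex.arg_mem_Ioc _

theorem hasDerivAt_logSum {w z : ℂ} (hz : 0 < z.im) :
    HasDerivAt (logSum d k u w) (∑ j, (nodeCoeff d k u j : ℂ) / (w - d j) * (1 / (z - d j))) z := by
  refine HasDerivAt.fun_sum fun j _ => ?_
  refine (((hasDerivAt_id z).sub_const _).clog ?_).const_mul _
  refine mem_slitPlane_of_im_pos ?_
  simpa using hz

theorem resolvent_div_sub {w z : ℂ} (hz : 0 < z.im) (hw : w.im ≠ 0) (hzw : z ≠ w) :
    resolvent d k u w * (1 / (z - w)) -
      ∑ j, (nodeCoeff d k u j : ℂ) / (w - d j) * (1 / (z - d j)) =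
    resolvent d k u z / (z - w) := by
  have h1 := sub_ne_zero.2 hzw
  rw [resolvent, resolvent, Finset.sum_mul, Finset.sum_div, ← Finset.sum_sub_distrib]
  refine Finset.sum_congr rfl fun j _ => ?_
  have h2 := sub_ofReal_ne_zero hz (d j)
  have h3 := sub_ofReal_ne_zero_of_im_ne_zero hw (d j)
  field_simp
  ring

theorem hasDerivAt_primIn {w z : ℂ} (hz : 0 < z.im) (hw : w.im ≠ 0)
    (h : 1 - z / w ∈ Complex.slitPlane) :
    HasDerivAt (primIn d k u w) (resolvent d k u z / (z - w)) z := by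
  have hw0 : w ≠ 0 := by rintro rfl; simp at hw
  have hzw : z ≠ w := by
    rintro rfl
    rw [div_self hw0, sub_self] at h
    exact Complex.zero_notMem_slitPlane h
  have h1 : HasDerivAt (fun z => Complex.log (1 - z / w)) (1 / (z - w)) z := by
    refine ((((hasDerivAt_id' z).div_const w).const_sub 1).clog h).congr_deriv ?_
    have h3 := sub_ne_zero.2 hzw
    have h4 : w - z ≠ 0 := sub_ne_zero.2 hzw.symm
    have h5 : 1 - z / w = (w - z) / w := by field_simp
    rw [h5]
    field_simp
    ring
  rw [← resolvent_div_sub hz hw hzw]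
  exact (h1.const_mul _).sub (hasDerivAt_logSum hz)

theorem hasDerivAt_primOut {w z : ℂ} (hz : 0 < z.im) (hw : w.im ≠ 0) (h : ‖w‖ < ‖z‖) :
    HasDerivAt (primOut d k u w) (resolvent d k u z / (z - w)) z := by
  have hzw : z ≠ w := by rintro rfl; exact lt_irrefl _ h
  have hz0 := ne_zero_of_im_pos hz
  have h1 : HasDerivAt (fun z => Complex.log z + Complex.log (1 - w / z)) (1 / (z - w)) z := by
    refine (((hasDerivAt_id' z).clog (mem_slitPlane_of_im_pos hz)).fun_add
      ((((hasDerivAt_const z w).fun_div (hasDerivAt_id' z) hz0).const_sub 1).clog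
        (one_sub_div_mem_slitPlane h))).congr_deriv ?_
    have h3 := sub_ne_zero.2 hzw
    have h6 : 1 - w / z = (z - w) / z := by field_simp
    rw [h6]
    field_simp
    ring
  rw [← resolvent_div_sub hz hw hzw]
  exact (h1.const_mul _).sub (hasDerivAt_logSum hz)

/-! ### Boundary behaviour of the primitives -/

theorem tendsto_log_vert {u t : ℝ} (h : u ≠ t) :
    Tendsto (fun y : ℝ => Complex.log ((⟨u, y⟩ : ℂ) - t)) (𝓝[>] 0)
      (𝓝 (Real.log |u - t| + if u < t then Real.pi * Complex.I else 0)) := by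
  have hcont : Continuous fun y : ℝ => (⟨u, y⟩ : ℂ) - t := by
    have : (fun y : ℝ => (⟨u, y⟩ : ℂ) - t) = fun y : ℝ => (u : ℂ) + y * Complex.I - t := by
      ext y; rw [Complex.mk_eq_add_mul_I]
    rw [this]; fun_prop
  have h0 : (⟨u, 0⟩ : ℂ) - t = ((u - t : ℝ) : ℂ) := by
    apply Complex.ext <;> simp
  have hlim := hcont.tendsto 0
  rw [h0] at hlim
  split_ifs with hut
  · have h1 : Tendsto (fun y : ℝ => (⟨u, y⟩ : ℂ) - t) (𝓝[>] 0)
        (𝓝[{z : ℂ | 0 ≤ z.im}] ((u - t : ℝ) : ℂ)) := by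
      refine tendsto_nhdsWithin_iff.2 ⟨hlim.mono_left nhdsWithin_le_nhds, ?_⟩
      filter_upwards [self_mem_nhdsWithin] with y hy
      have : (0 : ℝ) ≤ y := le_of_lt hy
      simpa using this
    have h2 := (Complex.tendsto_log_nhdsWithin_im_nonneg_of_re_neg_of_im_zero
      (z := ((u - t : ℝ) : ℂ)) (by rw [Complex.ofReal_re]; linarith) (Complex.ofReal_im _)).comp h1
    rw [Complex.norm_real, Real.norm_eq_abs] at h2
    exact h2
  · have hpos : 0 < u - t := sub_pos.2 (lt_of_le_of_ne (not_lt.1 hut) h.symm)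
    have h2 := (hlim.mono_left (nhdsWithin_le_nhds (s := Set.Ioi 0))).clog
      (Complex.ofReal_mem_slitPlane.2 hpos)
    rw [← Complex.ofReal_log hpos.le] at h2
    rw [abs_of_pos hpos, add_zero]
    exact h2

/-- For k ≠ 0 a node equal to u has coefficient zero, so no logarithm blows up; every other
logarithm has a boundary value from above. -/
theorem tendsto_primIn_vert (hk : k ≠ 0) {w : ℂ} (hw : |u| < ‖w‖) :
    Tendsto (fun y : ℝ => primIn d k u w ⟨u, y⟩) (𝓝[>] 0) (𝓝 (primInBdry d k u w)) := by
  refine Tendsto.sub (Tendsto.const_mul _ ?_) (tendsto_finsetSum _ fun j _ => ?_)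
  · refine Tendsto.clog ?_ (one_sub_div_mem_slitPlane (by simpa using hw))
    have hcont : Continuous fun y : ℝ => 1 - (⟨u, y⟩ : ℂ) / w := by
      have : (fun y : ℝ => 1 - (⟨u, y⟩ : ℂ) / w) = fun y : ℝ => 1 - ((u : ℂ) + y * Complex.I) / w := by
        ext y; rw [Complex.mk_eq_add_mul_I]
      rw [this]; fun_prop
    have := hcont.tendsto 0
    have h0 : (⟨u, 0⟩ : ℂ) = u := rfl
    rw [h0] at this
    exact this.mono_left nhdsWithin_le_nhds
  · rcases eq_or_ne (d j) u with h | h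
    · have : nodeCoeff d k u j = 0 := by simp [nodeCoeff, h, hk]
      simp [this]
    · exact (tendsto_log_vert h.symm).const_mul _

/-- High up, log(z - d_j) = log z + log(1 - d_j/z). The coefficients of log z sum to the resolvent
at w and cancel the leading term; everything else tends to log 1. -/
theorem tendsto_primOut_vert {w : ℂ} :
    Tendsto (fun y : ℝ => primOut d k u w ⟨u, y⟩) atTop (𝓝 0) := by
  have hinv : Tendsto (fun y : ℝ => (⟨u, y⟩ : ℂ)⁻¹) atTop (𝓝 0) := by
    refine tendsto_zero_iff_norm_tendsto_zero.2 ?_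
    refine squeeze_zero' (Eventually.of_forall fun _ => norm_nonneg _) ?_ tendsto_inv_atTop_zero
    filter_upwards [eventually_gt_atTop 0] with y hy
    rw [norm_inv]
    gcongr
    exact (le_abs_self y).trans (Complex.abs_im_le_norm (⟨u, y⟩ : ℂ))
  have hlog : ∀ a : ℂ, Tendsto (fun y : ℝ => Complex.log (1 - a / (⟨u, y⟩ : ℂ))) atTop (𝓝 0) := by
    intro a
    have h1 : Tendsto (fun y : ℝ => 1 - a / (⟨u, y⟩ : ℂ)) atTop (𝓝 1) := by
      have := (hinv.const_mul a).const_sub 1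
      simpa [div_eq_mul_inv] using this
    have h2 := h1.clog Complex.one_mem_slitPlane
    rwa [Complex.log_one] at h2
  have h1 : Tendsto (fun y : ℝ => resolvent d k u w * Complex.log (1 - w / (⟨u, y⟩ : ℂ)) -
      ∑ j, (nodeCoeff d k u j : ℂ) / (w - d j) * Complex.log (1 - d j / (⟨u, y⟩ : ℂ))) atTop
      (𝓝 (resolvent d k u w * 0 - ∑ j, (nodeCoeff d k u j : ℂ) / (w - d j) * 0)) :=
    ((hlog w).const_mul _).sub (tendsto_finsetSum _ fun j _ => (hlog _).const_mul _)
  simp only [mul_zero, Finset.sum_const_zero, sub_zero] at h1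
  refine h1.congr' ?_
  have hsplit : ∀ᶠ y : ℝ in atTop, ∀ j : Fin N, Complex.log ((⟨u, y⟩ : ℂ) - d j) =
      Complex.log (⟨u, y⟩ : ℂ) + Complex.log (1 - d j / (⟨u, y⟩ : ℂ)) := by
    refine eventually_all.2 fun j => ?_
    filter_upwards [eventually_gt_atTop |d j|] with y hy
    have hy0 : 0 < y := (abs_nonneg _).trans_lt hy
    set z : ℂ := ⟨u, y⟩ with hz
    have hzim : 0 < z.im := hy0
    have hz0 := ne_zero_of_im_pos hzim
    have hlt : ‖(d j : ℂ)‖ < ‖z‖ := by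
      rw [Complex.norm_real, Real.norm_eq_abs]
      exact hy.trans_le ((le_abs_self y).trans (Complex.abs_im_le_norm z))
    have hp := Complex.slitPlane_ne_zero (one_sub_div_mem_slitPlane hlt)
    have hmul : z - d j = z * (1 - d j / z) := by field_simp
    rw [hmul, log_mul_of_abs_arg_lt hz0 hp]
    rw [← hmul]
    have h1 : 0 < (z - d j).im := by simpa using hzim
    have h2 := abs_lt.1 (abs_arg_one_sub_div_lt hlt)
    have h3 := Complex.arg_nonneg_iff.2 hzim.le
    have h4 := Complex.arg_nonneg_iff.2 h1.le
    have h5 := Complex.arg_le_pi z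
    have h6 := Complex.arg_le_pi (z - d j)
    rw [abs_lt]
    constructor <;> linarith [Real.pi_pos]
  filter_upwards [hsplit] with y hy
  rw [primOut, logSum]
  simp only [hy, mul_add, Finset.sum_add_distrib]
  rw [← Finset.sum_mul, ← resolvent]
  ring

end Resolvent

end GelfandTsetlin

/-! ### The contour value and its jump across the critical ray. -/

namespace GelfandTsetlin

theorem log_one_sub_div {z w : ℂ} (hw : w ≠ 0) (h : ‖w‖ < ‖z‖) :
    Complex.log (1 - z / w) = Complex.log (1 - w / z) + Complex.log (-(z / w)) := by
  have hz : z ≠ 0 := norm_pos_iff.1 ((norm_nonneg w).trans_lt h)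
  have hmul : 1 - z / w = (1 - w / z) * (-(z / w)) := by field_simp; ring
  rw [hmul, log_mul_of_abs_arg_lt (Complex.slitPlane_ne_zero (one_sub_div_mem_slitPlane h))
    (neg_ne_zero.2 (div_ne_zero hz hw))]
  rw [← hmul]
  have h1 := abs_lt.1 (abs_arg_one_sub_div_lt h)
  have him : (1 - z / w).im = (-(z / w)).im := by simp
  have h2 := Complex.arg_mem_Ioc (1 - z / w)
  have h3 := Complex.arg_mem_Ioc (-(z / w))
  rw [abs_lt]
  rcases le_or_gt 0 (-(z / w)).im with h4 | h4
  · have h5 := Complex.arg_nonneg_iff.2 h4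
    have h6 := Complex.arg_nonneg_iff.2 (him.symm ▸ h4)
    constructor <;> linarith [h2.2, h3.2, Real.pi_pos]
  · have h5 := Complex.arg_neg_iff.2 h4
    have h6 := Complex.arg_neg_iff.2 (him.symm ▸ h4)
    constructor <;> linarith [h2.1, h3.1, Real.pi_pos]

theorem log_polar {r x : ℝ} (hr : 0 < r) (hx : x ∈ Set.Ioc (-Real.pi) Real.pi) :
    Complex.log (r * Complex.exp (x * Complex.I)) = Real.log r + x * Complex.I := by
  rw [Complex.log_ofReal_mul hr (Complex.exp_ne_zero _), Complex.log_exp (by simpa using hx.1)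
    (by simpa using hx.2)]

theorem neg_div_polar {r R a θ x : ℝ} (hx : x = a - θ + Real.pi ∨ x = a - θ - Real.pi) :
    -((r * Complex.exp (a * Complex.I)) / (R * Complex.exp (θ * Complex.I))) =
      ((r / R : ℝ) : ℂ) * Complex.exp (x * Complex.I) := by
  have h1 : Complex.exp (x * Complex.I) =
      -(Complex.exp (a * Complex.I) / Complex.exp (θ * Complex.I)) := by
    rw [← Complex.exp_sub]
    rcases hx with rfl | rfl
    · have : ((a - θ + Real.pi : ℝ) : ℂ) * Complex.I =
          (a * Complex.I - θ * Complex.I) + Real.pi * Complex.I := by push_cast; ring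
      rw [this, Complex.exp_add, Complex.exp_pi_mul_I]; ring
    · have : ((a - θ - Real.pi : ℝ) : ℂ) * Complex.I =
          (a * Complex.I - θ * Complex.I) - Real.pi * Complex.I := by push_cast; ring
      rw [this, Complex.exp_sub, Complex.exp_pi_mul_I]; ring
  rw [h1]
  push_cast
  ring

/-- The jump between the branches of the logarithm on the two sides of the critical point. -/
theorem log_branch_jump {r R a θ : ℝ} (hr : 0 < r) (hR : 0 < R) (ha : a ∈ Set.Ioo 0 Real.pi)
    (hθ : θ ∈ Set.Ioo 0 Real.pi) :
    (Complex.log (-((r * Complex.exp (a * Complex.I)) / (R * Complex.exp (θ * Complex.I)))) -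
      Complex.log (r * Complex.exp (a * Complex.I))) -
    starRingEnd ℂ (Complex.log (-((r * Complex.exp (a * Complex.I)) /
      (R * Complex.exp ((-θ : ℝ) * Complex.I)))) - Complex.log (r * Complex.exp (a * Complex.I))) =
    if θ < a then -(2 * Real.pi * Complex.I) else 0 := by
  have hrR : 0 < r / R := by positivity
  -- For the conjugate point the principal argument is always a + θ - π. For the point itself it is
  -- a - θ ± π, with the sign decided by whether θ < a; that is the jump.
  have h2 : a - (-θ) - Real.pi ∈ Set.Ioc (-Real.pi) Real.pi :=
    ⟨by linarith [ha.1, hθ.1], by linarith [ha.2, hθ.2]⟩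
  rw [neg_div_polar (x := a - (-θ) - Real.pi) (Or.inr rfl), log_polar hrR h2,
    log_polar hr ⟨by linarith [ha.1, Real.pi_pos], ha.2.le⟩]
  split_ifs with h
  · rw [neg_div_polar (x := a - θ - Real.pi) (Or.inr rfl), log_polar hrR
      ⟨by linarith, by linarith [ha.2, hθ.1, Real.pi_pos]⟩]
    simp only [map_sub, map_add, map_mul, Complex.conj_ofReal, Complex.conj_I]
    push_cast
    ring
  · rw [neg_div_polar (x := a - θ + Real.pi) (Or.inl rfl), log_polar hrR
      ⟨by linarith [ha.1, hθ.2], by linarith [not_lt.1 h]⟩]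
    simp only [map_sub, map_add, map_mul, Complex.conj_ofReal, Complex.conj_I]
    push_cast
    ring

section Contour

variable {N : ℕ} (d : Fin N → ℝ) (k : ℕ) (u : ℝ)

/-- The integral of `resolvent z / (z - w)` along a path in the upper half plane from `u` to
infinity which crosses the circle through `w` on the ray through `z`. -/
noncomputable def contourValue (w z : ℂ) : ℂ :=
  primIn d k u w z - primOut d k u w z - primInBdry d k u w

variable {d k u}

theorem contourValue_eq {w z : ℂ} (hw : w ≠ 0) (h : ‖w‖ < ‖z‖) :
    contourValue d k u w z = resolvent d k u w * (Complex.log (-(z / w)) - Complex.log z) -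
      primInBdry d k u w := by
  rw [contourValue, primIn, primOut, log_one_sub_div hw h]
  ring

/-- All ingredients commute with conjugation except the iπ of the logarithms at nodes above u. These
double up and assemble the upper resolvent. -/
theorem conj_primInBdry {w : ℂ} (hw : |u| < ‖w‖) :
    primInBdry d k u w - starRingEnd ℂ (primInBdry d k u (starRingEnd ℂ w)) =
      -(2 * Real.pi * Complex.I) * upperResolvent d k u w := by
  have h1 : Complex.log (1 - u / (starRingEnd ℂ w)) =
      starRingEnd ℂ (Complex.log (1 - u / w)) := by
    rw [← Complex.log_conj]
    · simp
    · have h2 := abs_lt.1 (abs_arg_one_sub_div_lt (z := (u : ℂ)) (w := w) (by simpa using hw))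
      intro h3
      rw [h3] at h2
      linarith [Real.pi_pos]
  rw [primInBdry, primInBdry, h1, conj_resolvent, map_sub, map_mul, Complex.conj_conj,
    Complex.conj_conj, sub_sub_sub_cancel_left, map_sum, ← Finset.sum_sub_distrib, upperResolvent,
    Finset.mul_sum]
  refine Finset.sum_congr rfl fun j _ => ?_
  split_ifs
  · simp
    ring
  · simp

/-- The residue theorem in closed form: the path and its conjugate enclose the nodes above u, and
also w precisely when θ < a. -/
theorem contourValue_sub_conj {r R a θ : ℝ} (hR : 0 < R) (hrR : R < r)
    (ha : a ∈ Set.Ioo 0 Real.pi) (hθ : θ ∈ Set.Ioo 0 Real.pi) (hu : |u| < R) :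
    contourValue d k u (R * Complex.exp (θ * Complex.I)) (r * Complex.exp (a * Complex.I)) -
      starRingEnd ℂ (contourValue d k u (starRingEnd ℂ (R * Complex.exp (θ * Complex.I)))
        (r * Complex.exp (a * Complex.I))) =
    2 * Real.pi * Complex.I * (upperResolvent d k u (R * Complex.exp (θ * Complex.I)) -
      if θ < a then resolvent d k u (R * Complex.exp (θ * Complex.I)) else 0) := by
  have hr : 0 < r := hR.trans hrR
  have hn : ∀ s t : ℝ, 0 < s → ‖(s : ℂ) * Complex.exp (t * Complex.I)‖ = s := fun s t hs => by
    rw [norm_mul, Complex.norm_exp_ofReal_mul_I, mul_one, Complex.norm_real,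
      Real.norm_of_nonneg hs.le]
  have hw0 : (R : ℂ) * Complex.exp (θ * Complex.I) ≠ 0 := by
    rw [← norm_pos_iff, hn _ _ hR]; exact hR
  have hj := log_branch_jump hr hR ha hθ
  have hconj : starRingEnd ℂ ((R : ℂ) * Complex.exp (θ * Complex.I)) =
      R * Complex.exp ((-θ : ℝ) * Complex.I) := by
    rw [map_mul, Complex.conj_ofReal, ← Complex.exp_conj]
    simp
  have hb := conj_primInBdry (d := d) (k := k) (u := u) (w := R * Complex.exp (θ * Complex.I))
    (by rw [hn _ _ hR]; exact hu)
  rw [contourValue_eq hw0 (by rw [hn _ _ hR, hn _ _ hr]; exact hrR),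
    contourValue_eq ((map_ne_zero _).2 hw0)
    (by rw [RCLike.norm_conj, hn _ _ hR, hn _ _ hr]; exact hrR), conj_resolvent, map_sub, map_mul,
    Complex.conj_conj]
  rw [← hconj] at hj
  have key : ∀ H X Y Z T : ℂ, (H * X - Z) - (H * Y - T) = H * (X - Y) - (Z - T) := by
    intros; ring
  rw [key, hj, hb]
  split_ifs <;> ring

theorem norm_upperResolvent_sub_le {r R a θ M : ℝ} (hR : 0 < R) (hrR : R < r)
    (ha : a ∈ Set.Ioo 0 Real.pi) (hθ : θ ∈ Set.Ioo 0 Real.pi) (hu : |u| < R)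
    (h1 : ‖contourValue d k u (R * Complex.exp (θ * Complex.I))
      (r * Complex.exp (a * Complex.I))‖ ≤ M)
    (h2 : ‖contourValue d k u (starRingEnd ℂ (R * Complex.exp (θ * Complex.I)))
      (r * Complex.exp (a * Complex.I))‖ ≤ M) :
    ‖upperResolvent d k u (R * Complex.exp (θ * Complex.I)) -
      if θ < a then resolvent d k u (R * Complex.exp (θ * Complex.I)) else 0‖ ≤ M := by
  have h := contourValue_sub_conj (d := d) (k := k) (u := u) hR hrR ha hθ hu
  have h3 := norm_sub_le_of_le h1 ((RCLike.norm_conj _).le.trans h2)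
  rw [h, norm_mul] at h3
  have h4 : ‖(2 * Real.pi * Complex.I : ℂ)‖ = 2 * Real.pi := by
    simp [abs_of_pos Real.pi_pos]
  rw [h4] at h3
  set X := ‖upperResolvent d k u (R * Complex.exp (θ * Complex.I)) -
      if θ < a then resolvent d k u (R * Complex.exp (θ * Complex.I)) else 0‖
  have hX : 0 ≤ X := norm_nonneg _
  nlinarith [Real.pi_gt_three]

end Contour

end GelfandTsetlin

namespace GelfandTsetlin

/-! ### Estimates for the resolvent -/

/-- The size of `w ^ (k + 1) / ∏ (w - d j)`. -/
noncomputable def critWeight {N : ℕ} (d : Fin N → ℝ) (k : ℕ) (w : ℂ) : ℝ :=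
  Real.exp (-(N * pot d (k + 1) w))

/-- Replacing (z - u)^k by z^k costs at most exp(k|u|/|z|), which stays bounded because u is of
order 1/N. -/
theorem norm_resolvent_le {N : ℕ} {d : Fin N → ℝ} {k : ℕ} {u : ℝ} (hd : Function.Injective d)
    (hk : k < N) {z : ℂ} (hz : 0 < z.im) :
    ‖resolvent d k u z‖ ≤ Real.exp (k * |u| / ‖z‖) / ‖z‖ * critWeight d k z := by
  have hz0 : 0 < ‖z‖ := norm_pos_iff.2 (ne_zero_of_im_pos hz)
  have hN : 0 < N := by omega
  have hP : 0 < ‖∏ j, (z - (d j : ℂ))‖ :=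
    norm_pos_iff.2 (Finset.prod_ne_zero_iff.2 fun j _ => sub_ofReal_ne_zero hz _)
  have h1 : ‖z - u‖ ≤ ‖z‖ * Real.exp (|u| / ‖z‖) := by
    calc ‖z - u‖ ≤ ‖z‖ + ‖(u : ℂ)‖ := norm_sub_le _ _
      _ = ‖z‖ * (|u| / ‖z‖ + 1) := by
          rw [Complex.norm_real, Real.norm_eq_abs]; field_simp; ring
      _ ≤ _ := by gcongr; exact Real.add_one_le_exp _
  rw [resolvent_eq hd hk hz.ne', norm_div, norm_pow, critWeight, Real.exp_neg,
    exp_card_mul_pot d (k + 1) hN hz]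
  calc ‖z - u‖ ^ k / ‖∏ j, (z - (d j : ℂ))‖
      ≤ (‖z‖ * Real.exp (|u| / ‖z‖)) ^ k / ‖∏ j, (z - (d j : ℂ))‖ := by gcongr
    _ = _ := by
      rw [mul_pow, ← Real.exp_nat_mul, mul_div_assoc]
      field_simp
      ring

/-- On the vertical line through u the numerator has modulus exactly y^k, and the denominator is
controlled by the vertical growth bound. Both the approach to u and the escape to infinity use this.
-/
theorem norm_resolvent_vert_le {N : ℕ} {d : Fin N → ℝ} {k : ℕ} {u : ℝ}
    (hd : Function.Injective d) (hk : k < N) {ε y : ℝ} (hε : 0 < ε) (hy : 0 < y) :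
    ‖resolvent d k u ⟨u, y⟩‖ ≤ ‖resolvent d k u ⟨u, ε⟩‖ *
      Real.exp ((k - ∑ j, vertWeight u ε (d j)) * Real.log (y / ε)) := by
  have key : ∀ y : ℝ, 0 < y → ‖resolvent d k u ⟨u, y⟩‖ =
      Real.exp (k * Real.log y - ∑ j, Real.log ‖(⟨u, y⟩ : ℂ) - d j‖) := by
    intro y hy
    have hz : 0 < (⟨u, y⟩ : ℂ).im := hy
    have h1 : ‖(⟨u, y⟩ : ℂ) - u‖ = y := by
      have := norm_vert_sq u y u
      exact (pow_left_inj₀ (norm_nonneg _) hy.le two_ne_zero).1 (by simpa using this)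
    rw [resolvent_eq hd hk hz.ne', norm_div, norm_pow, h1, Real.exp_sub, ← Real.log_pow,
      Real.exp_log (by positivity), norm_prod, Real.exp_sum]
    congr 1
    exact Finset.prod_congr rfl fun j _ =>
      (Real.exp_log (norm_pos_iff.2 (sub_ofReal_ne_zero hz _))).symm
  rw [key y hy, key ε hε, ← Real.exp_add]
  refine Real.exp_le_exp.2 ?_
  have h2 := Finset.sum_le_sum fun j (_ : j ∈ Finset.univ) => log_norm_vert_ge u (d j) hε hy
  rw [Finset.sum_add_distrib, ← Finset.sum_mul] at h2
  have h3 := Real.log_div hy.ne' hε.ne'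
  rw [sub_mul]
  have h4 : (k : ℝ) * Real.log (y / ε) = k * Real.log y - k * Real.log ε := by rw [h3]; ring
  linarith

theorem hasDerivAt_vert (u y : ℝ) : HasDerivAt (fun y : ℝ => (⟨u, y⟩ : ℂ)) Complex.I y := by
  have h1 : (fun y : ℝ => (⟨u, y⟩ : ℂ)) = fun y : ℝ => (u : ℂ) + y * Complex.I := by
    ext y; rw [Complex.mk_eq_add_mul_I]
  rw [h1]
  simpa using ((Complex.ofRealCLM.hasDerivAt (x := y)).mul_const Complex.I).const_add (u : ℂ)

/-! ### Bounds for the primitives along paths -/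

theorem norm_primIn_vert_sub_bdry_le {N : ℕ} {d : Fin N → ℝ} {k : ℕ} {u ε M c : ℝ} (hk0 : k ≠ 0)
    (hε : 0 < ε) {w : ℂ} (hw : w.im ≠ 0) (hc : 0 < c) (hcw : |u| + ε + c ≤ ‖w‖)
    (hM : ∀ y ∈ Set.Ioc 0 ε, ‖resolvent d k u ⟨u, y⟩‖ ≤ M) :
    ‖primIn d k u w ⟨u, ε⟩ - primInBdry d k u w‖ ≤ M / c * ε := by
  have hnorm : ∀ y ∈ Set.Ioc 0 ε, ‖(⟨u, y⟩ : ℂ)‖ ≤ |u| + ε := fun y hy => by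
    refine (Complex.norm_le_abs_re_add_abs_im _).trans ?_
    simp only [abs_of_pos hy.1]
    linarith [hy.2]
  have hderiv : ∀ y ∈ Set.Ioc 0 ε, HasDerivAt (fun y : ℝ => primIn d k u w ⟨u, y⟩)
      (resolvent d k u ⟨u, y⟩ / (⟨u, y⟩ - w) * Complex.I) y := fun y hy => by
    have h1 := hasDerivAt_primIn (d := d) (k := k) (u := u) (z := ⟨u, y⟩) hy.1 hw
      (one_sub_div_mem_slitPlane (by linarith [hnorm y hy]))
    exact h1.comp y (hasDerivAt_vert u y)
  have hbound : ∀ y ∈ Set.Ioc 0 ε,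
      ‖resolvent d k u ⟨u, y⟩ / (⟨u, y⟩ - w) * Complex.I‖ ≤ M / c := fun y hy => by
    rw [norm_mul, Complex.norm_I, mul_one, norm_div]
    have h2 : c ≤ ‖(⟨u, y⟩ : ℂ) - w‖ := by
      have := norm_sub_norm_le w (⟨u, y⟩ : ℂ)
      rw [norm_sub_rev] at this
      linarith [hnorm y hy]
    have := hM y hy
    have hM0 : 0 ≤ M := (norm_nonneg _).trans this
    gcongr
  have hM0 : 0 ≤ M := (norm_nonneg _).trans (hM ε ⟨hε, le_rfl⟩)
  have hlim : Tendsto (fun y : ℝ => ‖primIn d k u w ⟨u, ε⟩ - primIn d k u w ⟨u, y⟩‖) (𝓝[>] 0)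
      (𝓝 ‖primIn d k u w ⟨u, ε⟩ - primInBdry d k u w‖) :=
    (tendsto_const_nhds.sub (tendsto_primIn_vert hk0 (by linarith))).norm
  refine le_of_tendsto hlim ?_
  filter_upwards [Ioo_mem_nhdsGT hε] with y hy
  have hsub : Set.Icc y ε ⊆ Set.Ioc 0 ε := fun x hx => ⟨hy.1.trans_le hx.1, hx.2⟩
  have h3 := norm_image_sub_le_of_norm_deriv_le_segment' (f := fun y : ℝ => primIn d k u w ⟨u, y⟩)
    (fun x hx => (hderiv x (hsub hx)).hasDerivWithinAt)
    (fun x hx => hbound x (hsub (Set.Ico_subset_Icc_self hx))) ε (Set.right_mem_Icc.2 hy.2.le)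
  refine h3.trans ?_
  have := hy.1
  gcongr
  linarith

/-- The decay ε/y together with |z - w| ≥ y/2 bounds the derivative by 2Mε/y², which is integrable
up to infinity, where the primitive vanishes. -/
theorem norm_primOut_vert_le {N : ℕ} {d : Fin N → ℝ} {k : ℕ} {u ε M : ℝ} (hε : 0 < ε) {w : ℂ}
    (hw : w.im ≠ 0) (hcw : 2 * ‖w‖ < ε)
    (hM : ∀ y, ε ≤ y → ‖resolvent d k u ⟨u, y⟩‖ ≤ M * (ε / y)) :
    ‖primOut d k u w ⟨u, ε⟩‖ ≤ 2 * M := by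
  have hM0 : 0 ≤ M := by
    have := (norm_nonneg _).trans (hM ε le_rfl)
    rwa [div_self hε.ne', mul_one] at this
  have hnorm : ∀ y, 0 < y → y ≤ ‖(⟨u, y⟩ : ℂ)‖ := fun y _ =>
    (le_abs_self y).trans (Complex.abs_im_le_norm (⟨u, y⟩ : ℂ))
  have hderiv : ∀ y, ε ≤ y → HasDerivAt (fun y : ℝ => primOut d k u w ⟨u, y⟩)
      (resolvent d k u ⟨u, y⟩ / (⟨u, y⟩ - w) * Complex.I) y := fun y hy => by
    have hy0 := hε.trans_le hy
    have h1 := hasDerivAt_primOut (d := d) (k := k) (u := u) (z := ⟨u, y⟩) hy0 hw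
      (by linarith [hnorm y hy0, norm_nonneg w])
    exact h1.comp y (hasDerivAt_vert u y)
  have hbound : ∀ y, ε ≤ y →
      ‖resolvent d k u ⟨u, y⟩ / (⟨u, y⟩ - w) * Complex.I‖ ≤ 2 * M * ε * (y ^ 2)⁻¹ := fun y hy => by
    have hy0 := hε.trans_le hy
    rw [norm_mul, Complex.norm_I, mul_one, norm_div]
    have h2 : y / 2 ≤ ‖(⟨u, y⟩ : ℂ) - w‖ := by
      have := norm_sub_norm_le (⟨u, y⟩ : ℂ) w
      linarith [hnorm y hy0]
    calc ‖resolvent d k u ⟨u, y⟩‖ / ‖(⟨u, y⟩ : ℂ) - w‖ ≤ M * (ε / y) / (y / 2) := by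
          gcongr
          exact hM y hy
      _ = _ := by field_simp
  have hle : ∀ Y, ε ≤ Y → ‖primOut d k u w ⟨u, Y⟩ - primOut d k u w ⟨u, ε⟩‖ ≤ 2 * M := by
    intro Y hY
    have hd' : ∀ y ∈ Set.Icc ε Y, HasDerivAt (fun y : ℝ => primOut d k u w ⟨u, y⟩ -
        primOut d k u w ⟨u, ε⟩) (resolvent d k u ⟨u, y⟩ / (⟨u, y⟩ - w) * Complex.I) y :=
      fun y hy => (hderiv y hy.1).sub_const _
    have hB : ∀ y ∈ Set.Icc ε Y, HasDerivAt (fun y : ℝ => 2 * M * (1 - ε * y⁻¹))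
        (2 * M * ε * (y ^ 2)⁻¹) y := fun y hy => by
      have hy0 := hε.trans_le hy.1
      refine ((((hasDerivAt_inv hy0.ne').const_mul ε).const_sub 1).const_mul (2 * M)).congr_deriv ?_
      ring
    have h4 := image_norm_le_of_norm_deriv_right_le_deriv_boundary'
      (f := fun y : ℝ => primOut d k u w ⟨u, y⟩ - primOut d k u w ⟨u, ε⟩)
      (fun y hy => (hd' y hy).continuousAt.continuousWithinAt)
      (fun y hy => (hd' y (Set.Ico_subset_Icc_self hy)).hasDerivWithinAt)
      (B := fun y : ℝ => 2 * M * (1 - ε * y⁻¹)) (by simp [hε.ne'])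
      (fun y hy => (hB y hy).continuousAt.continuousWithinAt)
      (fun y hy => (hB y (Set.Ico_subset_Icc_self hy)).hasDerivWithinAt)
      (fun y hy => hbound y hy.1) (Set.right_mem_Icc.2 hY)
    refine h4.trans ?_
    have h5 : 0 ≤ ε * Y⁻¹ := by have := hε.trans_le hY; positivity
    nlinarith
  have hlim : Tendsto (fun Y : ℝ => ‖primOut d k u w ⟨u, Y⟩ - primOut d k u w ⟨u, ε⟩‖) atTop
      (𝓝 ‖0 - primOut d k u w ⟨u, ε⟩‖) :=
    (tendsto_primOut_vert.sub tendsto_const_nhds).norm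
  rw [zero_sub, norm_neg] at hlim
  exact le_of_tendsto hlim ((eventually_ge_atTop ε).mono hle)

theorem log_one_add_le_two_mul_sqrt {x : ℝ} (hx : 0 ≤ x) : Real.log (1 + x) ≤ 2 * √x := by
  have h1 : 1 + x ≤ (1 + √x) ^ 2 := by
    nlinarith [Real.sq_sqrt hx, Real.sqrt_nonneg x]
  calc Real.log (1 + x) ≤ Real.log ((1 + √x) ^ 2) := Real.log_le_log (by positivity) h1
    _ = 2 * Real.log (1 + √x) := by rw [Real.log_pow]; push_cast; ring
    _ ≤ 2 * √x := by
        have := Real.log_le_sub_one_of_pos (x := 1 + √x) (by positivity)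
        linarith

/-- The natural bound is log(1 + δ/g). Its weakening to a square root is still integrable in the
angle and simpler to carry. -/
theorem norm_sub_le_of_deriv_le_div {f f' : ℝ → ℂ} {δ g K : ℝ} (hδ : 0 ≤ δ) (hg : 0 < g)
    (hK : 0 ≤ K) (hf : ∀ s ∈ Set.Icc 0 δ, HasDerivAt f (f' s) s)
    (hbound : ∀ s ∈ Set.Icc 0 δ, ‖f' s‖ ≤ K / (s + g)) :
    ‖f δ - f 0‖ ≤ 2 * K * √(δ / g) := by
  have hpos : ∀ s ∈ Set.Icc 0 δ, s + g ≠ 0 := fun s hs => by linarith [hs.1]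
  have hB : ∀ s ∈ Set.Icc 0 δ, HasDerivAt (fun s : ℝ => K * (Real.log (s + g) - Real.log g))
      (K / (s + g)) s := fun s hs => by
    refine (((((hasDerivAt_id' s).add_const g).log (hpos s hs)).sub_const _).const_mul K).congr_deriv ?_
    ring
  have h4 := image_norm_le_of_norm_deriv_right_le_deriv_boundary' (f := fun s => f s - f 0)
    (fun s hs => ((hf s hs).sub_const _).continuousAt.continuousWithinAt)
    (fun s hs => ((hf s (Set.Ico_subset_Icc_self hs)).sub_const _).hasDerivWithinAt)
    (B := fun s : ℝ => K * (Real.log (s + g) - Real.log g)) (by simp)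
    (fun s hs => (hB s hs).continuousAt.continuousWithinAt)
    (fun s hs => (hB s (Set.Ico_subset_Icc_self hs)).hasDerivWithinAt)
    (fun s hs => hbound s (Set.Ico_subset_Icc_self hs)) (Set.right_mem_Icc.2 hδ)
  refine h4.trans ?_
  have h5 : Real.log (δ + g) - Real.log g = Real.log (1 + δ / g) := by
    rw [← Real.log_div (by linarith) hg.ne']
    congr 1
    field_simp
    ring
  simp only [h5]
  have h6 := log_one_add_le_two_mul_sqrt (x := δ / g) (by positivity)
  nlinarith

theorem abs_le_two_mul_abs_exp_sub_one {s : ℝ} (hs : |s| ≤ 1) : |s| ≤ 2 * |Real.exp s - 1| := by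
  rcases le_total 0 s with h | h
  · rw [abs_of_nonneg h, abs_of_nonneg (by linarith [Real.add_one_le_exp s])]
    linarith [Real.add_one_le_exp s]
  · have h1 : -1 ≤ s := (abs_le.1 hs).1
    have h2 : Real.exp s ≤ 1 := Real.exp_le_one_iff.2 h
    rw [abs_of_nonpos h, abs_of_nonpos (by linarith)]
    have h3 := Real.add_one_le_exp (-s)
    have h4 : Real.exp s * Real.exp (-s) = 1 := by rw [← Real.exp_add]; simp
    have h5 := Real.exp_pos s
    have h6 : Real.exp s * (1 - s) ≤ 1 := by nlinarith
    nlinarith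

/-- For w on the circle through W, the distance from the ray to w controls both the radial
displacement and the gap W - w. -/
theorem norm_ray_sub_ge {W w : ℂ} (hn : ‖w‖ = ‖W‖) {s : ℝ} (hs : |s| ≤ 1) :
    ‖W‖ * |s| + ‖W - w‖ ≤ 4 * ‖W * Real.exp s - w‖ := by
  have h1 : ‖W‖ * |Real.exp s - 1| ≤ ‖W * Real.exp s - w‖ := by
    have := abs_norm_sub_norm_le (W * Real.exp s) w
    rw [norm_mul_exp, hn] at this
    calc ‖W‖ * |Real.exp s - 1| = |‖W‖ * Real.exp s - ‖W‖| := by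
          rw [← mul_sub_one, abs_mul, abs_of_nonneg (norm_nonneg W)]
      _ ≤ _ := this
  have h2 : ‖W * Real.exp s - W‖ = ‖W‖ * |Real.exp s - 1| := by
    rw [← mul_sub_one, norm_mul, ← Complex.ofReal_one, ← Complex.ofReal_sub, Complex.norm_real,
      Real.norm_eq_abs]
  have h3 : ‖W - w‖ ≤ ‖W * Real.exp s - w‖ + ‖W * Real.exp s - W‖ := by
    rw [norm_sub_rev (W * Real.exp s) W, add_comm]
    exact norm_sub_le_norm_sub_add_norm_sub _ _ _
  have h4 : ‖W‖ * |s| ≤ ‖W‖ * (2 * |Real.exp s - 1|) :=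
    mul_le_mul_of_nonneg_left (abs_le_two_mul_abs_exp_sub_one hs) (norm_nonneg _)
  linarith

/-- On the cut, W e^s would be a positive multiple of w, and equal moduli would force w = W. Hence
`primIn` remains a primitive across the circle along the ray. -/
theorem one_sub_ray_div_mem_slitPlane {W w : ℂ} (hn : ‖w‖ = ‖W‖) (hw : w ≠ 0) (hne : w ≠ W)
    (s : ℝ) : 1 - W * Real.exp s / w ∈ Complex.slitPlane := by
  by_contra hcon
  rw [Complex.mem_slitPlane_iff, not_or, not_lt, not_not] at hcon
  obtain ⟨x, hx⟩ : ∃ x : ℝ, W * Real.exp s / w = x := by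
    refine ⟨(W * Real.exp s / w).re, Complex.ext (by simp) ?_⟩
    have := hcon.2
    rw [Complex.sub_im, Complex.one_im] at this
    rw [Complex.ofReal_im]
    linarith
  rw [hx, ← Complex.ofReal_one, ← Complex.ofReal_sub, Complex.ofReal_re] at hcon
  have hx0 : 0 < x := by linarith [hcon.1]
  have h1 : W * Real.exp s = x * w := by rw [← hx]; field_simp
  have h2 := congrArg norm h1
  rw [norm_mul_exp, norm_mul, Complex.norm_real, Real.norm_of_nonneg hx0.le, hn, mul_comm] at h2
  have h3 : ‖W‖ ≠ 0 := by rw [← hn]; exact norm_ne_zero_iff.2 hw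
  rw [← mul_right_cancel₀ h3 h2, mul_comm] at h1
  exact hne (mul_left_cancel₀ (by exact_mod_cast (Real.exp_pos s).ne') h1).symm

theorem norm_primIn_ray_sub_le {N : ℕ} {d : Fin N → ℝ} {k : ℕ} {u δ M : ℝ} (hδ : 0 ≤ δ)
    (hδ1 : δ ≤ 1) (hM0 : 0 ≤ M) {W w : ℂ} (hW : 0 < W.im) (hw : w.im ≠ 0) (hn : ‖w‖ = ‖W‖)
    (hne : w ≠ W) (hM : ∀ s ∈ Set.Icc (-δ) δ, ‖resolvent d k u (W * Real.exp s)‖ *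
      ‖W * Real.exp s‖ ≤ M) :
    ‖primIn d k u w (W * Real.exp δ) - primIn d k u w (W * Real.exp (-δ))‖ ≤
      16 * M / ‖W‖ * √(‖W‖ / ‖W - w‖) := by
  have hw0 : w ≠ 0 := by rintro rfl; simp at hw
  have hWpos : 0 < ‖W‖ := norm_pos_iff.2 (ne_zero_of_im_pos hW)
  have hg : 0 < ‖W - w‖ := norm_pos_iff.2 (sub_ne_zero.2 hne.symm)
  have hd : ∀ s, HasDerivAt (fun s : ℝ => primIn d k u w (W * Real.exp s))
      (resolvent d k u (W * Real.exp s) / (W * Real.exp s - w) * (W * Real.exp s)) s := fun s => by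
    have h1 := hasDerivAt_primIn (d := d) (k := k) (u := u) (mul_exp_im_pos hW s) hw
      (one_sub_ray_div_mem_slitPlane hn hw0 hne s)
    exact h1.comp s (hasDerivAt_mul_exp W s)
  have hb : ∀ s ∈ Set.Icc (-δ) δ, ‖resolvent d k u (W * Real.exp s) / (W * Real.exp s - w) *
      (W * Real.exp s)‖ ≤ (4 * M / ‖W‖) / (|s| + ‖W - w‖ / ‖W‖) := by
    intro s hs
    have h1 := norm_ray_sub_ge (W := W) hn (s := s) (abs_le.2 ⟨by linarith [hs.1], by linarith [hs.2]⟩)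
    have h2 := hM s hs
    have h3 : 0 < ‖W‖ * |s| + ‖W - w‖ := by positivity
    have h4 : 0 < ‖W * Real.exp s - w‖ := by linarith
    rw [norm_mul, norm_div]
    calc ‖resolvent d k u (W * Real.exp s)‖ / ‖W * Real.exp s - w‖ * ‖W * Real.exp s‖
        = (‖resolvent d k u (W * Real.exp s)‖ * ‖W * Real.exp s‖) / ‖W * Real.exp s - w‖ := by ring
      _ ≤ M / ((‖W‖ * |s| + ‖W - w‖) / 4) := by gcongr; linarith
      _ = _ := by field_simp
  have hg' : 0 < ‖W - w‖ / ‖W‖ := by positivity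
  have hK : 0 ≤ 4 * M / ‖W‖ := by positivity
  have h1 := norm_sub_le_of_deriv_le_div hδ hg' hK (fun s _ => hd s) (fun s hs => by
    have := hb s ⟨by linarith [hs.1], hs.2⟩
    rwa [abs_of_nonneg hs.1] at this)
  have h2 := norm_sub_le_of_deriv_le_div (f := fun s : ℝ => primIn d k u w (W * Real.exp (-s)))
    (f' := fun s => -(resolvent d k u (W * Real.exp (-s)) / (W * Real.exp (-s) - w) *
      (W * Real.exp (-s)))) hδ hg' hK (fun s _ => by
      have := (hd (-s)).scomp s (hasDerivAt_neg s)
      simpa [Function.comp_def] using this) (fun s hs => by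
    have := hb (-s) ⟨by linarith [hs.2], by linarith [hs.1]⟩
    rw [abs_neg, abs_of_nonneg hs.1] at this
    rwa [norm_neg])
  have h3 : √(δ / (‖W - w‖ / ‖W‖)) ≤ √(‖W‖ / ‖W - w‖) := by
    refine Real.sqrt_le_sqrt ?_
    rw [div_div_eq_mul_div]
    gcongr
    nlinarith
  have h4 : primIn d k u w (W * Real.exp δ) - primIn d k u w (W * Real.exp (-δ)) =
      (primIn d k u w (W * Real.exp δ) - primIn d k u w (W * Real.exp 0)) -
      (primIn d k u w (W * Real.exp (-δ)) - primIn d k u w (W * Real.exp (-0))) := by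
    rw [neg_zero]; ring
  rw [h4]
  refine (norm_sub_le_of_le h1 h2).trans ?_
  have h5 : 2 * (4 * M / ‖W‖) * √(δ / (‖W - w‖ / ‖W‖)) ≤
      2 * (4 * M / ‖W‖) * √(‖W‖ / ‖W - w‖) := by gcongr
  calc _ ≤ 2 * (4 * M / ‖W‖) * √(‖W‖ / ‖W - w‖) + 2 * (4 * M / ‖W‖) * √(‖W‖ / ‖W - w‖) :=
        add_le_add h5 h5
    _ = _ := by ring

end GelfandTsetlin

/-! ### Bounds for the contour value along a scaling. -/

namespace GelfandTsetlin

/-- Scaling of configurations around a point of the bulk: `w₀` is the critical point of the limiting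
potential, `W` its finite counterpart and `u` a point at distance of order `1 / N` of the origin. -/
structure BulkScaling {ι : Type*} (l : Filter ι) (A B β : ℝ) (ν : Measure ℝ) (N k : ι → ℕ)
    (d : (i : ι) → Fin (N i) → ℝ) (u : ι → ℝ) (w₀ : ℂ) (W : ι → ℂ) : Prop where
  scaling : Scaling l A B β ν N (fun i => k i + 1) d
  injective : ∀ᶠ i in l, Function.Injective (d i)
  ne_zero : ∀ᶠ i in l, k i ≠ 0
  lt_card : ∀ᶠ i in l, k i + 1 < N i
  bound : ∃ U₀ : ℝ, ∀ᶠ i in l, N i * |u i| ≤ U₀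
  measure_compl : ν (Set.Icc A B)ᶜ = 0
  ne_dirac : ν ≠ Measure.dirac 0
  isCritical : IsCritical ν β w₀
  lt_one : β < 1
  tendsto_root : Tendsto W l (𝓝 w₀)
  crit_root : ∀ᶠ i in l, crit (d i) (k i + 1) (W i) = 0

theorem exists_ball_of_eventually_prod {ι : Type*} {l : Filter ι} {ζ : ℂ} {P : ι → ℂ → Prop}
    (h : ∀ᶠ p in l ×ˢ 𝓝 ζ, P p.1 p.2) : ∃ ρ > 0, ∀ᶠ i in l, ∀ z ∈ Metric.ball ζ ρ, P i z := by
  obtain ⟨p, hp, q, hq, hpq⟩ := eventually_prod_iff.1 h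
  obtain ⟨ρ, hρ, hball⟩ := Metric.eventually_nhds_iff_ball.1 hq
  exact ⟨ρ, hρ, hp.mono fun i hi z hz => hpq hi (hball z hz)⟩

/-- The functions `Φ i w` differ by at most a multiple of `h i` between `x i` and `y i`. -/
def CloseAlong {ι : Type*} (l : Filter ι) (T : ι → Set ℂ) (h : ι → ℝ) (Φ : ι → ℂ → ℂ → ℂ)
    (x y : ι → ℂ) : Prop :=
  ∃ C : ℝ, ∀ᶠ i in l, ∀ w ∈ T i, ‖Φ i w (x i) - Φ i w (y i)‖ ≤ C * h i

namespace CloseAlong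

variable {ι : Type*} {l : Filter ι} {T : ι → Set ℂ} {h : ι → ℝ} {Φ : ι → ℂ → ℂ → ℂ}
  {x y z : ι → ℂ}

theorem symm (hxy : CloseAlong l T h Φ x y) : CloseAlong l T h Φ y x := by
  obtain ⟨C, hC⟩ := hxy
  exact ⟨C, hC.mono fun i hi w hw => by rw [norm_sub_rev]; exact hi w hw⟩

theorem trans (hxy : CloseAlong l T h Φ x y) (hyz : CloseAlong l T h Φ y z) :
    CloseAlong l T h Φ x z := by
  obtain ⟨C, hC⟩ := hxy
  obtain ⟨D, hD⟩ := hyz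
  refine ⟨C + D, (hC.and hD).mono fun i hi w hw => ?_⟩
  rw [add_mul]
  exact (norm_sub_le_norm_sub_add_norm_sub _ _ _).trans (add_le_add (hi.1 w hw) (hi.2 w hw))

/-- The local condition which makes `Φ` have bounded differences. -/
def LocallyBounded (l : Filter ι) (T : ι → Set ℂ) (h : ι → ℝ) (Φ : ι → ℂ → ℂ → ℂ) (ζ : ℂ) : Prop :=
  ∃ C : ℝ, ∀ᶠ p : ι × ℂ in l ×ˢ 𝓝 ζ, ∀ w ∈ T p.1,
    ∃ F, HasDerivAt (Φ p.1 w) F p.2 ∧ ‖F‖ ≤ C * h p.1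

theorem LocallyBounded.exists_ball {ζ : ℂ} (hloc : LocallyBounded l T h Φ ζ) :
    ∃ ρ > 0, ∃ C, ∀ᶠ i in l, ∀ w ∈ T i, ∀ x ∈ Metric.ball ζ ρ, ∀ y ∈ Metric.ball ζ ρ,
      ‖Φ i w x - Φ i w y‖ ≤ C * h i := by
  obtain ⟨C, hC⟩ := hloc
  obtain ⟨ρ, hρ, hball⟩ := exists_ball_of_eventually_prod
    (P := fun i z => ∀ w ∈ T i, ∃ F, HasDerivAt (Φ i w) F z ∧ ‖F‖ ≤ C * h i) hC
  refine ⟨ρ, hρ, C * (2 * ρ), hball.mono fun i hi w hw x hx y hy => ?_⟩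
  have hderiv : ∀ z ∈ Metric.ball ζ ρ, HasDerivAt (Φ i w) (deriv (Φ i w) z) z ∧
      ‖deriv (Φ i w) z‖ ≤ C * h i := fun z hz => by
    obtain ⟨F, hF, hFn⟩ := hi z hz w hw
    rw [hF.deriv]
    exact ⟨hF, hFn⟩
  have h1 := (convex_ball ζ ρ).norm_image_sub_le_of_norm_hasDerivWithin_le
    (fun z hz => (hderiv z hz).1.hasDerivWithinAt) (fun z hz => (hderiv z hz).2) hy hx
  have h2 : ‖x - y‖ ≤ 2 * ρ := by
    have h3 := dist_triangle_right x y ζ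
    rw [dist_eq_norm] at h3
    linarith [Metric.mem_ball.1 hx, Metric.mem_ball.1 hy]
  have h3 : 0 ≤ C * h i := (norm_nonneg _).trans (hderiv x hx).2
  calc _ ≤ C * h i * ‖x - y‖ := h1
    _ ≤ C * h i * (2 * ρ) := by gcongr
    _ = _ := by ring

theorem of_tendsto {ζ : ℂ} (hloc : LocallyBounded l T h Φ ζ) (hx : Tendsto x l (𝓝 ζ))
    (hy : Tendsto y l (𝓝 ζ)) : CloseAlong l T h Φ x y := by
  obtain ⟨ρ, hρ, C, hC⟩ := hloc.exists_ball
  refine ⟨C, ?_⟩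
  filter_upwards [hC, hx.eventually (Metric.ball_mem_nhds ζ hρ),
    hy.eventually (Metric.ball_mem_nhds ζ hρ)] with i hi hxi hyi w hw
  exact hi w hw _ hxi _ hyi

/-- Bounded derivatives give closeness locally, and closeness is an equivalence relation, so
connectedness replaces an explicit path and its length. -/
theorem of_isPreconnected {S : Set ℂ} (hS : IsPreconnected S)
    (hloc : ∀ ζ ∈ S, LocallyBounded l T h Φ ζ) {a b : ℂ} (ha : a ∈ S) (hb : b ∈ S) :
    CloseAlong l T h Φ (fun _ => a) (fun _ => b) := by
  refine hS.induction₂ (fun a b => CloseAlong l T h Φ (fun _ => a) (fun _ => b))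
    (fun a ha => ?_) (fun a b c _ _ _ hab hbc => hab.trans hbc) (fun a b _ _ hab => hab.symm) ha hb
  obtain ⟨ρ, hρ, C, hC⟩ := (hloc a ha).exists_ball
  filter_upwards [mem_nhdsWithin_of_mem_nhds (Metric.ball_mem_nhds a hρ)] with b hb
  exact ⟨C, hC.mono fun i hi w hw => hi w hw _ (Metric.mem_ball_self hρ) _ hb⟩

end CloseAlong

namespace BulkScaling

variable {ι : Type*} {l : Filter ι} {A B β : ℝ} {ν : Measure ℝ}
  {N k : ι → ℕ} {d : (i : ι) → Fin (N i) → ℝ} {u : ι → ℝ} {w₀ : ℂ} {W : ι → ℂ}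

theorem norm_pos (h : BulkScaling l A B β ν N k d u w₀ W) : 0 < ‖w₀‖ :=
  norm_pos_iff.2 (ne_zero_of_im_pos h.isCritical.im_pos)

theorem tendsto_u (h : BulkScaling l A B β ν N k d u w₀ W) : Tendsto u l (𝓝 0) := by
  obtain ⟨U₀, hU⟩ := h.bound
  have h1 : Tendsto (fun i => U₀ / (N i : ℝ)) l (𝓝 0) :=
    Tendsto.const_div_atTop (tendsto_natCast_atTop_atTop.comp h.scaling.tendsto_card) _
  refine squeeze_zero_norm' ?_ h1
  filter_upwards [hU, h.scaling.eventually_card_pos] with i hi hN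
  have : (0 : ℝ) < N i := by exact_mod_cast hN
  rw [Real.norm_eq_abs, le_div_iff₀ this, mul_comm]
  exact hi

theorem tendsto_pot_root (h : BulkScaling l A B β ν N k d u w₀ W) :
    Tendsto (fun i => pot (d i) (k i + 1) (W i)) l (𝓝 (limPot ν β w₀)) :=
  h.scaling.tendsto_pot_comp h.isCritical.im_pos h.tendsto_root

theorem eventually_root_im_pos (h : BulkScaling l A B β ν N k d u w₀ W) :
    ∀ᶠ i in l, 0 < (W i).im :=
  h.tendsto_root.eventually (eventually_im_pos h.isCritical.im_pos)

/-- A strict inequality between limiting potentials persists for the finite ones near ζ, so exp(-N ·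
`pot`) is smaller there than at the root. -/
theorem eventually_norm_resolvent_le (h : BulkScaling l A B β ν N k d u w₀ W) {ζ : ℂ}
    (hζ : 0 < ζ.im) (hL : limPot ν β w₀ < limPot ν β ζ) :
    ∃ C : ℝ, ∀ᶠ p : ι × ℂ in l ×ˢ 𝓝 ζ,
      ‖resolvent (d p.1) (k p.1) (u p.1) p.2‖ ≤ C * critWeight (d p.1) (k p.1) (W p.1) := by
  obtain ⟨U₀, hU⟩ := h.bound
  have hζ0 : 0 < ‖ζ‖ := norm_pos_iff.2 (ne_zero_of_im_pos hζ)
  obtain ⟨M, hM1, hM2⟩ := exists_between hL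
  refine ⟨Real.exp (U₀ / (‖ζ‖ / 2)) / (‖ζ‖ / 2), ?_⟩
  have h1 := (h.scaling.tendsto_pot hζ).eventually (lt_mem_nhds hM2)
  have h2 : ∀ᶠ i in l, (N i * |u i| ≤ U₀ ∧ Function.Injective (d i) ∧ k i + 1 < N i) ∧
      pot (d i) (k i + 1) (W i) < M :=
    (hU.and (h.injective.and h.lt_card)).and (h.tendsto_pot_root.eventually (gt_mem_nhds hM1))
  have h3 : ∀ᶠ z : ℂ in 𝓝 ζ, 0 < z.im ∧ ‖ζ‖ / 2 < ‖z‖ :=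
    (eventually_im_pos hζ).and ((continuous_norm.tendsto ζ).eventually (lt_mem_nhds (by linarith)))
  filter_upwards [h1, h2.prod_mk h3] with p hp1 hp2
  obtain ⟨⟨⟨hu, hinj, hk⟩, hpW⟩, him, hnz⟩ := hp2
  have hku : k p.1 * |u p.1| ≤ U₀ := by
    refine le_trans ?_ hu
    gcongr
    omega
  have hU0 : 0 ≤ U₀ := le_trans (by positivity) hku
  refine (norm_resolvent_le hinj (by omega) him).trans ?_
  have h4 : critWeight (d p.1) (k p.1) p.2 ≤ critWeight (d p.1) (k p.1) (W p.1) := by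
    refine Real.exp_le_exp.2 (neg_le_neg (mul_le_mul_of_nonneg_left ?_ (Nat.cast_nonneg _)))
    linarith
  have h5 : 0 ≤ critWeight (d p.1) (k p.1) p.2 := (Real.exp_pos _).le
  gcongr

theorem locallyBounded_primIn (h : BulkScaling l A B β ν N k d u w₀ W) {ζ : ℂ}
    (hζ : 0 < ζ.im) (hζR : ‖ζ‖ < ‖w₀‖) (hL : limPot ν β w₀ < limPot ν β ζ) :
    CloseAlong.LocallyBounded l (fun i => {w | ‖w‖ = ‖W i‖ ∧ w.im ≠ 0})
      (fun i => critWeight (d i) (k i) (W i)) (fun i => primIn (d i) (k i) (u i)) ζ := by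
  obtain ⟨C, hC⟩ := h.eventually_norm_resolvent_le hζ hL
  obtain ⟨M, hM1, hM2⟩ := exists_between hζR
  obtain ⟨M', hM1', hM2'⟩ := exists_between hM1
  refine ⟨C / (M - M'), ?_⟩
  have h2 : ∀ᶠ i in l, M < ‖W i‖ := h.tendsto_root.norm.eventually (lt_mem_nhds hM2)
  have h3 : ∀ᶠ z : ℂ in 𝓝 ζ, 0 < z.im ∧ ‖z‖ < M' :=
    (eventually_im_pos hζ).and ((continuous_norm.tendsto ζ).eventually (gt_mem_nhds hM1'))
  filter_upwards [hC, h2.prod_mk h3] with p hp1 hp2 w hw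
  obtain ⟨hWn, him, hz⟩ := hp2
  obtain ⟨hwn, hwim⟩ : ‖w‖ = ‖W p.1‖ ∧ w.im ≠ 0 := hw
  refine ⟨_, hasDerivAt_primIn him hwim (one_sub_div_mem_slitPlane (by linarith)), ?_⟩
  have h4 : M - M' ≤ ‖p.2 - w‖ := by
    have := norm_sub_norm_le w p.2
    rw [norm_sub_rev] at this
    linarith
  have h5 : 0 < M - M' := sub_pos.2 hM2'
  have h6 := (norm_nonneg _).trans hp1
  rw [norm_div, div_mul_eq_mul_div]
  gcongr

theorem locallyBounded_primOut (h : BulkScaling l A B β ν N k d u w₀ W) {ζ : ℂ}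
    (hζ : 0 < ζ.im) (hζR : ‖w₀‖ < ‖ζ‖) (hL : limPot ν β w₀ < limPot ν β ζ) :
    CloseAlong.LocallyBounded l (fun i => {w | ‖w‖ = ‖W i‖ ∧ w.im ≠ 0})
      (fun i => critWeight (d i) (k i) (W i)) (fun i => primOut (d i) (k i) (u i)) ζ := by
  obtain ⟨C, hC⟩ := h.eventually_norm_resolvent_le hζ hL
  obtain ⟨M, hM1, hM2⟩ := exists_between hζR
  obtain ⟨M', hM1', hM2'⟩ := exists_between hM1
  refine ⟨C / (M - M'), ?_⟩
  have h2 : ∀ᶠ i in l, ‖W i‖ < M' := h.tendsto_root.norm.eventually (gt_mem_nhds hM1')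
  have h3 : ∀ᶠ z : ℂ in 𝓝 ζ, 0 < z.im ∧ M < ‖z‖ :=
    (eventually_im_pos hζ).and ((continuous_norm.tendsto ζ).eventually (lt_mem_nhds hM2))
  filter_upwards [hC, h2.prod_mk h3] with p hp1 hp2 w hw
  obtain ⟨hWn, him, hz⟩ := hp2
  obtain ⟨hwn, hwim⟩ : ‖w‖ = ‖W p.1‖ ∧ w.im ≠ 0 := hw
  refine ⟨_, hasDerivAt_primOut him hwim (by linarith), ?_⟩
  have h4 : M - M' ≤ ‖p.2 - w‖ := by
    have := norm_sub_norm_le p.2 w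
    linarith
  have h5 : 0 < M - M' := sub_pos.2 hM2'
  have h6 := (norm_nonneg _).trans hp1
  rw [norm_div, div_mul_eq_mul_div]
  gcongr

theorem tendsto_avg_vertWeight (h : BulkScaling l A B β ν N k d u w₀ W) {ε : ℝ} (hε : 0 < ε) :
    Tendsto (fun i => avg (d i) (vertWeight (u i) ε)) l (𝓝 (∫ t, vertWeight 0 ε t ∂ν)) := by
  have h1 := h.scaling.tendsto_avg_param (φ := fun u t => vertWeight u ε t) (y := 0)
    (fun t _ => ?_) (h.scaling.tendsto_avg_real _ (continuous_vertWeight 0 hε))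
  · have h2 := h1.comp (tendsto_prodMk_self h.tendsto_u)
    simp only [Function.comp_def] at h2
    exact h2
  · have : (Function.uncurry fun u t => vertWeight u ε t) =
        fun p : ℝ × ℝ => ε ^ 2 / ((p.1 - p.2) ^ 2 + ε ^ 2) := by
      ext p; simp only [Function.uncurry, vertWeight, norm_vert_sq]
    rw [this]
    exact ContinuousAt.div₀ (by fun_prop) (by fun_prop) (by positivity)

theorem tendsto_vert (h : BulkScaling l A B β ν N k d u w₀ W) (ε : ℝ) :
    Tendsto (fun i => (⟨u i, ε⟩ : ℂ)) l (𝓝 ⟨0, ε⟩) := by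
  have h1 : ∀ x : ℝ, (⟨x, ε⟩ : ℂ) = (x : ℂ) + ε * Complex.I :=
    fun x => Complex.mk_eq_add_mul_I _ _
  simp only [h1]
  exact ((Complex.continuous_ofReal.tendsto 0).comp h.tendsto_u).add_const _

theorem eventually_norm_resolvent_vert_le (h : BulkScaling l A B β ν N k d u w₀ W) {ε : ℝ}
    (hε : 0 < ε) (hL : limPot ν β w₀ < limPot ν β ⟨0, ε⟩) :
    ∃ C : ℝ, ∀ᶠ i in l, ‖resolvent (d i) (k i) (u i) ⟨u i, ε⟩‖ ≤
      C * critWeight (d i) (k i) (W i) := by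
  obtain ⟨C, hC⟩ := h.eventually_norm_resolvent_le (ζ := ⟨0, ε⟩) hε hL
  refine ⟨C, ?_⟩
  have := (tendsto_prodMk_self (h.tendsto_vert ε)).eventually hC
  exact this

theorem card_mul_avg {N : ℕ} (hN : 0 < N) (d : Fin N → ℝ) (f : ℝ → ℝ) :
    N * avg d f = ∑ j, f (d j) := by
  have : (N : ℝ) ≠ 0 := by exact_mod_cast hN.ne'
  rw [avg, smul_eq_mul, mul_inv_cancel_left₀ this]

/-- Mean weight below β makes k at least the sum of the weights, so the resolvent below height ε is
no larger than at height ε. -/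
theorem exists_primIn_bdry_bound (h : BulkScaling l A B β ν N k d u w₀ W) {ε : ℝ} (hε : 0 < ε)
    (hεR : ε < ‖w₀‖) (hL : limPot ν β w₀ < limPot ν β ⟨0, ε⟩)
    (hint : ∫ t, vertWeight 0 ε t ∂ν < β) :
    ∃ C : ℝ, ∀ᶠ i in l, ∀ w ∈ {w : ℂ | ‖w‖ = ‖W i‖ ∧ w.im ≠ 0},
      ‖primIn (d i) (k i) (u i) w ⟨u i, ε⟩ - primInBdry (d i) (k i) (u i) w‖ ≤
        C * critWeight (d i) (k i) (W i) := by
  obtain ⟨C, hC⟩ := h.eventually_norm_resolvent_vert_le hε hL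
  set c := (‖w₀‖ - ε) / 2 with hc
  have hc0 : 0 < c := by linarith
  refine ⟨C / c * ε, ?_⟩
  have hratio : Tendsto (fun i => (k i : ℝ) / N i) l (𝓝 β) := by
    have h1 := h.scaling.tendsto_ratio.sub (tendsto_inv_atTop_zero.comp
      (tendsto_natCast_atTop_atTop.comp h.scaling.tendsto_card))
    rw [sub_zero] at h1
    refine h1.congr fun i => ?_
    simp only [Function.comp_apply]
    push_cast
    ring
  have h1 := (h.tendsto_avg_vertWeight hε).eventually_lt hratio hint
  have h2 : ∀ᶠ i in l, |u i| + ε + c < ‖W i‖ := by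
    refine Tendsto.eventually_lt (y := |0| + ε + c) ?_ h.tendsto_root.norm ?_
    · exact (h.tendsto_u.abs.add_const _).add_const _
    · rw [abs_zero]; linarith
  filter_upwards [hC, h1, h2, h.ne_zero, h.lt_card, h.injective] with i hCi hi1 hi2 hk0 hkN hinj w hw
  obtain ⟨hwn, hwim⟩ : ‖w‖ = ‖W i‖ ∧ w.im ≠ 0 := hw
  have hN : 0 < N i := by omega
  have hN' : (0 : ℝ) < N i := by exact_mod_cast hN
  have hsum : ∑ j, vertWeight (u i) ε (d i j) ≤ k i := by
    rw [← card_mul_avg hN, ← le_div_iff₀' hN']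
    exact hi1.le
  have h3 := norm_primIn_vert_sub_bdry_le (d := d i) (u := u i)
    (M := C * critWeight (d i) (k i) (W i)) hk0 hε hwim hc0 (by rw [hwn]; exact hi2.le)
    (fun y hy => by
      refine (norm_resolvent_vert_le hinj (by omega) hε hy.1).trans (le_trans ?_ hCi)
      refine mul_le_of_le_one_right (norm_nonneg _) (Real.exp_le_one_iff.2 ?_)
      refine mul_nonpos_of_nonneg_of_nonpos (by linarith) (Real.log_nonpos (div_nonneg hy.1.le hε.le) ?_)
      exact (div_le_one hε).2 hy.2)
  refine h3.trans (le_of_eq ?_)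
  ring

/-- Mean weight above β makes the sum of the weights at least k + 1, and the spare unit yields the
decay ε/y. -/
theorem exists_primOut_bound (h : BulkScaling l A B β ν N k d u w₀ W) {ε : ℝ} (hε : 0 < ε)
    (hεR : 2 * ‖w₀‖ < ε) (hL : limPot ν β w₀ < limPot ν β ⟨0, ε⟩)
    (hint : β < ∫ t, vertWeight 0 ε t ∂ν) :
    ∃ C : ℝ, ∀ᶠ i in l, ∀ w ∈ {w : ℂ | ‖w‖ = ‖W i‖ ∧ w.im ≠ 0},
      ‖primOut (d i) (k i) (u i) w ⟨u i, ε⟩‖ ≤ C * critWeight (d i) (k i) (W i) := by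
  obtain ⟨C, hC⟩ := h.eventually_norm_resolvent_vert_le hε hL
  refine ⟨2 * C, ?_⟩
  have h1 := h.scaling.tendsto_ratio.eventually_lt (h.tendsto_avg_vertWeight hε) hint
  have h2 : ∀ᶠ i in l, 2 * ‖W i‖ < ε :=
    (h.tendsto_root.norm.const_mul 2).eventually (gt_mem_nhds hεR)
  filter_upwards [hC, h1, h2, h.lt_card, h.injective] with i hCi hi1 hi2 hkN hinj w hw
  obtain ⟨hwn, hwim⟩ : ‖w‖ = ‖W i‖ ∧ w.im ≠ 0 := hw
  have hN : 0 < N i := by omega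
  have hN' : (0 : ℝ) < N i := by exact_mod_cast hN
  have hsum : (k i : ℝ) + 1 ≤ ∑ j, vertWeight (u i) ε (d i j) := by
    rw [← card_mul_avg hN, ← div_le_iff₀' hN']
    exact_mod_cast hi1.le
  rw [mul_assoc]
  refine norm_primOut_vert_le hε hwim (by rw [hwn]; exact hi2) fun y hy => ?_
  have hy0 := hε.trans_le hy
  refine (norm_resolvent_vert_le hinj (by omega) hε hy0).trans ?_
  have hlog : 0 ≤ Real.log (y / ε) := Real.log_nonneg ((one_le_div hε).2 hy)
  have h4 : Real.exp ((k i - ∑ j, vertWeight (u i) ε (d i j)) * Real.log (y / ε)) ≤ ε / y := by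
    have h5 : ε / y = Real.exp (-Real.log (y / ε)) := by
      rw [Real.exp_neg, Real.exp_log (by positivity), inv_div]
    rw [h5]
    refine Real.exp_le_exp.2 ?_
    nlinarith
  have h6 := (norm_nonneg _).trans hCi
  gcongr

/-- The bound for the contour integral, up to the singularity at the critical point. -/
theorem exists_contourValue_bound [IsProbabilityMeasure ν] [l.NeBot] (h : BulkScaling l A B β ν N k d u w₀ W) :
    ∃ δ > 0, ∃ C : ℝ, ∀ᶠ i in l, ∀ w : ℂ, ‖w‖ = ‖W i‖ → w.im ≠ 0 → w ≠ W i →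
      ‖contourValue (d i) (k i) (u i) w (W i * Real.exp δ)‖ ≤
        C * critWeight (d i) (k i) (W i) * (1 + √(‖W i‖ / ‖W i - w‖)) := by
  have hν := h.measure_compl
  have h0 := h.ne_dirac
  have hc := h.isCritical
  have hR := h.norm_pos
  obtain ⟨U₀, hU⟩ := h.bound
  obtain ⟨δ₀, hδ₀, κ, hκ, hray⟩ := h.scaling.exists_pot_ray_ge hν h0 hc h.tendsto_root h.crit_root
  set δ := min δ₀ 1 with hδdef
  have hδ : 0 < δ := lt_min hδ₀ one_pos
  have hδ1 : δ ≤ 1 := min_le_right _ _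
  have hδδ₀ : δ ≤ δ₀ := min_le_left _ _
  have hWs : ∀ s : ℝ, Tendsto (fun i => W i * Real.exp s) l (𝓝 (w₀ * Real.exp s)) := fun s =>
    h.tendsto_root.mul_const _
  -- The ray estimate in the limit: both ends of the ray segment lie in the superlevel set and can
  -- be joined to the imaginary axis.
  have hlim : ∀ s ∈ Set.Icc (-δ) δ, s ≠ 0 → limPot ν β w₀ < limPot ν β (w₀ * Real.exp s) := by
    intro s hs hs0
    have h1 := h.scaling.tendsto_pot_comp (mul_exp_im_pos hc.im_pos s) (hWs s)
    have h2 := le_of_tendsto_of_tendsto (h.tendsto_pot_root.add_const (κ * (Real.exp s - 1 - s))) h1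
      (hray.mono fun i hi => hi s ⟨by linarith [hs.1], by linarith [hs.2]⟩)
    have := mul_pos hκ (show 0 < Real.exp s - 1 - s by linarith [Real.add_one_lt_exp hs0])
    linarith
  obtain ⟨ε, hε, hεR, hεL, hεint⟩ := hc.exists_low_point hν h0 (limPot ν β w₀) hR
  obtain ⟨Λ, hΛ, hΛR, hΛL, hΛint⟩ := exists_high_point hν h.lt_one (limPot ν β w₀) (2 * ‖w₀‖)
  -- the inner and the outer region
  have hin : CloseAlong l (fun i => {w | ‖w‖ = ‖W i‖ ∧ w.im ≠ 0})
      (fun i => critWeight (d i) (k i) (W i)) (fun i => primIn (d i) (k i) (u i))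
      (fun i => W i * Real.exp (-δ)) (fun i => ⟨u i, ε⟩) := by
    have hz : ‖w₀ * Real.exp (-δ)‖ < ‖w₀‖ := by
      rw [norm_mul_exp]
      exact mul_lt_of_lt_one_right hR (Real.exp_lt_one_iff.2 (by linarith))
    have hzL := hlim (-δ) ⟨le_rfl, by linarith⟩ (by linarith)
    have hzi := mul_exp_im_pos hc.im_pos (-δ)
    have hlow : ‖(⟨0, ε⟩ : ℂ)‖ < ‖w₀‖ := by rwa [norm_vert_zero hε]
    have hS := isPreconnected_superlevel (β := β) hν (J := Set.Ioo 0 ‖w₀‖) Set.ordConnected_Ioo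
      (fun r hr => hr.1) (L := limPot ν β w₀)
      (fun r hr => h.scaling.exists_limPot_gt hν h0 hc hr.1 hr.2.ne)
    have h1 := CloseAlong.of_tendsto (h.locallyBounded_primIn hzi hz hzL) (hWs (-δ))
      (tendsto_const_nhds (x := w₀ * Real.exp (-δ)))
    have h2 := CloseAlong.of_isPreconnected hS (fun ζ hζ =>
      h.locallyBounded_primIn hζ.1 hζ.2.1.2 hζ.2.2)
      (a := w₀ * Real.exp (-δ)) (b := ⟨0, ε⟩)
      ⟨hzi, ⟨norm_pos_iff.2 (ne_zero_of_im_pos hzi), hz⟩, hzL⟩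
      ⟨hε, ⟨by rwa [norm_vert_zero hε], hlow⟩, hεL⟩
    have h3 := CloseAlong.of_tendsto (h.locallyBounded_primIn (ζ := ⟨0, ε⟩) hε hlow hεL)
      (tendsto_const_nhds (x := (⟨0, ε⟩ : ℂ))) (h.tendsto_vert ε)
    exact (h1.trans h2).trans h3
  have hout : CloseAlong l (fun i => {w | ‖w‖ = ‖W i‖ ∧ w.im ≠ 0})
      (fun i => critWeight (d i) (k i) (W i)) (fun i => primOut (d i) (k i) (u i))
      (fun i => W i * Real.exp δ) (fun i => ⟨u i, Λ⟩) := by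
    have hz : ‖w₀‖ < ‖w₀ * Real.exp δ‖ := by
      rw [norm_mul_exp]
      exact lt_mul_of_one_lt_right hR (Real.one_lt_exp_iff.2 hδ)
    have hzL := hlim δ ⟨by linarith, le_rfl⟩ hδ.ne'
    have hzi := mul_exp_im_pos hc.im_pos δ
    have hhigh : ‖w₀‖ < ‖(⟨0, Λ⟩ : ℂ)‖ := by rw [norm_vert_zero hΛ]; linarith
    have hS := isPreconnected_superlevel (β := β) hν (J := Set.Ioi ‖w₀‖) Set.ordConnected_Ioi
      (fun r hr => hR.trans hr) (L := limPot ν β w₀)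
      (fun r hr => h.scaling.exists_limPot_gt hν h0 hc (hR.trans hr) (ne_of_gt hr))
    have h1 := CloseAlong.of_tendsto (h.locallyBounded_primOut hzi hz hzL) (hWs δ)
      (tendsto_const_nhds (x := w₀ * Real.exp δ))
    have h2 := CloseAlong.of_isPreconnected hS (fun ζ hζ =>
      h.locallyBounded_primOut hζ.1 hζ.2.1 hζ.2.2)
      (a := w₀ * Real.exp δ) (b := ⟨0, Λ⟩) ⟨hzi, hz, hzL⟩ ⟨hΛ, hhigh, hΛL⟩
    have h3 := CloseAlong.of_tendsto (h.locallyBounded_primOut (ζ := ⟨0, Λ⟩) hΛ hhigh hΛL)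
      (tendsto_const_nhds (x := (⟨0, Λ⟩ : ℂ))) (h.tendsto_vert Λ)
    exact (h1.trans h2).trans h3
  obtain ⟨C₁, hC₁⟩ := hin
  obtain ⟨C₂, hC₂⟩ := h.exists_primIn_bdry_bound hε hεR hεL hεint
  obtain ⟨C₃, hC₃⟩ := hout
  obtain ⟨C₄, hC₄⟩ := h.exists_primOut_bound hΛ hΛR hΛL hΛint
  set r₀ := ‖w₀‖ / 2 * Real.exp (-1) with hr₀
  have hr₀pos : 0 < r₀ := by positivity
  set C₅ := Real.exp (U₀ / r₀) with hC₅
  have hWlow := h.tendsto_root.norm.eventually (lt_mem_nhds (show ‖w₀‖ / 2 < ‖w₀‖ by linarith))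
  refine ⟨δ, hδ, max (C₁ + C₂ + C₃ + C₄) (16 * C₅ / (‖w₀‖ / 2)), ?_⟩
  filter_upwards [hC₁, hC₂, hC₃, hC₄, hU, hWlow, hray, h.lt_card, h.injective,
    h.eventually_root_im_pos] with i h1 h2 h3 h4 hUi hWi hrayi hkN hinj him w hwn hwim hne
  have hh : 0 ≤ critWeight (d i) (k i) (W i) := (Real.exp_pos _).le
  have h5 := norm_primIn_ray_sub_le (d := d i) (k := k i) (u := u i)
    (M := C₅ * critWeight (d i) (k i) (W i)) hδ.le hδ1 (by positivity) him hwim hwn hne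
    (fun s hs => by
      have hz := mul_exp_im_pos him s
      have hz0 : 0 < ‖W i * Real.exp s‖ := norm_pos_iff.2 (ne_zero_of_im_pos hz)
      have hzr : r₀ ≤ ‖W i * Real.exp s‖ := by
        rw [norm_mul_exp, hr₀]
        have : -1 ≤ s := by linarith [hs.1]
        gcongr
      have hku : k i * |u i| ≤ U₀ := by
        refine le_trans ?_ hUi
        gcongr
        omega
      have hU0 : 0 ≤ U₀ := le_trans (by positivity) hku
      have h6 := norm_resolvent_le (u := u i) hinj (by omega : k i < N i) hz
      have h7 : critWeight (d i) (k i) (W i * Real.exp s) ≤ critWeight (d i) (k i) (W i) := by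
        refine Real.exp_le_exp.2 (neg_le_neg (mul_le_mul_of_nonneg_left ?_ (Nat.cast_nonneg _)))
        have h8 := hrayi s ⟨by linarith [hs.1], by linarith [hs.2]⟩
        have h9 := mul_nonneg hκ.le (show 0 ≤ Real.exp s - 1 - s by linarith [Real.add_one_le_exp s])
        linarith
      have h10 : 0 ≤ critWeight (d i) (k i) (W i * Real.exp s) := (Real.exp_pos _).le
      calc _ ≤ Real.exp (k i * |u i| / ‖W i * Real.exp s‖) / ‖W i * Real.exp s‖ *
            critWeight (d i) (k i) (W i * Real.exp s) * ‖W i * Real.exp s‖ := by gcongr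
        _ = Real.exp (k i * |u i| / ‖W i * Real.exp s‖) *
            critWeight (d i) (k i) (W i * Real.exp s) := by field_simp
        _ ≤ _ := by rw [hC₅]; gcongr)
  -- Five pieces of the path: the ray through the root, the inner connection, the descent to u, the
  -- outer connection, the escape to infinity. Only the first is singular as w approaches the root.
  have hdecomp : contourValue (d i) (k i) (u i) w (W i * Real.exp δ) =
      (primIn (d i) (k i) (u i) w (W i * Real.exp δ) -
        primIn (d i) (k i) (u i) w (W i * Real.exp (-δ))) +
      ((primIn (d i) (k i) (u i) w (W i * Real.exp (-δ)) - primIn (d i) (k i) (u i) w ⟨u i, ε⟩) +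
      (primIn (d i) (k i) (u i) w ⟨u i, ε⟩ - primInBdry (d i) (k i) (u i) w) -
      (primOut (d i) (k i) (u i) w (W i * Real.exp δ) - primOut (d i) (k i) (u i) w ⟨u i, Λ⟩) -
      primOut (d i) (k i) (u i) w ⟨u i, Λ⟩) := by
    rw [contourValue]; ring
  have hw : w ∈ {w : ℂ | ‖w‖ = ‖W i‖ ∧ w.im ≠ 0} := ⟨hwn, hwim⟩
  rw [hdecomp]
  refine (norm_add_le_of_le h5 (norm_sub_le_of_le (norm_sub_le_of_le
    (norm_add_le_of_le (h1 w hw) (h2 w hw)) (h3 w hw)) (h4 w hw))).trans ?_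
  set h' := critWeight (d i) (k i) (W i)
  set g := √(‖W i‖ / ‖W i - w‖)
  have hg : 0 ≤ g := Real.sqrt_nonneg _
  have h11 : 16 * (C₅ * h') / ‖W i‖ * g ≤ 16 * C₅ / (‖w₀‖ / 2) * h' * g := by
    have : 16 * (C₅ * h') / ‖W i‖ ≤ 16 * (C₅ * h') / (‖w₀‖ / 2) := by gcongr
    calc _ ≤ 16 * (C₅ * h') / (‖w₀‖ / 2) * g := by gcongr
      _ = _ := by ring
  have h12 : 16 * C₅ / (‖w₀‖ / 2) * h' * g ≤
      max (C₁ + C₂ + C₃ + C₄) (16 * C₅ / (‖w₀‖ / 2)) * h' * g := by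
    have := le_max_right (C₁ + C₂ + C₃ + C₄) (16 * C₅ / (‖w₀‖ / 2))
    gcongr
  have h13 : (C₁ + C₂ + C₃ + C₄) * h' ≤
      max (C₁ + C₂ + C₃ + C₄) (16 * C₅ / (‖w₀‖ / 2)) * h' := by
    have := le_max_left (C₁ + C₂ + C₃ + C₄) (16 * C₅ / (‖w₀‖ / 2))
    gcongr
  linarith

end BulkScaling

end GelfandTsetlin

namespace GelfandTsetlin

/-! ### The kernel as an integral over a half circle -/

/-- The point with polar coordinates `R`, `θ`. -/
noncomputable def polar (R θ : ℝ) : ℂ := R * Complex.exp (θ * Complex.I)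

theorem norm_polar {R : ℝ} (hR : 0 ≤ R) (θ : ℝ) : ‖polar R θ‖ = R := by
  rw [polar, norm_mul, Complex.norm_exp_ofReal_mul_I, mul_one, Complex.norm_real,
    Real.norm_of_nonneg hR]

theorem polar_im (R θ : ℝ) : (polar R θ).im = R * Real.sin θ := by
  rw [polar, Complex.im_ofReal_mul, Complex.exp_ofReal_mul_I_im]

theorem polar_im_pos {R θ : ℝ} (hR : 0 < R) (hθ : θ ∈ Set.Ioo 0 Real.pi) : 0 < (polar R θ).im := by
  rw [polar_im]
  exact mul_pos hR (Real.sin_pos_of_mem_Ioo hθ)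

theorem polar_norm_arg (w : ℂ) : polar ‖w‖ (Complex.arg w) = w := Complex.norm_mul_exp_arg_mul_I w

theorem continuous_polar : Continuous fun p : ℝ × ℝ => polar p.1 p.2 := by
  unfold polar; fun_prop

theorem continuous_polar_right (R : ℝ) : Continuous (polar R) := by
  unfold polar; fun_prop

theorem arg_mem_Ioo {w : ℂ} (hw : 0 < w.im) : Complex.arg w ∈ Set.Ioo 0 Real.pi := by
  have h1 := Complex.arg_nonneg_iff.2 hw.le
  refine ⟨lt_of_le_of_ne h1 fun h => ?_, lt_of_le_of_ne (Complex.arg_le_pi w) fun h => ?_⟩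
  · exact hw.ne' (Complex.arg_eq_zero_iff.1 h.symm).2
  · exact hw.ne' (Complex.arg_eq_pi_iff.1 h).2

theorem polar_pow_mul_inv_pow_re {R : ℝ} (n m : ℕ) (θ : ℝ) :
    (polar R θ ^ n * (polar R θ ^ m)⁻¹).re =
      R ^ n * (R ^ m)⁻¹ * Real.cos (((n : ℝ) - m) * θ) := by
  have h1 : polar R θ ^ n * (polar R θ ^ m)⁻¹ =
      ((R ^ n * (R ^ m)⁻¹ : ℝ) : ℂ) * Complex.exp (((((n : ℝ) - m) * θ : ℝ) : ℂ) * Complex.I) := by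
    rw [polar, mul_pow, mul_pow, mul_inv, ← Complex.exp_nat_mul, ← Complex.exp_nat_mul,
      ← Complex.exp_neg]
    have : Complex.exp (((((n : ℝ) - m) * θ : ℝ) : ℂ) * Complex.I) =
        Complex.exp (n * (θ * Complex.I)) * Complex.exp (-(m * (θ * Complex.I))) := by
      rw [← Complex.exp_add]; congr 1; push_cast; ring
    rw [this]
    push_cast
    ring
  rw [h1, Complex.re_ofReal_mul, Complex.exp_ofReal_mul_I_re]

theorem integral_cos_sub_mul (n m : ℕ) :
    ∫ θ in (0 : ℝ)..Real.pi, Real.cos (((n : ℝ) - m) * θ) = if n = m then Real.pi else 0 := by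
  split_ifs with h
  · simp [h]
  · have h1 : (n : ℝ) - m ≠ 0 := sub_ne_zero.2 (by exact_mod_cast h)
    rw [intervalIntegral.integral_comp_mul_left _ h1, integral_cos]
    have h2 : Real.sin (((n : ℝ) - m) * Real.pi) = 0 := by
      have := Real.sin_int_mul_pi ((n : ℤ) - m)
      push_cast at this
      exact this
    simp [h2]

open Polynomial in
-- Coefficients are real, so real parts over the half circle suffice: they are combinations of
-- cos((n - m)θ), whose integrals over (0, π) vanish for n ≠ m.
theorem integral_polar_eq_coeff (p : ℝ[X]) (m : ℕ) {R : ℝ} (hR : 0 < R) :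
    ∫ θ in (0 : ℝ)..Real.pi, (aeval (polar R θ) p * (polar R θ ^ m)⁻¹).re =
      Real.pi * p.coeff m := by
  have h1 : ∀ θ, (aeval (polar R θ) p * (polar R θ ^ m)⁻¹).re =
      ∑ n ∈ Finset.range (p.natDegree + 1 + m),
        p.coeff n * (R ^ n * (R ^ m)⁻¹) * Real.cos (((n : ℝ) - m) * θ) := by
    intro θ
    rw [aeval_eq_sum_range' (n := p.natDegree + 1 + m) (by omega), Finset.sum_mul, Complex.re_sum]
    refine Finset.sum_congr rfl fun n _ => ?_
    rw [smul_mul_assoc, Complex.smul_re, polar_pow_mul_inv_pow_re, smul_eq_mul]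
    ring
  simp only [h1]
  rw [intervalIntegral.integral_finsetSum fun n _ =>
    (Continuous.intervalIntegrable (by fun_prop) _ _)]
  simp only [intervalIntegral.integral_const_mul, integral_cos_sub_mul]
  simp only [mul_ite, mul_zero, Finset.sum_ite_eq', Finset.mem_range]
  split_ifs with h
  · have : R ^ m ≠ 0 := by positivity
    field_simp
  · rw [coeff_eq_zero_of_natDegree_lt (by omega), mul_zero]

open Polynomial in
theorem eval_iterate_derivative_eq_integral (p : ℝ[X]) (m : ℕ) (v : ℝ) {R : ℝ} (hR : 0 < R) :
    (derivative^[m] p).eval v = m.factorial / Real.pi *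
      ∫ θ in (0 : ℝ)..Real.pi, (aeval (polar R θ + v) p * (polar R θ ^ m)⁻¹).re := by
  have h1 : ∀ z : ℂ, aeval (z + v) p = aeval z (taylor v p) := by
    intro z
    rw [taylor_apply, aeval_comp]
    simp
  simp only [h1]
  rw [integral_polar_eq_coeff _ _ hR, taylor_coeff, ← factorial_smul_hasseDeriv]
  rw [LinearMap.smul_apply, ← Nat.cast_smul_eq_nsmul ℝ, eval_smul, smul_eq_mul]
  have := Real.pi_ne_zero
  field_simp

/-- The integrand in the representation of the kernel as an integral over a half circle. -/
noncomputable def kernelIntegrand {N : ℕ} (d : Fin N → ℝ) (k : ℕ) (u : ℝ) (w : ℂ) : ℂ :=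
  (∏ j, (w - d j)) * upperResolvent d k u w * (w ^ (k + 1))⁻¹

/-- Cauchy's formula on a circle centred at v, which is why the nodes are shifted by v. The
prefactor is (k+1)! / k!, and the sum over nodes above u factors as nodal polynomial times upper
resolvent. -/
theorem kernel_eq_integral {n : ℕ} {x : Fin n → ℝ} (hx : Function.Injective x) {q k : ℕ}
    (hq : q + (k + 1) = n) (hk : k ≠ 0) (u v : ℝ) {R : ℝ} (hR : 0 < R) :
    kernel x q q u v = (k + 1) / Real.pi * ∫ θ in Set.Ioo 0 Real.pi,
      (kernelIntegrand (fun j => x j - v) k (u - v) (polar R θ)).re := by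
  rw [kernel_eq_sum hx hq u v (Or.inl hk)]
  have hint : ∀ j : Fin n, IntervalIntegrable (fun θ : ℝ => (Polynomial.aeval (polar R θ + v)
      (Lagrange.basis Finset.univ x j) * (polar R θ ^ (k + 1))⁻¹).re) volume 0 Real.pi := by
    intro j
    refine Continuous.intervalIntegrable (Complex.continuous_re.comp (Continuous.mul ?_ ?_)) _ _
    · exact (Polynomial.continuous_aeval _).comp ((continuous_polar_right R).add continuous_const)
    · refine ((continuous_polar_right R).pow _).inv₀ fun θ => pow_ne_zero _ ?_
      rw [← norm_pos_iff, norm_polar hR.le]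
      exact hR
  have h1 : ∀ j : Fin n, truncPow k (x j - u) *
      ((Polynomial.derivative^[k + 1] (Lagrange.basis Finset.univ x j)).eval v) =
      (k + 1) / Real.pi * ∫ θ in (0 : ℝ)..Real.pi, (if u < x j then (x j - u) ^ k else 0) *
        (Polynomial.aeval (polar R θ + v)
          (Lagrange.basis Finset.univ x j) * (polar R θ ^ (k + 1))⁻¹).re := by
    intro j
    rw [eval_iterate_derivative_eq_integral _ _ _ hR, intervalIntegral.integral_const_mul, truncPow]
    have : (k.factorial : ℝ) ≠ 0 := by positivity
    simp only [sub_pos]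
    split_ifs with h
    · rw [Nat.factorial_succ]
      push_cast
      field_simp
    · simp
  simp only [h1]
  rw [← Finset.mul_sum, ← intervalIntegral.integral_finsetSum fun j _ => (hint j).const_mul _,
    intervalIntegral.integral_of_le Real.pi_pos.le, integral_Ioc_eq_integral_Ioo]
  congr 1
  refine setIntegral_congr_fun measurableSet_Ioo fun θ hθ => ?_
  have him := polar_im_pos hR hθ
  simp only [kernelIntegrand]
  set w := polar R θ
  rw [upperResolvent, Finset.mul_sum, Finset.sum_mul, Complex.re_sum]
  refine Finset.sum_congr rfl fun j _ => ?_
  have hlt : (u - v < x j - v) = (u < x j) := by simp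
  simp only [hlt]
  split_ifs with h
  · rw [← Complex.re_ofReal_mul]
    congr 1
    have h2 := sub_ofReal_ne_zero him (x j - v)
    rw [aeval_lagrange_basis, nodeCoeff, Finset.prod_div_distrib,
      ← Finset.mul_prod_erase Finset.univ _ (Finset.mem_univ j)]
    have h3 : ∀ i, w + v - x i = w - ((x i - v : ℝ) : ℂ) := by intro i; push_cast; ring
    have h4 : ∀ i, x j - v - (x i - v) = x j - x i := by intro i; ring
    have h5 : x j - v - (u - v) = x j - u := by ring
    simp only [h3, h4, h5]
    push_cast at h2 ⊢
    field_simp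
  · simp

end GelfandTsetlin

/-! ### The integrand on the half circle: bounds and pointwise limit. -/

namespace GelfandTsetlin

theorem measurable_kernelIntegrand {N : ℕ} (d : Fin N → ℝ) (k : ℕ) (u : ℝ) :
    Measurable (kernelIntegrand d k u) := by
  unfold kernelIntegrand upperResolvent
  refine ((Measurable.mul (by fun_prop) ?_).mul (by fun_prop))
  refine Finset.measurable_sum _ fun j _ => ?_
  split_ifs
  · fun_prop
  · exact measurable_const

theorem abs_sub_le_two_mul_norm_polar_sub {a θ : ℝ} (ha : a ∈ Set.Ioo 0 Real.pi)
    (hθ : θ ∈ Set.Ioo 0 Real.pi) {R : ℝ} (hR : 0 < R) :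
    R * |θ - a| ≤ 2 * ‖polar R a - polar R θ‖ := by
  have h1 : polar R θ - polar R a =
      R * Complex.exp (a * Complex.I) * (Complex.exp (Complex.I * ((θ - a : ℝ) : ℂ)) - 1) := by
    have : Complex.exp (θ * Complex.I) =
        Complex.exp (a * Complex.I) * Complex.exp (Complex.I * ((θ - a : ℝ) : ℂ)) := by
      rw [← Complex.exp_add]; congr 1; push_cast; ring
    rw [polar, polar, this]
    ring
  rw [norm_sub_rev, h1, norm_mul, norm_mul, Complex.norm_exp_ofReal_mul_I, mul_one,
    Complex.norm_real, Real.norm_of_nonneg hR.le, Complex.norm_exp_I_mul_ofReal_sub_one, norm_mul,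
    Real.norm_eq_abs, Real.norm_eq_abs, abs_two]
  have h2 : |(θ - a) / 2| ≤ Real.pi / 2 := by
    rw [abs_div, abs_two]
    have : |θ - a| ≤ Real.pi := abs_le.2 ⟨by linarith [ha.2, hθ.1], by linarith [ha.1, hθ.2]⟩
    linarith
  have h3 := Real.mul_abs_le_abs_sin h2
  rw [abs_div, abs_two] at h3
  have h4 : 1 / 2 ≤ 2 / Real.pi := by
    rw [div_le_div_iff₀ two_pos Real.pi_pos]
    linarith [Real.pi_le_four]
  have h5 : 1 / 2 * (|θ - a| / 2) ≤ 2 / Real.pi * (|θ - a| / 2) := by gcongr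
  have h6 : |θ - a| ≤ 4 * |Real.sin ((θ - a) / 2)| := by linarith
  nlinarith

theorem norm_sub_le_norm_sub_conj {z w : ℂ} (hz : 0 < z.im) (hw : 0 < w.im) :
    ‖z - w‖ ≤ ‖z - starRingEnd ℂ w‖ := by
  refine le_of_sq_le_sq ?_ (norm_nonneg _)
  rw [Complex.sq_norm, Complex.sq_norm, Complex.normSq_apply, Complex.normSq_apply]
  simp only [Complex.sub_re, Complex.sub_im, Complex.conj_re, Complex.conj_im]
  nlinarith [mul_pos hz hw]

namespace BulkScaling

variable {ι : Type*} {l : Filter ι} {A B β : ℝ} {ν : Measure ℝ}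
  {N k : ι → ℕ} {d : (i : ι) → Fin (N i) → ℝ} {u : ι → ℝ} {w₀ : ℂ} {W : ι → ℂ}

/-- The contour bound is used at w and at its conjugate; the conjugate is at least as far from the
root, so the singularity of w governs both. Chord length turns it into |θ - arg W|^{-1/2}. -/
theorem exists_upperResolvent_bound [IsProbabilityMeasure ν] [l.NeBot]
    (h : BulkScaling l A B β ν N k d u w₀ W) :
    ∃ C : ℝ, 0 ≤ C ∧ ∀ᶠ i in l, ∀ θ ∈ Set.Ioo 0 Real.pi, θ ≠ Complex.arg (W i) →
      ‖upperResolvent (d i) (k i) (u i) (polar ‖W i‖ θ) - (if θ < Complex.arg (W i) then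
        resolvent (d i) (k i) (u i) (polar ‖W i‖ θ) else 0)‖ ≤
        C * critWeight (d i) (k i) (W i) * (1 + (√|θ - Complex.arg (W i)|)⁻¹) := by
  obtain ⟨δ, hδ, C, hC⟩ := h.exists_contourValue_bound
  refine ⟨2 * |C|, by positivity, ?_⟩
  have hu : ∀ᶠ i in l, |u i| < ‖W i‖ := by
    have := h.tendsto_u.abs.eventually_lt h.tendsto_root.norm (by rw [abs_zero]; exact h.norm_pos)
    exact this
  filter_upwards [hC, hu, h.eventually_root_im_pos] with i hCi hui him θ hθ hne
  have hR : 0 < ‖W i‖ := norm_pos_iff.2 (ne_zero_of_im_pos him)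
  have ha := arg_mem_Ioo him
  set a := Complex.arg (W i) with hadef
  set R := ‖W i‖ with hRdef
  have hW : W i = polar R a := (polar_norm_arg (W i)).symm
  set w := polar R θ with hwdef
  have hwn : ‖w‖ = R := norm_polar hR.le θ
  have hwim : 0 < w.im := polar_im_pos hR hθ
  have hθa : 0 < |θ - a| := abs_pos.2 (sub_ne_zero.2 hne)
  have hdist : R * |θ - a| ≤ 2 * ‖W i - w‖ := by
    rw [hW]; exact abs_sub_le_two_mul_norm_polar_sub ha hθ hR
  have hWw : 0 < ‖W i - w‖ := by
    have : 0 < R * |θ - a| := by positivity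
    linarith
  have hWne : w ≠ W i := fun h => by rw [h, sub_self, norm_zero] at hWw; exact lt_irrefl _ hWw
  have hconj := norm_sub_le_norm_sub_conj him hwim
  have hcne : starRingEnd ℂ w ≠ W i := fun h => by
    rw [h, sub_self, norm_zero] at hconj; linarith
  have h0 : 0 ≤ critWeight (d i) (k i) (W i) := (Real.exp_pos _).le
  have hsq : ∀ y : ℝ, ‖W i - w‖ ≤ y → √(R / y) ≤ 2 * (√|θ - a|)⁻¹ := by
    intro y hy
    have hy0 : 0 < y := hWw.trans_le hy
    rw [← Real.sqrt_inv]
    have h2 : (2 : ℝ) = √4 := by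
      rw [show (4 : ℝ) = 2 ^ 2 by norm_num, Real.sqrt_sq zero_le_two]
    rw [h2, ← Real.sqrt_mul (by norm_num)]
    refine Real.sqrt_le_sqrt ?_
    rw [div_le_iff₀ hy0, mul_assoc, inv_mul_eq_div, ← mul_div_assoc, le_div_iff₀ hθa]
    linarith
  have hval : ∀ y : ℂ, ‖y‖ = R → y.im ≠ 0 → y ≠ W i → ‖W i - w‖ ≤ ‖W i - y‖ →
      ‖contourValue (d i) (k i) (u i) y (W i * Real.exp δ)‖ ≤
        2 * |C| * critWeight (d i) (k i) (W i) * (1 + (√|θ - a|)⁻¹) := by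
    intro y hy1 hy2 hy3 hy4
    have h1 := hCi y hy1 hy2 hy3
    have h2 := hsq _ hy4
    have h3 : 0 ≤ (√|θ - a|)⁻¹ := by positivity
    have h4 : C * critWeight (d i) (k i) (W i) ≤ |C| * critWeight (d i) (k i) (W i) := by
      gcongr
      exact le_abs_self C
    have h5 : 0 ≤ √(R / ‖W i - y‖) := Real.sqrt_nonneg _
    have h6 : 0 ≤ |C| * critWeight (d i) (k i) (W i) := by positivity
    calc _ ≤ C * critWeight (d i) (k i) (W i) * (1 + √(R / ‖W i - y‖)) := h1
      _ ≤ |C| * critWeight (d i) (k i) (W i) * (1 + √(R / ‖W i - y‖)) := by gcongr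
      _ ≤ |C| * critWeight (d i) (k i) (W i) * (1 + 2 * (√|θ - a|)⁻¹) := by gcongr
      _ ≤ |C| * critWeight (d i) (k i) (W i) * (2 * (1 + (√|θ - a|)⁻¹)) := by
        gcongr
        linarith
      _ = _ := by ring
  have hz : W i * Real.exp δ = ((R * Real.exp δ : ℝ) : ℂ) * Complex.exp (a * Complex.I) := by
    conv_lhs => rw [hW, polar]
    push_cast
    ring
  have h1 := hval w hwn hwim.ne' hWne le_rfl
  have h2 := hval (starRingEnd ℂ w) (by rw [RCLike.norm_conj, hwn])
    (by rw [Complex.conj_im]; exact neg_ne_zero.2 hwim.ne') hcne hconj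
  rw [hz] at h1 h2
  exact norm_upperResolvent_sub_le hR
    (lt_mul_of_one_lt_right hR (Real.one_lt_exp_iff.2 hδ)) ha hθ hui h1 h2

/-- The integrand, up to an error which is integrable and small away from the critical point, is
elementary. -/
theorem exists_kernelIntegrand_bound [IsProbabilityMeasure ν] [l.NeBot]
    (h : BulkScaling l A B β ν N k d u w₀ W) :
    ∃ C : ℝ, 0 ≤ C ∧ ∀ᶠ i in l, ∀ θ ∈ Set.Ioo 0 Real.pi, θ ≠ Complex.arg (W i) →
      ‖kernelIntegrand (d i) (k i) (u i) (polar ‖W i‖ θ) - (if θ < Complex.arg (W i) then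
        (polar ‖W i‖ θ - u i) ^ k i * (polar ‖W i‖ θ ^ (k i + 1))⁻¹ else 0)‖ ≤
        C * Real.exp (N i * (pot (d i) (k i + 1) (polar ‖W i‖ θ) - pot (d i) (k i + 1) (W i))) *
          (1 + (√|θ - Complex.arg (W i)|)⁻¹) := by
  obtain ⟨C, hC0, hC⟩ := h.exists_upperResolvent_bound
  refine ⟨C, hC0, ?_⟩
  filter_upwards [hC, h.eventually_root_im_pos, h.lt_card, h.injective] with i hCi him hk hinj θ hθ hne
  have hR : 0 < ‖W i‖ := norm_pos_iff.2 (ne_zero_of_im_pos him)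
  have hwim := polar_im_pos hR hθ
  have h1 := hCi θ hθ hne
  set w := polar ‖W i‖ θ
  have hP : ∏ j, (w - (d i j : ℂ)) ≠ 0 :=
    Finset.prod_ne_zero_iff.2 fun j _ => sub_ofReal_ne_zero hwim _
  have h2 : kernelIntegrand (d i) (k i) (u i) w - (if θ < Complex.arg (W i) then
        (w - u i) ^ k i * (w ^ (k i + 1))⁻¹ else 0) =
      (∏ j, (w - d i j)) * (w ^ (k i + 1))⁻¹ * (upperResolvent (d i) (k i) (u i) w -
        (if θ < Complex.arg (W i) then resolvent (d i) (k i) (u i) w else 0)) := by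
    rw [kernelIntegrand]
    split_ifs
    · rw [resolvent_eq hinj (by omega) hwim.ne']
      field_simp
    · ring
  rw [h2, norm_mul, norm_mul, norm_inv, norm_pow, ← div_eq_mul_inv,
    ← exp_card_mul_pot (d i) (k i + 1) (by omega) hwim]
  refine (mul_le_mul_of_nonneg_left h1 (Real.exp_pos _).le).trans (le_of_eq ?_)
  rw [critWeight, mul_sub, Real.exp_sub, Real.exp_neg]
  ring

theorem eventually_pot_polar_le (h : BulkScaling l A B β ν N k d u w₀ W) :
    ∀ᶠ i in l, ∀ θ ∈ Set.Ioo 0 Real.pi,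
      Real.exp (N i * (pot (d i) (k i + 1) (polar ‖W i‖ θ) - pot (d i) (k i + 1) (W i))) ≤ 1 := by
  filter_upwards [h.eventually_root_im_pos, h.crit_root, h.lt_card] with i him hcrit hk θ hθ
  have hR : 0 < ‖W i‖ := norm_pos_iff.2 (ne_zero_of_im_pos him)
  have hN : 0 < N i := by omega
  have hwn := norm_polar hR.le θ
  rw [mul_sub, Real.exp_sub, exp_card_mul_pot _ _ hN (polar_im_pos hR hθ),
    exp_card_mul_pot _ _ hN him, hwn]
  refine div_le_one_of_le₀ ?_ (by positivity)
  gcongr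
  exact norm_prod_sub_le_of_norm_eq him hcrit hwn

theorem tendsto_arg (h : BulkScaling l A B β ν N k d u w₀ W) :
    Tendsto (fun i => Complex.arg (W i)) l (𝓝 (Complex.arg w₀)) :=
  (Complex.continuousAt_arg (mem_slitPlane_of_im_pos h.isCritical.im_pos)).tendsto.comp
    h.tendsto_root

theorem tendsto_polar_shift (h : BulkScaling l A B β ν N k d u w₀ W) (s : ℝ) :
    Tendsto (fun i => polar ‖W i‖ (Complex.arg (W i) + s)) l
      (𝓝 (polar ‖w₀‖ (Complex.arg w₀ + s))) :=
  (continuous_polar.tendsto (‖w₀‖, Complex.arg w₀ + s)).comp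
    (h.tendsto_root.norm.prodMk_nhds (h.tendsto_arg.add_const s))

theorem tendsto_exp_pot_polar [IsProbabilityMeasure ν] (h : BulkScaling l A B β ν N k d u w₀ W)
    {s : ℝ} (hs : s ≠ 0) (hsθ : Complex.arg w₀ + s ∈ Set.Ioo 0 Real.pi) :
    Tendsto (fun i => Real.exp (N i * (pot (d i) (k i + 1)
      (polar ‖W i‖ (Complex.arg (W i) + s)) - pot (d i) (k i + 1) (W i)))) l (𝓝 0) := by
  have him := polar_im_pos h.norm_pos hsθ
  have hne : polar ‖w₀‖ (Complex.arg w₀ + s) ≠ w₀ := by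
    intro heq
    have h1 := arg_mem_Ioo h.isCritical.im_pos
    have h2 := abs_sub_le_two_mul_norm_polar_sub h1 hsθ h.norm_pos
    rw [polar_norm_arg, heq, sub_self, norm_zero, mul_zero, add_sub_cancel_left] at h2
    have := mul_pos h.norm_pos (abs_pos.2 hs)
    linarith
  have hlt := h.isCritical.limPot_lt h.measure_compl h.ne_dirac him
    (norm_polar (norm_nonneg _) _) hne
  have h1 := (h.scaling.tendsto_pot_comp him (h.tendsto_polar_shift s)).sub h.tendsto_pot_root
  exact Real.tendsto_exp_atBot.comp
    ((tendsto_natCast_atTop_atTop.comp h.scaling.tendsto_card).atTop_mul_neg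
      (sub_neg.2 hlt) h1)

/-- This is (1 - u/w)^k / w with k u → κ. The second-order term of the logarithm contributes k
|u/w|², which vanishes in the limit. -/
theorem tendsto_pow_main (h : BulkScaling l A B β ν N k d u w₀ W) {κ : ℝ}
    (hκ : Tendsto (fun i => (k i : ℝ) * u i) l (𝓝 κ)) {w : ι → ℂ} {z : ℂ} (hz : z ≠ 0)
    (hw : Tendsto w l (𝓝 z)) :
    Tendsto (fun i => (w i - u i) ^ k i * (w i ^ (k i + 1))⁻¹) l
      (𝓝 (z⁻¹ * Complex.exp (-(κ / z)))) := by
  have hu : Tendsto (fun i => (u i : ℂ)) l (𝓝 0) := by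
    have := (Complex.continuous_ofReal.tendsto 0).comp h.tendsto_u
    simpa [Function.comp_def] using this
  have hx : Tendsto (fun i => -((u i : ℂ) / w i)) l (𝓝 0) := by
    simpa using (hu.div hw hz).neg
  have hkx : Tendsto (fun i => (k i : ℂ) * -((u i : ℂ) / w i)) l (𝓝 (-(κ / z))) := by
    have h1 := (((Complex.continuous_ofReal.tendsto κ).comp hκ).div hw hz).neg
    refine h1.congr fun i => ?_
    change -((((k i : ℝ) * u i : ℝ) : ℂ) / w i) = _
    push_cast
    ring
  have herr : Tendsto (fun i => (k i : ℂ) * (Complex.log (1 + -((u i : ℂ) / w i)) -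
      -((u i : ℂ) / w i))) l (𝓝 0) := by
    have h2 := (hkx.norm.mul hx.norm)
    rw [norm_zero, mul_zero] at h2
    refine squeeze_zero_norm' ?_ h2
    have h3 := hx.norm.eventually (gt_mem_nhds (show ‖(0 : ℂ)‖ < 1 / 2 by rw [norm_zero]; norm_num))
    filter_upwards [h3] with i hi
    set y := -((u i : ℂ) / w i)
    have h4 := Complex.norm_log_one_add_sub_self_le (z := y) (by linarith)
    have h5 : (1 - ‖y‖)⁻¹ ≤ 2 := by
      rw [inv_le_comm₀ (by linarith) two_pos]; linarith
    rw [norm_mul, norm_mul, mul_assoc]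
    gcongr
    calc _ ≤ ‖y‖ ^ 2 * (1 - ‖y‖)⁻¹ / 2 := h4
      _ ≤ ‖y‖ ^ 2 * 2 / 2 := by gcongr
      _ = ‖y‖ * ‖y‖ := by ring
  have hsum := hkx.add herr
  rw [add_zero] at hsum
  have hlim := (hw.inv₀ hz).mul ((Complex.continuous_exp.tendsto _).comp hsum)
  refine hlim.congr' ?_
  have h3 := hx.norm.eventually (gt_mem_nhds (show ‖(0 : ℂ)‖ < 1 by rw [norm_zero]; norm_num))
  filter_upwards [h3, hw.eventually_ne hz] with i hi hwi
  have h4 : (1 : ℂ) + -((u i : ℂ) / w i) ≠ 0 := by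
    intro h5
    have h6 : -((u i : ℂ) / w i) = -1 := by linear_combination h5
    rw [h6, norm_neg, norm_one] at hi
    exact lt_irrefl _ hi
  simp only [Function.comp_apply]
  have h7 : (k i : ℂ) * -((u i : ℂ) / w i) + (k i : ℂ) *
      (Complex.log (1 + -((u i : ℂ) / w i)) - -((u i : ℂ) / w i)) =
      (k i : ℂ) * Complex.log (1 + -((u i : ℂ) / w i)) := by ring
  rw [h7, Complex.exp_nat_mul, Complex.exp_log h4]
  have h8 : w i - u i = w i * (1 + -((u i : ℂ) / w i)) := by field_simp; ring
  rw [h8, mul_pow, pow_succ]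
  field_simp

end BulkScaling

end GelfandTsetlin

/-! ### Dominated convergence and the limiting integral. -/

namespace GelfandTsetlin

theorem integrableOn_inv_sqrt_abs (T : ℝ) :
    IntegrableOn (fun s : ℝ => (√|s|)⁻¹) (Set.Icc (-T) T) := by
  rcases lt_or_ge T 0 with hT | hT
  · rw [Set.Icc_eq_empty (by linarith)]
    exact integrableOn_empty
  have h1 : IntervalIntegrable (fun s : ℝ => (√|s|)⁻¹) volume 0 T := by
    refine (intervalIntegral.intervalIntegrable_rpow' (r := -(1 / 2)) (by norm_num)).congr ?_
    intro s hs
    rw [Set.uIoc_of_le hT] at hs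
    simp only
    rw [abs_of_pos hs.1, Real.sqrt_eq_rpow, Real.rpow_neg hs.1.le]
  have h2 : IntervalIntegrable (fun s : ℝ => (√|s|)⁻¹) volume (-T) 0 := by
    have h3 := ((IntervalIntegrable.iff_comp_neg (by simp)).1 h1).symm
    simpa using h3
  have h3 := h2.trans h1
  rwa [intervalIntegrable_iff_integrableOn_Icc_of_le (by linarith)] at h3

theorem norm_pow_main_le {w : ℂ} (hw : w ≠ 0) (u : ℝ) (k : ℕ) :
    ‖(w - u) ^ k * (w ^ (k + 1))⁻¹‖ ≤ Real.exp (k * |u| / ‖w‖) / ‖w‖ := by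
  have hR : 0 < ‖w‖ := norm_pos_iff.2 hw
  have h1 : (w - u) ^ k * (w ^ (k + 1))⁻¹ = (1 - u / w) ^ k / w := by
    rw [show (1 : ℂ) - u / w = (w - u) / w by field_simp, div_pow, pow_succ]
    field_simp
  have h2 : ‖1 - (u : ℂ) / w‖ ≤ Real.exp (|u| / ‖w‖) := by
    refine (norm_sub_le _ _).trans ?_
    rw [norm_one, norm_div, Complex.norm_real, Real.norm_eq_abs]
    linarith [Real.add_one_le_exp (|u| / ‖w‖)]
  rw [h1, norm_div, norm_pow, mul_div_assoc, Real.exp_nat_mul]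
  gcongr

/-- The limit of the integrand on the half circle through the critical point. -/
noncomputable def limitIntegrand (κ : ℝ) (z : ℂ) : ℝ := (z⁻¹ * Complex.exp (-(κ / z))).re

namespace BulkScaling

variable {ι : Type*} {l : Filter ι} {A B β : ℝ} {ν : Measure ℝ}
  {N k : ι → ℕ} {d : (i : ι) → Fin (N i) → ℝ} {u : ι → ℝ} {w₀ : ℂ} {W : ι → ℂ}

theorem exists_norm_kernelIntegrand_le [IsProbabilityMeasure ν] [l.NeBot]
    (h : BulkScaling l A B β ν N k d u w₀ W) :
    ∃ C D : ℝ, 0 ≤ C ∧ 0 ≤ D ∧ ∀ᶠ i in l, ∀ θ ∈ Set.Ioo 0 Real.pi, θ ≠ Complex.arg (W i) →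
      ‖kernelIntegrand (d i) (k i) (u i) (polar ‖W i‖ θ)‖ ≤
        C * (1 + (√|θ - Complex.arg (W i)|)⁻¹) + D := by
  obtain ⟨C, hC0, hC⟩ := h.exists_kernelIntegrand_bound
  obtain ⟨U₀, hU⟩ := h.bound
  have hlim : Tendsto (fun i => Real.exp (U₀ / ‖W i‖) / ‖W i‖) l
      (𝓝 (Real.exp (U₀ / ‖w₀‖) / ‖w₀‖)) :=
    ((Real.continuous_exp.tendsto _).comp
      (tendsto_const_nhds.div h.tendsto_root.norm h.norm_pos.ne')).div h.tendsto_root.norm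
      h.norm_pos.ne'
  refine ⟨C, Real.exp (U₀ / ‖w₀‖) / ‖w₀‖ + 1, hC0, by positivity, ?_⟩
  filter_upwards [hC, hU, h.eventually_pot_polar_le, h.eventually_root_im_pos, h.lt_card,
    hlim.eventually (gt_mem_nhds (lt_add_one _))] with i hCi hUi hpot him hk hD θ hθ hne
  have hR : 0 < ‖W i‖ := norm_pos_iff.2 (ne_zero_of_im_pos him)
  have h1 := hCi θ hθ hne
  have h2 := hpot θ hθ
  have hw := ne_zero_of_im_pos (polar_im_pos hR hθ)
  have h3 := norm_pow_main_le hw (u i) (k i)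
  rw [norm_polar hR.le] at h3
  have h4 : Real.exp (k i * |u i| / ‖W i‖) / ‖W i‖ ≤ Real.exp (U₀ / ‖W i‖) / ‖W i‖ := by
    gcongr
    refine le_trans ?_ hUi
    gcongr
    omega
  have h5 : ‖if θ < Complex.arg (W i) then
        (polar ‖W i‖ θ - u i) ^ k i * (polar ‖W i‖ θ ^ (k i + 1))⁻¹ else 0‖ ≤
      Real.exp (U₀ / ‖w₀‖) / ‖w₀‖ + 1 := by
    split_ifs
    · linarith
    · rw [norm_zero]
      positivity
  have h6 := norm_le_norm_sub_add (kernelIntegrand (d i) (k i) (u i) (polar ‖W i‖ θ))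
    (if θ < Complex.arg (W i) then
        (polar ‖W i‖ θ - u i) ^ k i * (polar ‖W i‖ θ ^ (k i + 1))⁻¹ else 0)
  refine h6.trans (add_le_add (h1.trans ?_) h5)
  have h7 : 0 ≤ 1 + (√|θ - Complex.arg (W i)|)⁻¹ := by positivity
  exact mul_le_mul_of_nonneg_right (mul_le_of_le_one_right hC0 h2) h7

theorem tendsto_kernelIntegrand [IsProbabilityMeasure ν] [l.NeBot]
    (h : BulkScaling l A B β ν N k d u w₀ W) {κ : ℝ}
    (hκ : Tendsto (fun i => (k i : ℝ) * u i) l (𝓝 κ)) {s : ℝ} (hs : s ≠ 0)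
    (hsθ : Complex.arg w₀ + s ∈ Set.Ioo 0 Real.pi) :
    Tendsto (fun i => kernelIntegrand (d i) (k i) (u i)
      (polar ‖W i‖ (Complex.arg (W i) + s))) l
      (𝓝 (if s < 0 then (polar ‖w₀‖ (Complex.arg w₀ + s))⁻¹ *
        Complex.exp (-(κ / polar ‖w₀‖ (Complex.arg w₀ + s))) else 0)) := by
  obtain ⟨C, hC0, hC⟩ := h.exists_kernelIntegrand_bound
  have hev : ∀ᶠ i in l, Complex.arg (W i) + s ∈ Set.Ioo 0 Real.pi :=
    (h.tendsto_arg.add_const s).eventually (isOpen_Ioo.mem_nhds hsθ)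
  have herr : Tendsto (fun i => kernelIntegrand (d i) (k i) (u i)
      (polar ‖W i‖ (Complex.arg (W i) + s)) - (if s < 0 then
        (polar ‖W i‖ (Complex.arg (W i) + s) - u i) ^ k i *
          (polar ‖W i‖ (Complex.arg (W i) + s) ^ (k i + 1))⁻¹ else 0)) l (𝓝 0) := by
    have h1 := ((h.tendsto_exp_pot_polar hs hsθ).const_mul C).mul_const (1 + (√|s|)⁻¹)
    rw [mul_zero, zero_mul] at h1
    refine squeeze_zero_norm' ?_ h1
    filter_upwards [hC, hev] with i hCi hi
    have h2 := hCi _ hi (by simpa using hs)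
    simp only [add_sub_cancel_left, add_lt_iff_neg_left] at h2
    exact h2
  have hmain : Tendsto (fun i => if s < 0 then
        (polar ‖W i‖ (Complex.arg (W i) + s) - u i) ^ k i *
          (polar ‖W i‖ (Complex.arg (W i) + s) ^ (k i + 1))⁻¹ else 0) l
      (𝓝 (if s < 0 then (polar ‖w₀‖ (Complex.arg w₀ + s))⁻¹ *
        Complex.exp (-(κ / polar ‖w₀‖ (Complex.arg w₀ + s))) else 0)) := by
    split_ifs
    · exact h.tendsto_pow_main hκ (ne_zero_of_im_pos (polar_im_pos h.norm_pos hsθ))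
        (h.tendsto_polar_shift s)
    · exact tendsto_const_nhds
  have := herr.add hmain
  simpa using this

theorem tendsto_integral_kernelIntegrand [IsProbabilityMeasure ν] [l.NeBot]
    [l.IsCountablyGenerated]
    (h : BulkScaling l A B β ν N k d u w₀ W) {κ : ℝ}
    (hκ : Tendsto (fun i => (k i : ℝ) * u i) l (𝓝 κ)) :
    Tendsto (fun i => ∫ θ in Set.Ioo 0 Real.pi,
      (kernelIntegrand (d i) (k i) (u i) (polar ‖W i‖ θ)).re) l
      (𝓝 (∫ θ in Set.Ioo 0 (Complex.arg w₀), limitIntegrand κ (polar ‖w₀‖ θ))) := by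
  obtain ⟨C, D, hC0, hD0, hCD⟩ := h.exists_norm_kernelIntegrand_le
  have ha := arg_mem_Ioo h.isCritical.im_pos
  -- Measuring the angle from arg W keeps the singularity at s = 0 for every index, so a single
  -- function dominates.
  have hshift : ∀ (a T : ℝ) (f : ℝ → ℝ), ∫ θ in Set.Ioo 0 T, f θ =
      ∫ s, (Set.Ioo 0 T).indicator f (a + s) := fun a T f => by
    rw [integral_add_left_eq_self, integral_indicator measurableSet_Ioo]
  rw [hshift (Complex.arg w₀)]
  have heq : (fun i => ∫ θ in Set.Ioo 0 Real.pi,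
      (kernelIntegrand (d i) (k i) (u i) (polar ‖W i‖ θ)).re) = fun i =>
      ∫ s, (Set.Ioo 0 Real.pi).indicator
        (fun θ => (kernelIntegrand (d i) (k i) (u i) (polar ‖W i‖ θ)).re)
        (Complex.arg (W i) + s) := by
    funext i
    exact hshift (Complex.arg (W i)) _ _
  rw [heq]
  refine tendsto_integral_filter_of_dominated_convergence
    ((Set.Icc (-Real.pi) Real.pi).indicator fun s => C * (1 + (√|s|)⁻¹) + D) ?_ ?_ ?_ ?_
  · refine Eventually.of_forall fun i => Measurable.aestronglyMeasurable ?_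
    refine Measurable.comp (g := (Set.Ioo 0 Real.pi).indicator
      (fun θ => (kernelIntegrand (d i) (k i) (u i) (polar ‖W i‖ θ)).re)) ?_ (by fun_prop)
    exact (Complex.measurable_re.comp ((measurable_kernelIntegrand _ _ _).comp
      (continuous_polar_right _).measurable)).indicator measurableSet_Ioo
  · filter_upwards [hCD, h.eventually_root_im_pos] with i hi him
    have h0 : ∀ᵐ s : ℝ, s ≠ 0 := Measure.ae_ne volume 0
    filter_upwards [h0] with s hs
    have hai := arg_mem_Ioo him
    by_cases hm : Complex.arg (W i) + s ∈ Set.Ioo 0 Real.pi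
    · have h1 := hi _ hm (by simpa using hs)
      rw [add_sub_cancel_left] at h1
      rw [Set.indicator_of_mem hm, Set.indicator_of_mem
        (by constructor <;> linarith [hm.1, hm.2, hai.1, hai.2])]
      exact (Complex.abs_re_le_norm _).trans h1
    · rw [Set.indicator_of_notMem hm, norm_zero]
      exact Set.indicator_nonneg (fun s _ => by positivity) s
  · rw [integrable_indicator_iff measurableSet_Icc]
    have h1 : IntegrableOn (fun _ : ℝ => (1 : ℝ)) (Set.Icc (-Real.pi) Real.pi) :=
      continuous_const.integrableOn_Icc
    have h2 : IntegrableOn (fun _ : ℝ => D) (Set.Icc (-Real.pi) Real.pi) :=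
      continuous_const.integrableOn_Icc
    exact ((h1.add (integrableOn_inv_sqrt_abs _)).const_mul C).add h2
  · have h0 : ∀ᵐ s : ℝ, s ≠ 0 := Measure.ae_ne volume 0
    -- At these two values of s the angle is an endpoint of (0, π), and the moving indicator need
    -- not converge.
    have h1 : ∀ᵐ s : ℝ, s ≠ -Complex.arg w₀ := Measure.ae_ne volume _
    have h2 : ∀ᵐ s : ℝ, s ≠ Real.pi - Complex.arg w₀ := Measure.ae_ne volume _
    filter_upwards [h0, h1, h2] with s hs0 hs1 hs2
    have hT := h.tendsto_arg.add_const s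
    by_cases hm : Complex.arg w₀ + s ∈ Set.Ioo 0 Real.pi
    · have h3 := (Complex.continuous_re.tendsto _).comp (h.tendsto_kernelIntegrand hκ hs0 hm)
      have h4 : (Set.Ioo 0 (Complex.arg w₀)).indicator
          (fun θ => limitIntegrand κ (polar ‖w₀‖ θ)) (Complex.arg w₀ + s) =
          (if s < 0 then (polar ‖w₀‖ (Complex.arg w₀ + s))⁻¹ *
            Complex.exp (-(κ / polar ‖w₀‖ (Complex.arg w₀ + s))) else 0).re := by
        simp only [Set.indicator_apply, Set.mem_Ioo, hm.1, true_and, add_lt_iff_neg_left]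
        split_ifs
        · rfl
        · rfl
      rw [h4]
      refine h3.congr' ?_
      filter_upwards [hT.eventually (isOpen_Ioo.mem_nhds hm)] with i hi
      exact (Set.indicator_of_mem (s := Set.Ioo 0 Real.pi) hi fun θ =>
        (kernelIntegrand (d i) (k i) (u i) (polar ‖W i‖ θ)).re).symm
    · have hm2 : Complex.arg w₀ + s ∉ Set.Ioo 0 (Complex.arg w₀) := fun hm' =>
        hm ⟨hm'.1, hm'.2.trans ha.2⟩
      rw [Set.indicator_of_notMem hm2]
      have hout : Complex.arg w₀ + s ∈ (Set.Icc 0 Real.pi)ᶜ := by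
        intro hm'
        refine hm ⟨lt_of_le_of_ne hm'.1 fun he => hs1 (by linarith),
          lt_of_le_of_ne hm'.2 fun he => hs2 (by linarith)⟩
      refine tendsto_const_nhds.congr' ?_
      filter_upwards [hT.eventually (isClosed_Icc.isOpen_compl.mem_nhds hout)] with i hi
      rw [Set.indicator_of_notMem fun hm' => hi (Set.Ioo_subset_Icc_self hm')]

end BulkScaling

/-- Differentiating exp(-κ/z) in the angle gives iκ z^{-1} exp(-κ/z), so the integrand is the
derivative of Im exp(-κ/z) / κ. At angle 0 the exponential is real and only the end w contributes.
For κ = 0 the primitive is -Im z^{-1}. -/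
theorem integral_limitIntegrand {w : ℂ} (hw : 0 < w.im) (κ : ℝ) :
    ∫ θ in Set.Ioo 0 (Complex.arg w), limitIntegrand κ (polar ‖w‖ θ) =
      -(Real.exp (-(κ * (w⁻¹).re)) * (w⁻¹).im * Real.sinc (κ * (w⁻¹).im)) := by
  have hR : 0 < ‖w‖ := norm_pos_iff.2 (ne_zero_of_im_pos hw)
  have ha := arg_mem_Ioo hw
  have hz : ∀ θ, polar ‖w‖ θ ≠ 0 := fun θ => by
    rw [← norm_pos_iff, norm_polar hR.le]; exact hR
  have hcont : Continuous fun θ => (polar ‖w‖ θ)⁻¹ := (continuous_polar_right _).inv₀ hz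
  have hci : Continuous fun θ => limitIntegrand κ (polar ‖w‖ θ) := by
    simp only [limitIntegrand, div_eq_mul_inv]
    exact Complex.continuous_re.comp (hcont.mul (Complex.continuous_exp.comp
      (continuous_const.mul hcont).neg))
  have hpol : ∀ θ : ℝ, HasDerivAt (fun θ : ℝ => (polar ‖w‖ θ)⁻¹)
      (-(Complex.I * (polar ‖w‖ θ)⁻¹)) θ := fun θ => by
    have h1 : HasDerivAt (polar ‖w‖) (polar ‖w‖ θ * Complex.I) θ := by
      have h2 : HasDerivAt (fun θ : ℝ => (θ : ℂ) * Complex.I) (1 * Complex.I) θ :=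
        (Complex.ofRealCLM.hasDerivAt (x := θ)).mul_const Complex.I
      exact (h2.cexp.const_mul (‖w‖ : ℂ)).congr_deriv (by rw [polar]; ring)
    refine (h1.fun_inv (hz θ)).congr_deriv ?_
    have := hz θ
    field_simp
  rw [← integral_Ioc_eq_integral_Ioo, ← intervalIntegral.integral_of_le ha.1.le]
  rcases eq_or_ne κ 0 with rfl | hκ
  · have h1 : ∀ θ ∈ Set.uIcc 0 (Complex.arg w), HasDerivAt (fun θ => -((polar ‖w‖ θ)⁻¹).im)
        (limitIntegrand 0 (polar ‖w‖ θ)) θ := fun θ _ => by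
      have h2 := (Complex.imCLM.hasFDerivAt.comp_hasDerivAt θ (hpol θ)).neg
      refine h2.congr_deriv ?_
      simp [limitIntegrand]
    rw [intervalIntegral.integral_eq_sub_of_hasDerivAt h1 (hci.intervalIntegrable _ _),
      polar_norm_arg]
    simp [polar]
  · have h1 : ∀ θ ∈ Set.uIcc 0 (Complex.arg w), HasDerivAt
        (fun θ => κ⁻¹ * (Complex.exp (-(κ * (polar ‖w‖ θ)⁻¹))).im)
        (limitIntegrand κ (polar ‖w‖ θ)) θ := fun θ _ => by
      have h2 := (Complex.imCLM.hasFDerivAt.comp_hasDerivAt θ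
        ((hpol θ).const_mul (κ : ℂ)).fun_neg.cexp).const_mul κ⁻¹
      refine h2.congr_deriv ?_
      rw [limitIntegrand, div_eq_mul_inv, Complex.imCLM_apply]
      have h3 : Complex.exp (-(κ * (polar ‖w‖ θ)⁻¹)) * -(κ * -(Complex.I * (polar ‖w‖ θ)⁻¹)) =
        κ * (Complex.I * ((polar ‖w‖ θ)⁻¹ * Complex.exp (-(κ * (polar ‖w‖ θ)⁻¹)))) := by ring
      rw [h3, Complex.im_ofReal_mul, Complex.I_mul_im]
      field_simp
    rw [intervalIntegral.integral_eq_sub_of_hasDerivAt h1 (hci.intervalIntegrable _ _),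
      polar_norm_arg]
    have h4 : polar ‖w‖ 0 = ‖w‖ := by simp [polar]
    have h5 : (-((κ : ℂ) * (‖w‖ : ℂ)⁻¹)) = ((-(κ * ‖w‖⁻¹) : ℝ) : ℂ) := by push_cast; ring
    have hwi : (w⁻¹).im ≠ 0 := by
      rw [Complex.inv_im]
      exact div_ne_zero (neg_ne_zero.2 hw.ne') (Complex.normSq_pos.2 (ne_zero_of_im_pos hw)).ne'
    rw [h4, h5, Complex.exp_ofReal_im, Complex.exp_im, Real.sinc_of_ne_zero (mul_ne_zero hκ hwi)]
    simp only [Complex.neg_re, Complex.neg_im, Complex.re_ofReal_mul, Complex.im_ofReal_mul,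
      Real.sin_neg]
    generalize (w⁻¹).im = y at hwi ⊢
    field_simp
    simp

end GelfandTsetlin

/-! ### From empirical measures to the rescaled kernel. -/

namespace GelfandTsetlin

/-- Recentres at a moving point v_i → c; the margin 1 in the interval absorbs v_i - c. Reindexing
along g lets the index carry the spatial variables as well. -/
theorem Scaling.comp_sub {ι ι' : Type*} {l : Filter ι} {l' : Filter ι'} {A B β : ℝ}
    {μ : Measure ℝ} {N m : ι → ℕ} {d : (i : ι) → Fin (N i) → ℝ} (h : Scaling l A B β μ N m d)
    {g : ι' → ι} (hg : Tendsto g l' l) {v : ι' → ℝ} {c : ℝ} (hv : Tendsto v l' (𝓝 c)) :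
    Scaling l' (A - c - 1) (B - c + 1) β (μ.map fun t => t - c) (fun i => N (g i))
      (fun i => m (g i)) (fun i j => d (g i) j - v i) where
  tendsto_card := h.tendsto_card.comp hg
  tendsto_ratio := h.tendsto_ratio.comp hg
  mem_Icc := by
    filter_upwards [hg.eventually h.mem_Icc, hv.eventually (Metric.ball_mem_nhds c one_pos)]
      with i hi hvi j
    have h1 := hi j
    rw [Real.dist_eq, abs_lt] at hvi
    constructor <;> linarith [h1.1, h1.2, hvi.1, hvi.2]
  tendsto_avg_real f hf := by
    have h1 := h.tendsto_avg_param (φ := fun y t => f (t - y)) (y := c)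
      (L := ∫ t, f (t - c) ∂μ) (fun t _ => Continuous.continuousAt (by
        unfold Function.uncurry; fun_prop)) (h.tendsto_avg_real _ (by fun_prop))
    rw [integral_map (by fun_prop) hf.aestronglyMeasurable]
    have h2 := h1.comp (hg.prodMk hv)
    simp only [Function.comp_def] at h2
    exact h2

theorem integral_empiricalMeasure {n : ℕ} (x : Fin n → ℝ) (f : ℝ → ℝ) :
    ∫ t, f t ∂(empiricalMeasure x) = avg x f := by
  rw [empiricalMeasure, integral_smul_measure, integral_finsetSum_measure
    fun i _ => integrable_dirac (by simp)]
  simp [avg]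

/-- Weak convergence of empirical measures of points of an interval. -/
theorem tendsto_avg_of_weak {a b : ℝ} (hab : a ≤ b) {x : (n : ℕ) → Fin n → ℝ}
    (hxab : ∀ (n : ℕ) (i : Fin n), x n i ∈ Set.Icc a b) {μ : Measure ℝ}
    (hμ : μ (Set.Icc a b)ᶜ = 0)
    (hweak : ∀ f : BoundedContinuousFunction ℝ ℝ,
      Tendsto (fun n : ℕ => ∫ t, f t ∂(empiricalMeasure (x n))) atTop (𝓝 (∫ t, f t ∂μ)))
    {f : ℝ → ℝ} (hf : Continuous f) :
    Tendsto (fun n => avg (x n) f) atTop (𝓝 (∫ t, f t ∂μ)) := by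
  -- Constant continuation of f beyond [a, b] is bounded and changes no integral, since all measures
  -- live on the interval.
  let g : BoundedContinuousFunction ℝ ℝ := (BoundedContinuousFunction.mkOfCompact
    (⟨fun t : Set.Icc a b => f t, by fun_prop⟩ : C(Set.Icc a b, ℝ))).compContinuous
    ⟨Set.projIcc a b hab, continuous_projIcc⟩
  have hg : ∀ t ∈ Set.Icc a b, g t = f t := fun t ht => by
    change f (Set.projIcc a b hab t) = f t
    rw [Set.projIcc_of_mem hab ht]
  have h1 := hweak g
  have h2 : ∫ t, g t ∂μ = ∫ t, f t ∂μ := by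
    refine integral_congr_ae ?_
    filter_upwards [mem_ae_iff.2 hμ] with t ht using hg t ht
  rw [h2] at h1
  refine h1.congr fun n => ?_
  rw [integral_empiricalMeasure, avg, avg]
  congr 1
  exact Finset.sum_congr rfl fun j _ => hg _ (hxab n j)

theorem scaling_of_weak {a b : ℝ} (hab : a ≤ b) {q : ℕ → ℕ} {x : (n : ℕ) → Fin n → ℝ}
    (hxab : ∀ (n : ℕ) (i : Fin n), x n i ∈ Set.Icc a b) {μ : Measure ℝ}
    (hμ : μ (Set.Icc a b)ᶜ = 0)
    (hweak : ∀ f : BoundedContinuousFunction ℝ ℝ,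
      Tendsto (fun n : ℕ => ∫ t, f t ∂(empiricalMeasure (x n))) atTop (𝓝 (∫ t, f t ∂μ)))
    {α : ℝ} (hα : α < 1) (hqα : Tendsto (fun n : ℕ => (q n : ℝ) / (n : ℝ)) atTop (𝓝 α)) :
    (∀ᶠ n in atTop, q n < n) ∧
    Scaling atTop a b (1 - α) μ (fun n => n) (fun n => n - q n - 1 + 1) x := by
  have hlt : ∀ᶠ n in atTop, q n < n := by
    filter_upwards [hqα.eventually (gt_mem_nhds hα), eventually_gt_atTop 0] with n hn h0
    rw [div_lt_one (by exact_mod_cast h0)] at hn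
    exact_mod_cast hn
  refine ⟨hlt, tendsto_id, ?_, Eventually.of_forall hxab,
    fun f hf => tendsto_avg_of_weak hab hxab hμ hweak hf⟩
  refine (tendsto_const_nhds.sub hqα).congr' ?_
  filter_upwards [hlt] with n hn
  have h0 : (n : ℝ) ≠ 0 := by
    have : n ≠ 0 := by omega
    exact_mod_cast this
  rw [show n - q n - 1 + 1 = n - q n by omega, Nat.cast_sub hn.le]
  field_simp

section Solutions

variable {a b c α : ℝ} {μ : Measure ℝ} {w : ℂ}

theorem map_sub_compl_Icc (hμ : μ (Set.Icc a b)ᶜ = 0) :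
    (μ.map fun t => t - c) (Set.Icc (a - c - 1) (b - c + 1))ᶜ = 0 := by
  rw [Measure.map_apply (by fun_prop) measurableSet_Icc.compl]
  refine measure_mono_null (Set.compl_subset_compl.2 fun t ht => ?_) hμ
  constructor <;> linarith [ht.1, ht.2]

theorem map_sub_ne_dirac (hμ : ∀ t : ℝ, μ ≠ Measure.dirac t) :
    (μ.map fun t => t - c) ≠ Measure.dirac 0 := by
  intro h
  refine hμ c ?_
  have h1 := congrArg (Measure.map fun t => t + c) h
  rw [Measure.map_map (by fun_prop) (by fun_prop),
    Measure.map_dirac' (by fun_prop)] at h1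
  simpa [Function.comp_def] using h1

theorem mem_solutions_iff (hw : 0 < w.im) :
    w ∈ solutions μ α c ↔ IsCritical (μ.map fun t => t - c) (1 - α) w := by
  have h1 : ∫ t : ℝ, w / (w - t) ∂(μ.map fun t => t - c) = w * cauchyTransform μ (w + c) := by
    rw [integral_map (by fun_prop) (Continuous.aestronglyMeasurable (by
      refine continuous_const.div (by fun_prop) fun t => sub_ofReal_ne_zero hw t)),
      cauchyTransform, ← integral_const_mul]
    refine integral_congr_ae (Eventually.of_forall fun t => ?_)
    simp only
    push_cast
    rw [mul_one_div, show w + c - t = w - (t - c) by ring]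
  constructor
  · intro h
    refine ⟨hw, ?_⟩
    rw [h1, h.2]
    push_cast
    ring
  · intro h
    refine ⟨hw.ne', ?_⟩
    rw [← h1, h.integral_eq]
    push_cast
    ring

theorem conj_mem_solutions (h : w ∈ solutions μ α c) : starRingEnd ℂ w ∈ solutions μ α c := by
  refine ⟨?_, ?_⟩
  · rw [Complex.conj_im]
    exact neg_ne_zero.2 h.1
  · have h1 := congrArg (starRingEnd ℂ) h.2
    rw [map_mul, cauchyTransform, ← integral_conj] at h1
    simpa [cauchyTransform] using h1

theorem solutions_eq_pair (hw : w ∈ solutions μ α c)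
    (huniq : ∀ w' ∈ solutions μ α c, 0 < w'.im → w' = w) :
    solutions μ α c = {w, starRingEnd ℂ w} := by
  ext z
  simp only [Set.mem_insert_iff, Set.mem_singleton_iff]
  constructor
  · intro hz
    rcases lt_or_gt_of_ne hz.1 with h | h
    · right
      rw [← huniq _ (conj_mem_solutions hz) (by rw [Complex.conj_im]; linarith), Complex.conj_conj]
    · exact Or.inl (huniq z hz h)
  · rintro (rfl | rfl)
    · exact hw
    · exact conj_mem_solutions hw

theorem exists_solution_im_pos (h : (solutions μ α c).Nonempty) :
    ∃ w ∈ solutions μ α c, 0 < w.im := by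
  obtain ⟨w, hw⟩ := h
  rcases lt_or_gt_of_ne hw.1 with h | h
  · exact ⟨_, conj_mem_solutions hw, by rw [Complex.conj_im]; linarith⟩
  · exact ⟨w, hw, h⟩

theorem inv_im_neg (hw : 0 < w.im) : (w⁻¹).im < 0 := by
  rw [Complex.inv_im]
  exact div_neg_of_neg_of_pos (by linarith) (Complex.normSq_pos.2 (ne_zero_of_im_pos hw))

theorem density_pos (hα : α < 1) (hw : 0 < w.im) : 0 < density α w := by
  have h1 := inv_im_neg hw
  have h2 : 0 < (1 - α) / Real.pi := div_pos (by linarith) Real.pi_pos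
  rw [density]
  nlinarith

theorem gauge_rpow (w : ℂ) (t : ℝ) :
    gauge w ^ t = Real.exp (Real.pi * ((w⁻¹).re / (w⁻¹).im) * t) := by
  rw [gauge, ← Real.exp_mul]

end Solutions

namespace BulkScaling

variable {ι : Type*} {l : Filter ι} {A B β : ℝ} {ν : Measure ℝ}
  {N k : ι → ℕ} {d : (i : ι) → Fin (N i) → ℝ} {u : ι → ℝ} {w₀ : ℂ} {W : ι → ℂ}

theorem exists_of_scaling [IsProbabilityMeasure ν]
    (h : Scaling l A B β ν N (fun i => k i + 1) d) (hinj : ∀ᶠ i in l, Function.Injective (d i))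
    (hlt : ∀ᶠ i in l, k i + 1 < N i) {U₀ : ℝ} (hu : Tendsto (fun i => N i * u i) l (𝓝 U₀))
    (hν : ν (Set.Icc A B)ᶜ = 0) (h0 : ν ≠ Measure.dirac 0) (hc : IsCritical ν β w₀)
    (hβ : β ∈ Set.Ioo 0 1) : ∃ W, BulkScaling l A B β ν N k d u w₀ W := by
  obtain ⟨W, hW, hcrit⟩ := h.exists_tendsto_crit_eq_zero hν h0 hc
  refine ⟨W, h, hinj, ?_, hlt, ⟨|U₀| + 1, ?_⟩, hν, h0, hc, hβ.2, hW, hcrit⟩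
  -- Since β > 0, the number k + 1 tends to infinity, hence k ≠ 0 eventually.
  · have h1 := h.tendsto_ratio.pos_mul_atTop hβ.1
      (tendsto_natCast_atTop_atTop.comp h.tendsto_card)
    filter_upwards [h1.eventually (eventually_gt_atTop 1), h.eventually_card_pos] with i hi hN
    have h2 : (N i : ℝ) ≠ 0 := by exact_mod_cast hN.ne'
    simp only [Function.comp_apply] at hi
    rw [div_mul_cancel₀ _ h2] at hi
    have : 1 < k i + 1 := by exact_mod_cast hi
    omega
  · filter_upwards [hu.abs.eventually (gt_mem_nhds (lt_add_one _))] with i hi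
    rw [abs_mul, Nat.abs_cast] at hi
    exact hi.le

theorem tendsto_integral_div_card [IsProbabilityMeasure ν] [l.NeBot] [l.IsCountablyGenerated]
    (h : BulkScaling l A B β ν N k d u w₀ W) {U₀ : ℝ}
    (hu : Tendsto (fun i => N i * u i) l (𝓝 U₀)) :
    Tendsto (fun i => (k i + 1) / Real.pi * (∫ θ in Set.Ioo 0 Real.pi,
      (kernelIntegrand (d i) (k i) (u i) (polar ‖W i‖ θ)).re) / N i) l
      (𝓝 (-(β / Real.pi * (Real.exp (-(β * U₀ * (w₀⁻¹).re)) * (w₀⁻¹).im *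
        Real.sinc (β * U₀ * (w₀⁻¹).im))))) := by
  have hr : Tendsto (fun i => ((k i : ℝ) + 1) / N i) l (𝓝 β) := by
    simpa using h.scaling.tendsto_ratio
  have hκ : Tendsto (fun i => (k i : ℝ) * u i) l (𝓝 (β * U₀)) := by
    have h1 := (hr.mul hu).sub h.tendsto_u
    rw [sub_zero] at h1
    refine h1.congr' ?_
    filter_upwards [h.scaling.eventually_card_pos] with i hi
    have h2 : (N i : ℝ) ≠ 0 := by exact_mod_cast hi.ne'
    field_simp
    ring
  have h2 := (hr.div_const Real.pi).mul (h.tendsto_integral_kernelIntegrand hκ)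
  rw [integral_limitIntegrand h.isCritical.im_pos, mul_neg] at h2
  refine h2.congr fun i => ?_
  ring

end BulkScaling

/-- The index is (n, u, v) with filter `atTop ×ˢ 𝓝 p`, so a plain limit already expresses
convergence that is locally uniform in u and v. -/
theorem tendsto_rescaled_kernel {a b : ℝ} (hab : a < b) {q : ℕ → ℕ}
    (hq : ∀ n : ℕ, 1 ≤ n → 1 ≤ q n ∧ q n ≤ n) {x : (n : ℕ) → Fin n → ℝ}
    (hx : ∀ n : ℕ, StrictAnti (x n)) (hxab : ∀ (n : ℕ) (i : Fin n), x n i ∈ Set.Icc a b)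
    {μ : Measure ℝ} [IsProbabilityMeasure μ] (hμ : μ (Set.Icc a b)ᶜ = 0)
    (hμ_ne : ∀ t : ℝ, μ ≠ Measure.dirac t)
    (hweak : ∀ f : BoundedContinuousFunction ℝ ℝ,
      Tendsto (fun n : ℕ => ∫ t, f t ∂(empiricalMeasure (x n))) atTop (𝓝 (∫ t, f t ∂μ)))
    {α : ℝ} (hα : α ∈ Set.Ioo (0 : ℝ) 1)
    (hqα : Tendsto (fun n : ℕ => (q n : ℝ) / (n : ℝ)) atTop (𝓝 α))
    {c : ℝ} {w : ℂ} (hw : w ∈ solutions μ α c) (him : 0 < w.im) (p : ℝ × ℝ) :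
    Tendsto (fun i : ℕ × ℝ × ℝ =>
      gauge w ^ (i.2.2 - i.2.1) / ((i.1 : ℝ) * density α w) *
        kernel (x i.1) (q i.1) (q i.1) (c + i.2.1 / ((i.1 : ℝ) * density α w))
          (c + i.2.2 / ((i.1 : ℝ) * density α w))) (atTop ×ˢ 𝓝 p)
      (𝓝 (Real.sinc (Real.pi * (p.2 - p.1)))) := by
  obtain ⟨hlt, hbase⟩ := scaling_of_weak hab.le hxab hμ hweak hα.2 hqα
  have hρ := density_pos hα.2 him
  set ρ := density α w with hρdef
  have hfst : Tendsto (fun i : ℕ × ℝ × ℝ => i.1) (atTop ×ˢ 𝓝 p) atTop := tendsto_fst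
  have hcard : Tendsto (fun i : ℕ × ℝ × ℝ => (i.1 : ℝ)) (atTop ×ˢ 𝓝 p) atTop :=
    tendsto_natCast_atTop_atTop.comp hfst
  have h1 : Tendsto (fun i : ℕ × ℝ × ℝ => i.2.1) (atTop ×ˢ 𝓝 p) (𝓝 p.1) :=
    (continuous_fst.tendsto p).comp tendsto_snd
  have h2 : Tendsto (fun i : ℕ × ℝ × ℝ => i.2.2) (atTop ×ˢ 𝓝 p) (𝓝 p.2) :=
    (continuous_snd.tendsto p).comp tendsto_snd
  have hv : Tendsto (fun i : ℕ × ℝ × ℝ => c + i.2.2 / ((i.1 : ℝ) * ρ)) (atTop ×ˢ 𝓝 p) (𝓝 c) := by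
    simpa using (h2.div_atTop (hcard.atTop_mul_const hρ)).const_add c
  have hsc := hbase.comp_sub hfst hv
  have hltl := hfst.eventually hlt
  have hposl := hfst.eventually (eventually_gt_atTop 0)
  have hu : Tendsto (fun i : ℕ × ℝ × ℝ => (i.1 : ℝ) *
      ((c + i.2.1 / ((i.1 : ℝ) * ρ)) - (c + i.2.2 / ((i.1 : ℝ) * ρ)))) (atTop ×ˢ 𝓝 p)
      (𝓝 ((p.1 - p.2) / ρ)) := by
    refine ((h1.sub h2).div_const ρ).congr' ?_
    filter_upwards [hposl] with i hi
    have : (i.1 : ℝ) ≠ 0 := by exact_mod_cast hi.ne'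
    field_simp
    ring
  have hprob : IsProbabilityMeasure (μ.map fun t => t - c) :=
    Measure.isProbabilityMeasure_map (by fun_prop)
  obtain ⟨W, hW⟩ := BulkScaling.exists_of_scaling
    (k := fun i : ℕ × ℝ × ℝ => i.1 - q i.1 - 1) hsc
    (Eventually.of_forall fun i => (sub_left_injective).comp (hx i.1).injective)
    (by
      filter_upwards [hltl, hposl] with i hi hi0
      have := (hq i.1 hi0).1
      omega) hu (map_sub_compl_Icc hμ) (map_sub_ne_dirac hμ_ne)
    ((mem_solutions_iff him).1 hw) ⟨by linarith [hα.2], by linarith [hα.1]⟩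
  have hlim := hW.tendsto_integral_div_card hu
  have hgauge : Tendsto (fun i : ℕ × ℝ × ℝ => gauge w ^ (i.2.2 - i.2.1) / ρ) (atTop ×ˢ 𝓝 p)
      (𝓝 (gauge w ^ (p.2 - p.1) / ρ)) := by
    simp only [gauge_rpow]
    exact ((Real.continuous_exp.tendsto _).comp ((h2.sub h1).const_mul _)).div_const ρ
  have hprod := hgauge.mul hlim
  -- The density ρ = -((1 - α)/π) Im w⁻¹ is exactly what makes the argument of sinc equal π (v - u),
  -- and the gauge cancels the remaining exponential.
  have hval : gauge w ^ (p.2 - p.1) / ρ * -((1 - α) / Real.pi *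
      (Real.exp (-((1 - α) * ((p.1 - p.2) / ρ) * (w⁻¹).re)) * (w⁻¹).im *
        Real.sinc ((1 - α) * ((p.1 - p.2) / ρ) * (w⁻¹).im))) =
      Real.sinc (Real.pi * (p.2 - p.1)) := by
    have hy := inv_im_neg him
    have hβ : 0 < 1 - α := by linarith [hα.2]
    rw [gauge_rpow, hρdef, density]
    generalize (w⁻¹).im = y at hy
    generalize (w⁻¹).re = z
    have hy' := hy.ne
    have hπ := Real.pi_ne_zero
    have e1 : (1 - α) * ((p.1 - p.2) / (-((1 - α) / Real.pi) * y)) * y =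
        Real.pi * (p.2 - p.1) := by
      field_simp
      ring
    have e2 : -((1 - α) * ((p.1 - p.2) / (-((1 - α) / Real.pi) * y)) * z) =
        -(Real.pi * (z / y) * (p.2 - p.1)) := by
      field_simp
      ring
    rw [e1, e2, Real.exp_neg]
    have := Real.exp_ne_zero (Real.pi * (z / y) * (p.2 - p.1))
    field_simp
  rw [hval] at hprod
  refine hprod.congr' ?_
  filter_upwards [hltl, hposl, hW.ne_zero, hW.eventually_root_im_pos] with i hi hi0 hk hWi
  have hn : (i.1 : ℝ) ≠ 0 := by exact_mod_cast hi0.ne'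
  rw [kernel_eq_integral (hx i.1).injective (k := i.1 - q i.1 - 1) (by omega) hk _ _
    (norm_pos_iff.2 (ne_zero_of_im_pos hWi))]
  generalize ∫ θ in Set.Ioo 0 Real.pi, (kernelIntegrand (fun j => x i.1 j - _) _ _ _).re = J
  field_simp

theorem tendstoUniformlyOn_of_tendsto_prod {ι X : Type*} [TopologicalSpace X] {l : Filter ι}
    {F : ι → X → ℝ} {f : X → ℝ} (hf : Continuous f)
    (h : ∀ p, Tendsto (fun i : ι × X => F i.1 i.2) (l ×ˢ 𝓝 p) (𝓝 (f p))) {S : Set X}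
    (hS : IsCompact S) : TendstoUniformlyOn F f l S := by
  rw [← tendstoLocallyUniformlyOn_iff_tendstoUniformlyOn_of_compact hS]
  refine TendstoLocallyUniformly.tendstoLocallyUniformlyOn ?_
  rw [tendstoLocallyUniformly_iff_forall_tendsto]
  intro p
  refine Tendsto.mono_right ?_ (nhds_le_uniformity (f p))
  exact (((hf.tendsto p).comp tendsto_snd).prodMk_nhds (h p))

end GelfandTsetlin

theorem mainTheorem1
    (a b : ℝ) (hab : a < b)
    (q : ℕ → ℕ) (hq : ∀ n : ℕ, 1 ≤ n → 1 ≤ q n ∧ q n ≤ n)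
    (x : (n : ℕ) → Fin n → ℝ) (hx : ∀ n : ℕ, StrictAnti (x n))
    (hxab : ∀ (n : ℕ) (i : Fin n), x n i ∈ Set.Icc a b)
    (μ : Measure ℝ) [IsProbabilityMeasure μ]
    (hμ_supp : μ (Set.Icc a b)ᶜ = 0) (hμ_ne : ∀ t : ℝ, μ ≠ Measure.dirac t)
    (hweak : ∀ f : BoundedContinuousFunction ℝ ℝ,
      Tendsto (fun n : ℕ => ∫ t, f t ∂(GelfandTsetlin.empiricalMeasure (x n))) atTop
        (𝓝 (∫ t, f t ∂μ)))
    (α : ℝ) (hα : α ∈ Set.Ioo (0 : ℝ) 1)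
    (hqα : Tendsto (fun n : ℕ => (q n : ℝ) / (n : ℝ)) atTop (𝓝 α)) :
    (∀ (n : ℕ) (r : Fin n), r.val + 1 = q n → q n < n →
      GelfandTsetlin.IsCorrelationKernel (GelfandTsetlin.uniformPattern (x n))
        (fun y : GelfandTsetlin.TriArray n => y r)
        (fun u v => GelfandTsetlin.kernel (x n) (q n) (q n) u v)) ∧
    ∀ c ∈ GelfandTsetlin.bulkSet μ α a b,
      ∃ w : ℂ, 0 < w.im ∧
        GelfandTsetlin.solutions μ α c = {w, (starRingEnd ℂ) w} ∧
        ∀ U V : Set ℝ, IsCompact U → IsCompact V →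
          TendstoUniformlyOn
            (fun (n : ℕ) (p : ℝ × ℝ) =>
              GelfandTsetlin.gauge w ^ (p.2 - p.1) / ((n : ℝ) * GelfandTsetlin.density α w) *
                GelfandTsetlin.kernel (x n) (q n) (q n)
                  (c + p.1 / ((n : ℝ) * GelfandTsetlin.density α w))
                  (c + p.2 / ((n : ℝ) * GelfandTsetlin.density α w)))
            (fun p : ℝ × ℝ => Real.sinc (Real.pi * (p.2 - p.1)))
            atTop (U ×ˢ V) := by
  refine ⟨fun n r hr hrn => ?_, fun c hc => ?_⟩
  · rw [← hr]
    exact GelfandTsetlin.isCorrelationKernel_kernel (hx n) r (by omega)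
  obtain ⟨w, hw, him⟩ := GelfandTsetlin.exists_solution_im_pos hc.2
  refine ⟨w, him, GelfandTsetlin.solutions_eq_pair hw fun w' hw' him' => ?_, fun U V hU hV => ?_⟩
  · have : IsProbabilityMeasure (μ.map fun t => t - c) :=
      Measure.isProbabilityMeasure_map (by fun_prop)
    have hbase := (GelfandTsetlin.scaling_of_weak hab.le hxab hμ_supp hweak hα.2 hqα).2
    -- Uniqueness concerns μ alone; the recentred configurations serve as the finite approximations
    -- needed by the maximum principle.
    exact (hbase.comp_sub tendsto_id (tendsto_const_nhds (x := c))).isCritical_unique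
      (GelfandTsetlin.map_sub_compl_Icc hμ_supp) (GelfandTsetlin.map_sub_ne_dirac hμ_ne)
      ((GelfandTsetlin.mem_solutions_iff him).1 hw) ((GelfandTsetlin.mem_solutions_iff him').1 hw')
  · exact GelfandTsetlin.tendstoUniformlyOn_of_tendsto_prod
      (Real.continuous_sinc.comp (by fun_prop))
      (GelfandTsetlin.tendsto_rescaled_kernel hab hq hx hxab hμ_supp hμ_ne hweak hα hqα hw him)
      (hU.prod hV)
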